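/- Let $(\mathcal M,\circ,I,\bullet,J)$ be a duoidal (i.e. 2-monoidal) category, with interchange law $\zeta_{X,Y,Z,W}:(X\bullet Y)\circ(Z\bullet W)\to(X\circ Z)\bullet(Y\circ W)$ and unit maps $\delta:I\to I\bullet I$, $\varpi:J\circ J\to J$, $\tau:I\to J$; associators and unitors are suppressed in the formulas below, and $fg$ denotes the composite "first $g$, then $f$". Assume that idempotent morphisms in $\mathcal M$ split. **Weak bimonoid.** Let $A$ be an object with a monoid structure $(\mu,\eta)$ with respect to $\circ$ and a comonoid structure $(\Delta,\varepsilon)$ with respect to $\bullet$. Then $A$ is a weak bimonoid if $\Delta\mu=(\mu\bullet\mu)\,\zeta\,(\Delta\circ\Delta)$ and the following eight conditions hold. Put $u=\Delta\eta:I\to A\bullet A$, $e=\varepsilon\mu:A\circ A\to J$, and $\Delta^2=(\Delta\bullet A)\Delta$. * Unit conditions, for morphisms $I\to I\bullet A\bullet A\bullet A$: the two composites $$(I\bullet A\bullet\mu\bullet A)\,(\zeta\bullet A)\,\big(((I\bullet A)\circ((I\bullet u)\delta))\bullet A\big)\,(I\bullet u)\,\delta,$$ $$(I\bullet A\bullet\mu\bullet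 A)\,(\zeta\bullet A)\,\big((((I\bullet u)\delta)\circ(I\bullet A))\bullet A\big)\,(I\bullet u)\,\delta$$ are both equal to $(I\bullet(A\bullet\Delta)\Delta\eta)\delta$. Here $\zeta=\zeta_{I,A,I\bullet A,A}$ in the first composite and $\zeta=\zeta_{I\bullet A,A,I,A}$ in the second. * The mirror images of these two conditions under reversing the order of $\bullet$, for morphisms $I\to A\bullet A\bullet A\bullet I$. * Counit conditions, for morphisms $J\circ A\circ A\circ A\to J$: the two composites $$\varpi(J\circ e)\,\big(((\varpi(J\circ e))\bullet(J\circ A))\circ A\big)\,(\zeta\circ A)\,(J\circ A\circ\Delta\circ A),$$ $$\varpi(J\circ e)\,\big(((J\circ A)\bullet(\varpi(J\circ e)))\circ A\big)\,(\zeta\circ A)\,(J\circ A\circ\Delta\circ A)$$ are both equal to $\varpi(J\circ\varepsilon)(J\circ\mu)(J\circ A\circ\mu)$. Here $\zeta=\zeta_{J\circ A,J,A,A}$ in the first composite and $\zeta=\zeta_{J,J\circ A,A,A}$ in the second. * The mirror images of these two conditions under reversing the order of $\circ$, for morphisms $A\circ A\circ A\circ J\to J$. **Notation.** Let $A$ be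 a weak bimonoid. * *Modules and Hopf modules.* $\mathcal M_A$ is the category of right $A$-modules with respect to $\circ$. Put $\psi_M=((M\circ A)\bullet\mu)\,\zeta\,((M\bullet A)\circ\Delta):(M\bullet A)\circ A\to(M\circ A)\bullet A$. The category $\mathcal M^A_A$ of Hopf modules consists of the right $A$-modules $(M,\gamma)$ with a right $A$-coaction $\varrho:M\to M\bullet A$ such that $\varrho\gamma=(\gamma\bullet A)\psi_M(\varrho\circ A)$; its morphisms are the maps that are both $A$-linear and $A$-colinear. * *Weakly lifted comonad.* $(-)\bullet_{R_\circ}A$ is the comonad on $\mathcal M_A$ obtained by splitting, for $(Q,\gamma)\in\mathcal M_A$, the idempotent $(\gamma\bullet A)\psi_Q((Q\bullet A)\circ\eta)$ of $Q\bullet A$ as $Q\bullet A\xrightarrow{\pi^R_Q}Q\bullet_{R_\circ}A\xrightarrow{\iota^R_Q}Q\bullet A$. The $A$-action is $\pi^R_Q(\gamma\bullet A)\psi_Q(\iota^R_Q\circ A)$. The comonad structure is the one that makes $\iota^R$ a comonad morphism over the forgetful functor $\mathcal M_A\to\mathcal M$ to the comonad $(-)\bullet A$. * *Base monoid.* $L_\bullet$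 is obtained by splitting the idempotent $$A\bullet I\xrightarrow{\;\delta\circ(A\bullet I)\;}(I\bullet I)\circ(A\bullet I)\xrightarrow{\;(u\bullet I)\circ(A\bullet I)\;}(A\bullet A\bullet I)\circ(A\bullet I)\xrightarrow{\;\zeta\;}(A\circ A)\bullet A\bullet I\xrightarrow{\;e\bullet A\bullet I\;}A\bullet I$$ as $A\bullet I\xrightarrow{\pi}L_\bullet\xrightarrow{\iota}A\bullet I$. Its multiplication is $\pi(\mu\bullet I)\zeta(\iota\circ\iota)$, its unit is $\pi(\eta\bullet I)\delta$, and its right $I$-coaction is $(\pi\bullet I)(A\bullet\delta)\iota$. Let $\omega=(A\bullet\tau)\iota:L_\bullet\to A$. * *Modules over the base.* $\mathcal M_{L_\bullet}$ is the category of right $L_\bullet$-modules with respect to $\circ$. $\mathcal M^I$ is the category of right comodules of the $\bullet$-comonoid $(I,\delta,\tau)$. $\mathcal M^I_{L_\bullet}$ is the category of right $L_\bullet$-modules in $\mathcal M^I$, where $P\circ L_\bullet$ has the coaction $\zeta(\varrho_P\circ\varrho_{L_\bullet})$. The functor $\omega^*=(-)\circ_{L_\bullet}A:\mathcal M_{L_\bullet}\to\mathcal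 M_A$ is given by the coequalizers $\pi^L_P:P\circ A\to P\circ_{L_\bullet}A$ of the two maps $P\circ L_\bullet\circ A\rightrightarrows P\circ A$ induced by the action on $P$ and by $\mu(\omega\circ A)$. **Proposition.** The above idempotents, coequalizers and structures exist: $L_\bullet$ is a monoid in $\mathcal M^I$; the comonad $(-)\bullet I$ lifts from $\mathcal M$ to $\mathcal M_{L_\bullet}$, with the action on $P\bullet I$ built from $\zeta$, the coaction of $L_\bullet$ and the action on $P$; and the functor $\omega^*$ and the comonad $(-)\bullet_{R_\circ}A$ exist. The forgetful functors $\mathcal M^I_{L_\bullet}\to\mathcal M_{L_\bullet}$ and $\mathcal M^A_A\to\mathcal M_A$ are comonadic. There is a natural transformation $$\lambda_P:(P\bullet I)\circ_{L_\bullet}A\to(P\circ_{L_\bullet}A)\bullet_{R_\circ}A\qquad(P\in\mathcal M_{L_\bullet})$$ of functors $\mathcal M_{L_\bullet}\to\mathcal M_A$, each of whose components is uniquely determined, as a morphism of $\mathcal M$, by $$\lambda_P\,\pi^L_{P\bullet I}=(\pi^L_P\bullet_{R_\circ}A)\,\lambda^0_P,\qquad \lambda^0_P=\pi^R_{P\circ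 A}\,\zeta\,((P\bullet I)\circ\Delta),$$ and $\lambda$ is a comonad morphism over $\omega^*$ (compatible with the comultiplications and the counits) from $(-)\bullet I$ to $(-)\bullet_{R_\circ}A$. Moreover, $\omega^*$ lifts to a functor $F:\mathcal M^I_{L_\bullet}\to\mathcal M^A_A$, that is, $$\big(\mathcal M^I_{L_\bullet}\xrightarrow{F}\mathcal M^A_A\to\mathcal M_A\big)=\big(\mathcal M^I_{L_\bullet}\to\mathcal M_{L_\bullet}\xrightarrow{\omega^*}\mathcal M_A\big)$$ with the forgetful functors unnamed, and the Hopf module $F(P,\varrho)$ has the coaction $\iota^R_{P\circ_{L_\bullet}A}\,\lambda_P\,(\varrho\circ_{L_\bullet}A)$. -/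

import Mathlib

open CategoryTheory

universe v u

namespace Duo

/-! ### Duoidal categories -/

/-- A category with two (not necessarily strict) monoidal structures: `circ` is the first product
`∘` with unit `I`, and `bull` is the second product `•` with unit `J`. -/
class TwoMonoidal (C : Type u) [Category.{v} C] where
  circ : MonoidalCategory C
  bull : MonoidalCategory C

section Products

variable {C : Type u} [Category.{v} C] [TwoMonoidal C]

/-- The object `X ∘ Y`. -/
abbrev cT (X Y : C) : C := TwoMonoidal.circ.tensorObj X Y
/-- The morphism `f ∘ g`. -/
abbrev cH {X Y Z W : C} (f : X ⟶ Y) (g : Z ⟶ W) : cT X Z ⟶ cT Y W :=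
  TwoMonoidal.circ.tensorHom f g
/-- The morphism `X ∘ f`. -/
abbrev cL (X : C) {Y Z : C} (f : Y ⟶ Z) : cT X Y ⟶ cT X Z := TwoMonoidal.circ.whiskerLeft X f
/-- The morphism `f ∘ X`. -/
abbrev cR {Y Z : C} (f : Y ⟶ Z) (X : C) : cT Y X ⟶ cT Z X := TwoMonoidal.circ.whiskerRight f X
/-- The `∘`-monoidal unit. -/
abbrev unitI (C : Type u) [Category.{v} C] [TwoMonoidal C] : C :=
  (TwoMonoidal.circ (C := C)).tensorUnit
abbrev cAs (X Y Z : C) : cT (cT X Y) Z ≅ cT X (cT Y Z) := TwoMonoidal.circ.associator X Y Z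
abbrev cLu (X : C) : cT (unitI C) X ≅ X := TwoMonoidal.circ.leftUnitor X
abbrev cRu (X : C) : cT X (unitI C) ≅ X := TwoMonoidal.circ.rightUnitor X

/-- The object `X • Y`. -/
abbrev bT (X Y : C) : C := TwoMonoidal.bull.tensorObj X Y
/-- The morphism `f • g`. -/
abbrev bH {X Y Z W : C} (f : X ⟶ Y) (g : Z ⟶ W) : bT X Z ⟶ bT Y W :=
  TwoMonoidal.bull.tensorHom f g
/-- The morphism `X • f`. -/
abbrev bL (X : C) {Y Z : C} (f : Y ⟶ Z) : bT X Y ⟶ bT X Z := TwoMonoidal.bull.whiskerLeft X f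
/-- The morphism `f • X`. -/
abbrev bR {Y Z : C} (f : Y ⟶ Z) (X : C) : bT Y X ⟶ bT Z X := TwoMonoidal.bull.whiskerRight f X
/-- The `•`-monoidal unit. -/
abbrev unitJ (C : Type u) [Category.{v} C] [TwoMonoidal C] : C :=
  (TwoMonoidal.bull (C := C)).tensorUnit
abbrev bAs (X Y Z : C) : bT (bT X Y) Z ≅ bT X (bT Y Z) := TwoMonoidal.bull.associator X Y Z
abbrev bLu (X : C) : bT (unitJ C) X ≅ X := TwoMonoidal.bull.leftUnitor X
abbrev bRu (X : C) : bT X (unitJ C) ≅ X := TwoMonoidal.bull.rightUnitor X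

end Products

infixr:70 " ⊚ " => cT
infixr:70 " ⊚ₘ " => cH
infixr:81 " ⊚◁ " => cL
infixl:81 " ▷⊚ " => cR
infixr:70 " ⊙ " => bT
infixr:70 " ⊙ₘ " => bH
infixr:81 " ⊙◁ " => bL
infixl:81 " ▷⊙ " => bR

/-- A duoidal category (also called a 2-monoidal category); associators and unitors are written
out. The first product `∘` is `⊚`, the second product `•` is `⊙`. -/
class Duoidal (C : Type u) [Category.{v} C] extends TwoMonoidal C where
  δ : unitI C ⟶ unitI C ⊙ unitI C
  ϖ : unitJ C ⊚ unitJ C ⟶ unitJ C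
  τ : unitI C ⟶ unitJ C
  /-- The interchange law. -/
  ζ : ∀ X Y Z W : C, (X ⊙ Y) ⊚ (Z ⊙ W) ⟶ (X ⊚ Z) ⊙ (Y ⊚ W)
  ζ_natural : ∀ {X X' Y Y' Z Z' W W' : C} (f : X ⟶ X') (g : Y ⟶ Y') (h : Z ⟶ Z') (k : W ⟶ W'),
    ((f ⊙ₘ g) ⊚ₘ (h ⊙ₘ k)) ≫ ζ X' Y' Z' W' = ζ X Y Z W ≫ ((f ⊚ₘ h) ⊙ₘ (g ⊚ₘ k))
  -- `(J, ϖ, τ)` is a monoid with respect to `∘`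
  ϖ_one_left : (τ ▷⊚ unitJ C) ≫ ϖ = (cLu (unitJ C)).hom
  ϖ_one_right : (unitJ C ⊚◁ τ) ≫ ϖ = (cRu (unitJ C)).hom
  ϖ_assoc : (ϖ ▷⊚ unitJ C) ≫ ϖ =
    (cAs (unitJ C) (unitJ C) (unitJ C)).hom ≫ (unitJ C ⊚◁ ϖ) ≫ ϖ
  -- `(I, δ, τ)` is a comonoid with respect to `•`
  δ_counit_left : δ ≫ (τ ▷⊙ unitI C) = (bLu (unitI C)).inv
  δ_counit_right : δ ≫ (unitI C ⊙◁ τ) = (bRu (unitI C)).inv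
  δ_coassoc : δ ≫ (δ ▷⊙ unitI C) ≫ (bAs (unitI C) (unitI C) (unitI C)).hom =
    δ ≫ (unitI C ⊙◁ δ)
  -- associativity
  ζ_circ_assoc : ∀ X Y Z W U V : C,
    (ζ X Y Z W ▷⊚ (U ⊙ V)) ≫ ζ (X ⊚ Z) (Y ⊚ W) U V ≫ ((cAs X Z U).hom ⊙ₘ (cAs Y W V).hom) =
      (cAs (X ⊙ Y) (Z ⊙ W) (U ⊙ V)).hom ≫ ((X ⊙ Y) ⊚◁ ζ Z W U V) ≫ ζ X Y (Z ⊚ U) (W ⊚ V)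
  ζ_bull_assoc : ∀ X Y Z W U V : C,
    ζ (X ⊙ Y) Z (W ⊙ U) V ≫ (ζ X Y W U ▷⊙ (Z ⊚ V)) ≫ (bAs (X ⊚ W) (Y ⊚ U) (Z ⊚ V)).hom =
      ((bAs X Y Z).hom ⊚ₘ (bAs W U V).hom) ≫ ζ X (Y ⊙ Z) W (U ⊙ V) ≫
        ((X ⊚ W) ⊙◁ ζ Y Z U V)
  -- unitality
  ζ_δ_left : ∀ X Y : C,
    (cLu (X ⊙ Y)).inv ≫ (δ ▷⊚ (X ⊙ Y)) ≫ ζ (unitI C) (unitI C) X Y ≫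
      ((cLu X).hom ⊙ₘ (cLu Y).hom) = 𝟙 (X ⊙ Y)
  ζ_δ_right : ∀ X Y : C,
    (cRu (X ⊙ Y)).inv ≫ ((X ⊙ Y) ⊚◁ δ) ≫ ζ X Y (unitI C) (unitI C) ≫
      ((cRu X).hom ⊙ₘ (cRu Y).hom) = 𝟙 (X ⊙ Y)
  ζ_ϖ_left : ∀ X Y : C,
    ((bLu X).inv ⊚ₘ (bLu Y).inv) ≫ ζ (unitJ C) X (unitJ C) Y ≫ (ϖ ▷⊙ (X ⊚ Y)) ≫
      (bLu (X ⊚ Y)).hom = 𝟙 (X ⊚ Y)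
  ζ_ϖ_right : ∀ X Y : C,
    ((bRu X).inv ⊚ₘ (bRu Y).inv) ≫ ζ X (unitJ C) Y (unitJ C) ≫ ((X ⊚ Y) ⊙◁ ϖ) ≫
      (bRu (X ⊚ Y)).hom = 𝟙 (X ⊚ Y)

/-! ### Weak bimonoids -/

/-- An object `A` with a monoid structure with respect to `∘` and a comonoid structure with respect
to `•`. -/
structure MonComon (C : Type u) [Category.{v} C] [TwoMonoidal C] where
  A : C
  mon : @MonObj C _ TwoMonoidal.circ A
  comon : @ComonObj C _ TwoMonoidal.bull A

namespace MonComon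

variable {C : Type u} [Category.{v} C] [TwoMonoidal C] (H : MonComon C)

/-- The multiplication `A ∘ A ⟶ A`. -/
abbrev μ : H.A ⊚ H.A ⟶ H.A := H.mon.mul
/-- The unit `I ⟶ A`. -/
abbrev η : unitI C ⟶ H.A := H.mon.one
/-- The comultiplication `A ⟶ A • A`. -/
abbrev Δ : H.A ⟶ H.A ⊙ H.A := H.comon.comul
/-- The counit `A ⟶ J`. -/
abbrev ε : H.A ⟶ unitJ C := H.comon.counit

end MonComon

open Duoidal

section WeakBimonoid

variable {C : Type u} [Category.{v} C] [Duoidal C]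

/-- The common path `J ∘ A ∘ A ∘ A ⟶ J` of the two right-handed counit axioms. -/
abbrev counitPathR (H : MonComon C) : ((unitJ C ⊚ H.A) ⊚ H.A) ⊚ H.A ⟶ unitJ C :=
  (cAs (unitJ C ⊚ H.A) H.A H.A).hom ≫ ((unitJ C ⊚ H.A) ⊚◁ H.μ) ≫
    (cAs (unitJ C) H.A H.A).hom ≫ (unitJ C ⊚◁ H.μ) ≫ (unitJ C ⊚◁ H.ε) ≫ ϖ

/-- The common path `A ∘ A ∘ A ∘ J ⟶ J` of the two left-handed counit axioms. -/
abbrev counitPathL (H : MonComon C) : H.A ⊚ (H.A ⊚ (H.A ⊚ unitJ C)) ⟶ unitJ C :=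
  (cAs H.A H.A (H.A ⊚ unitJ C)).inv ≫ (H.μ ▷⊚ (H.A ⊚ unitJ C)) ≫
    (cAs H.A H.A (unitJ C)).inv ≫ (H.μ ▷⊚ unitJ C) ≫ (H.ε ▷⊚ unitJ C) ≫ ϖ

/-- The common path `I ⟶ I • A • A • A` of the unit axioms with `I` on the left. -/
abbrev unitPathR (H : MonComon C) : unitI C ⟶ ((unitI C ⊙ H.A) ⊙ H.A) ⊙ H.A :=
  δ ≫ (unitI C ⊙◁ H.η) ≫ (unitI C ⊙◁ H.Δ) ≫ (bAs (unitI C) H.A H.A).inv ≫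
    ((unitI C ⊙ H.A) ⊙◁ H.Δ) ≫ (bAs (unitI C ⊙ H.A) H.A H.A).inv

/-- The common path `I ⟶ A • A • A • I` of the unit axioms with `I` on the right. -/
abbrev unitPathL (H : MonComon C) : unitI C ⟶ H.A ⊙ (H.A ⊙ (H.A ⊙ unitI C)) :=
  δ ≫ (H.η ▷⊙ unitI C) ≫ (H.Δ ▷⊙ unitI C) ≫ (bAs H.A H.A (unitI C)).hom ≫
    (H.Δ ▷⊙ (H.A ⊙ unitI C)) ≫ (bAs H.A H.A (H.A ⊙ unitI C)).hom

/-- The multiplication is comultiplicative. -/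
def AxWB (H : MonComon C) : Prop :=
  H.μ ≫ H.Δ = (H.Δ ⊚ₘ H.Δ) ≫ ζ H.A H.A H.A H.A ≫ (H.μ ⊙ₘ H.μ)

def AxRRU (H : MonComon C) : Prop :=
  δ ≫ (unitI C ⊙◁ (H.η ≫ H.Δ)) ≫ (bAs (unitI C) H.A H.A).inv ≫
    (((cRu (unitI C ⊙ H.A)).inv ≫ ((unitI C ⊙ H.A) ⊚◁ δ) ≫
      ((unitI C ⊙ H.A) ⊚◁ ((unitI C ⊙◁ (H.η ≫ H.Δ)) ≫ (bAs (unitI C) H.A H.A).inv)) ≫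
      ζ (unitI C) H.A (unitI C ⊙ H.A) H.A ≫
      ((cLu (unitI C ⊙ H.A)).hom ⊙ₘ H.μ)) ▷⊙ H.A) = unitPathR H

def AxLRU (H : MonComon C) : Prop :=
  δ ≫ ((H.η ≫ H.Δ) ▷⊙ unitI C) ≫ (bAs H.A H.A (unitI C)).hom ≫
    (H.A ⊙◁ ((cRu (H.A ⊙ unitI C)).inv ≫ ((H.A ⊙ unitI C) ⊚◁ δ) ≫
      ((H.A ⊙ unitI C) ⊚◁ (((H.η ≫ H.Δ) ▷⊙ unitI C) ≫ (bAs H.A H.A (unitI C)).hom)) ≫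
      ζ H.A (unitI C) H.A (H.A ⊙ unitI C) ≫
      (H.μ ⊙ₘ (cLu (H.A ⊙ unitI C)).hom))) = unitPathL H

def AxRLU (H : MonComon C) : Prop :=
  δ ≫ (unitI C ⊙◁ (H.η ≫ H.Δ)) ≫ (bAs (unitI C) H.A H.A).inv ≫
    (((cLu (unitI C ⊙ H.A)).inv ≫ (δ ▷⊚ (unitI C ⊙ H.A)) ≫
      (((unitI C ⊙◁ (H.η ≫ H.Δ)) ≫ (bAs (unitI C) H.A H.A).inv) ▷⊚ (unitI C ⊙ H.A)) ≫
      ζ (unitI C ⊙ H.A) H.A (unitI C) H.A ≫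
      ((cRu (unitI C ⊙ H.A)).hom ⊙ₘ H.μ)) ▷⊙ H.A) = unitPathR H

def AxLLU (H : MonComon C) : Prop :=
  δ ≫ ((H.η ≫ H.Δ) ▷⊙ unitI C) ≫ (bAs H.A H.A (unitI C)).hom ≫
    (H.A ⊙◁ ((cLu (H.A ⊙ unitI C)).inv ≫ (δ ▷⊚ (H.A ⊙ unitI C)) ≫
      ((((H.η ≫ H.Δ) ▷⊙ unitI C) ≫ (bAs H.A H.A (unitI C)).hom) ▷⊚ (H.A ⊙ unitI C)) ≫
      ζ H.A (H.A ⊙ unitI C) H.A (unitI C) ≫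
      (H.μ ⊙ₘ (cRu (H.A ⊙ unitI C)).hom))) = unitPathL H

def AxLRC (H : MonComon C) : Prop :=
  ((((unitJ C ⊚ H.A) ⊚◁ H.Δ) ≫ ((bRu (unitJ C ⊚ H.A)).inv ▷⊚ (H.A ⊙ H.A)) ≫
      ζ (unitJ C ⊚ H.A) (unitJ C) H.A H.A ≫
      (((cAs (unitJ C) H.A H.A).hom ≫ (unitJ C ⊚◁ (H.μ ≫ H.ε)) ≫ ϖ) ▷⊙ (unitJ C ⊚ H.A)) ≫
      (bLu (unitJ C ⊚ H.A)).hom) ▷⊚ H.A) ≫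
    (cAs (unitJ C) H.A H.A).hom ≫ (unitJ C ⊚◁ (H.μ ≫ H.ε)) ≫ ϖ = counitPathR H

def AxLLC (H : MonComon C) : Prop :=
  ((((unitJ C ⊚ H.A) ⊚◁ H.Δ) ≫ ((bLu (unitJ C ⊚ H.A)).inv ▷⊚ (H.A ⊙ H.A)) ≫
      ζ (unitJ C) (unitJ C ⊚ H.A) H.A H.A ≫
      ((unitJ C ⊚ H.A) ⊙◁ ((cAs (unitJ C) H.A H.A).hom ≫ (unitJ C ⊚◁ (H.μ ≫ H.ε)) ≫ ϖ)) ≫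
      (bRu (unitJ C ⊚ H.A)).hom) ▷⊚ H.A) ≫
    (cAs (unitJ C) H.A H.A).hom ≫ (unitJ C ⊚◁ (H.μ ≫ H.ε)) ≫ ϖ = counitPathR H

def AxRRC (H : MonComon C) : Prop :=
  (H.A ⊚◁ ((H.Δ ▷⊚ (H.A ⊚ unitJ C)) ≫ ((H.A ⊙ H.A) ⊚◁ (bRu (H.A ⊚ unitJ C)).inv) ≫
      ζ H.A H.A (H.A ⊚ unitJ C) (unitJ C) ≫
      (((cAs H.A H.A (unitJ C)).inv ≫ ((H.μ ≫ H.ε) ▷⊚ unitJ C) ≫ ϖ) ▷⊙ (H.A ⊚ unitJ C)) ≫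
      (bLu (H.A ⊚ unitJ C)).hom)) ≫
    (cAs H.A H.A (unitJ C)).inv ≫ ((H.μ ≫ H.ε) ▷⊚ unitJ C) ≫ ϖ = counitPathL H

def AxRLC (H : MonComon C) : Prop :=
  (H.A ⊚◁ ((H.Δ ▷⊚ (H.A ⊚ unitJ C)) ≫ ((H.A ⊙ H.A) ⊚◁ (bLu (H.A ⊚ unitJ C)).inv) ≫
      ζ H.A H.A (unitJ C) (H.A ⊚ unitJ C) ≫
      ((H.A ⊚ unitJ C) ⊙◁ ((cAs H.A H.A (unitJ C)).inv ≫ ((H.μ ≫ H.ε) ▷⊚ unitJ C) ≫ ϖ)) ≫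
      (bRu (H.A ⊚ unitJ C)).hom)) ≫
    (cAs H.A H.A (unitJ C)).inv ≫ ((H.μ ≫ H.ε) ▷⊚ unitJ C) ≫ ϖ = counitPathL H

/-- Right weak bimonoids. -/
structure IsRightWeakBimonoid (H : MonComon C) : Prop where
  wb : AxWB H
  rru : AxRRU H
  lru : AxLRU H
  lrc : AxLRC H
  llc : AxLLC H

/-- Left weak bimonoids. -/
structure IsLeftWeakBimonoid (H : MonComon C) : Prop where
  wb : AxWB H
  rlu : AxRLU H
  llu : AxLLU H
  rlc : AxRLC H
  rrc : AxRRC H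

/-- A weak bimonoid is both a right and a left weak bimonoid. -/
structure IsWeakBimonoid (H : MonComon C) : Prop where
  right : IsRightWeakBimonoid H
  left : IsLeftWeakBimonoid H

end WeakBimonoid

/-! ### Modules and mixed modules -/

/-- The data needed to speak of right modules over a `∘`-monoid `X` and of right comodules over a
`•`-comonoid `Y`, together with maps `ψ` that formulate their compatibility.
It is only used for the two instances `hopfData` and `baseData` below. -/
structure MixedData (C : Type u) [Category.{v} C] [TwoMonoidal C] where
  X : C
  mul : X ⊚ X ⟶ X
  one : unitI C ⟶ X
  Y : C
  comul : Y ⟶ Y ⊙ Y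
  counit : Y ⟶ unitJ C
  ψ : ∀ M : C, (M ⊙ Y) ⊚ X ⟶ (M ⊚ X) ⊙ Y

section Modules

variable {C : Type u} [Category.{v} C] [TwoMonoidal C]

/-- Right `X`-modules with respect to `∘`. -/
structure RMod (D : MixedData C) where
  carrier : C
  act : carrier ⊚ D.X ⟶ carrier
  act_one : (carrier ⊚◁ D.one) ≫ act = (cRu carrier).hom
  act_act : (act ▷⊚ D.X) ≫ act = (cAs carrier D.X D.X).hom ≫ (carrier ⊚◁ D.mul) ≫ act

namespace RMod

variable {D : MixedData C}

/-- Morphisms of right modules. -/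
@[ext]
structure Hom (P Q : RMod D) where
  hom : P.carrier ⟶ Q.carrier
  linear : P.act ≫ hom = (hom ▷⊚ D.X) ≫ Q.act

instance : Category (RMod D) where
  Hom P Q := Hom P Q
  id P := ⟨𝟙 _, by
    rw [Category.comp_id, cR, TwoMonoidal.circ.id_whiskerRight, Category.id_comp]⟩
  comp f g := ⟨f.hom ≫ g.hom, by
    rw [cR, @MonoidalCategory.comp_whiskerRight _ _ TwoMonoidal.circ, Category.assoc, ← g.linear,
      ← Category.assoc, f.linear, Category.assoc]⟩
  id_comp f := Hom.ext (Category.id_comp _)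
  comp_id f := Hom.ext (Category.comp_id _)
  assoc f g h := Hom.ext (Category.assoc _ _ _)

end RMod

/-- A morphism `r : Q ⟶ Q • Y` is a right `Y`-coaction (with respect to `•`) on the right
`X`-module `Q`, compatible with the action via `ψ`. -/
structure IsMixedCoaction {D : MixedData C} (Q : RMod D) (r : Q.carrier ⟶ Q.carrier ⊙ D.Y) :
    Prop where
  coact_counit : r ≫ (Q.carrier ⊙◁ D.counit) = (bRu Q.carrier).inv
  coact_coact : r ≫ (r ▷⊙ D.Y) ≫ (bAs Q.carrier D.Y D.Y).hom = r ≫ (Q.carrier ⊙◁ D.comul)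
  compat : Q.act ≫ r = (r ▷⊚ D.X) ≫ D.ψ Q.carrier ≫ (Q.act ▷⊙ D.Y)

/-- Mixed modules: right `X`-modules (with respect to `∘`) which are also right `Y`-comodules (with
respect to `•`), in a way compatible with `ψ`. -/
structure MixedMod (D : MixedData C) extends RMod D where
  coact : carrier ⟶ carrier ⊙ D.Y
  isMixed : IsMixedCoaction toRMod coact

namespace MixedMod

variable {D : MixedData C}

/-- Morphisms of mixed modules are the morphisms of modules and of comodules. -/
@[ext]
structure Hom (P Q : MixedMod D) where
  hom : P.carrier ⟶ Q.carrier
  linear : P.act ≫ hom = (hom ▷⊚ D.X) ≫ Q.act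
  colinear : hom ≫ Q.coact = P.coact ≫ (hom ▷⊙ D.Y)

instance : Category (MixedMod D) where
  Hom P Q := Hom P Q
  id P := ⟨𝟙 _, by
      rw [Category.comp_id, cR, TwoMonoidal.circ.id_whiskerRight, Category.id_comp], by
      rw [Category.id_comp, bR, TwoMonoidal.bull.id_whiskerRight, Category.comp_id]⟩
  comp f g := ⟨f.hom ≫ g.hom, by
      rw [cR, @MonoidalCategory.comp_whiskerRight _ _ TwoMonoidal.circ, Category.assoc,
        ← g.linear, ← Category.assoc, f.linear, Category.assoc], by
      rw [bR, @MonoidalCategory.comp_whiskerRight _ _ TwoMonoidal.bull, Category.assoc,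
        g.colinear, ← Category.assoc, f.colinear, Category.assoc]⟩
  id_comp f := Hom.ext (Category.id_comp _)
  comp_id f := Hom.ext (Category.comp_id _)
  assoc f g h := Hom.ext (Category.assoc _ _ _)

/-- The functor forgetting the coaction. -/
def forget (D : MixedData C) : MixedMod D ⥤ RMod D where
  obj P := P.toRMod
  map f := ⟨f.hom, f.linear⟩

end MixedMod

/-- A weak lifting, associated to `ψ`, of the comonad `(-) • Y` to the category of right
`X`-modules. It is a comonad `G` on `RMod D`, with underlying objects the retracts of `Q • Y`
through which the idempotents

`Q • Y ⟶ (Q • Y) ∘ X ⟶ (Q ∘ X) • Y ⟶ Q • Y`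

split, such that the monomorphisms `ι` of the splittings make the forgetful functor a comonad
morphism from `G` to `(-) • Y`. -/
structure WeakLifting (D : MixedData C) where
  G : Comonad (RMod D)
  ι : ∀ Q : RMod D, (G.obj Q).carrier ⟶ Q.carrier ⊙ D.Y
  π : ∀ Q : RMod D, Q.carrier ⊙ D.Y ⟶ (G.obj Q).carrier
  ι_natural : ∀ {Q Q' : RMod D} (f : Q ⟶ Q'), (G.map f).hom ≫ ι Q' = ι Q ≫ (f.hom ▷⊙ D.Y)
  π_natural : ∀ {Q Q' : RMod D} (f : Q ⟶ Q'), (f.hom ▷⊙ D.Y) ≫ π Q' = π Q ≫ (G.map f).hom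
  ι_π : ∀ Q : RMod D, ι Q ≫ π Q = 𝟙 _
  π_ι : ∀ Q : RMod D, π Q ≫ ι Q =
    (cRu (Q.carrier ⊙ D.Y)).inv ≫ ((Q.carrier ⊙ D.Y) ⊚◁ D.one) ≫ D.ψ Q.carrier ≫
      (Q.act ▷⊙ D.Y)
  act_eq : ∀ Q : RMod D,
    (G.obj Q).act = (ι Q ▷⊚ D.X) ≫ D.ψ Q.carrier ≫ (Q.act ▷⊙ D.Y) ≫ π Q
  counit_eq : ∀ Q : RMod D,
    (G.ε.app Q).hom = ι Q ≫ (Q.carrier ⊙◁ D.counit) ≫ (bRu Q.carrier).hom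
  comul_eq : ∀ Q : RMod D,
    (G.δ.app Q).hom ≫ ι (G.obj Q) ≫ (ι Q ▷⊙ D.Y) ≫ (bAs Q.carrier D.Y D.Y).hom =
      ι Q ≫ (Q.carrier ⊙◁ D.comul)

/-- A lifting of the comonad `(-) • Y` to the category of right `X`-modules: a weak lifting whose
underlying objects are all of `Q • Y` (via the isomorphisms `ι`, with inverses `π`). -/
structure Lifting (D : MixedData C) extends WeakLifting D where
  π_ι_id : ∀ Q : RMod D, π Q ≫ ι Q = 𝟙 _

end Modules

/-- `lam` is a comonad morphism, over the functor `W`, from the comonad `K` to the comonad `G`. -/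
structure IsComonadMorphism {B : Type*} [Category B] {E : Type*} [Category E] (K : Comonad B)
    (G : Comonad E) (W : B ⥤ E) (lam : K.toFunctor ⋙ W ⟶ W ⋙ G.toFunctor) : Prop where
  counit : ∀ P : B, lam.app P ≫ G.ε.app (W.obj P) = W.map (K.ε.app P)
  comul : ∀ P : B, lam.app P ≫ G.δ.app (W.obj P) =
    W.map (K.δ.app P) ≫ lam.app (K.obj P) ≫ G.map (lam.app P)

/-- A splitting of an endomorphism `e` of `X`. -/
structure Splitting {C : Type u} [Category.{v} C] {X : C} (e : X ⟶ X) where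
  obj : C
  ι : obj ⟶ X
  π : X ⟶ obj
  ι_π : ι ≫ π = 𝟙 obj
  π_ι : π ≫ ι = e

section Base

variable {C : Type u} [Category.{v} C] [Duoidal C] (H : MonComon C)

/-- The mixed data of Hopf modules: the monoid `A`, the comonoid `A`, and
`ψ : (M • A) ∘ A ⟶ (M ∘ A) • A`. -/
def hopfData : MixedData C where
  X := H.A
  mul := H.μ
  one := H.η
  Y := H.A
  comul := H.Δ
  counit := H.ε
  ψ M := ((M ⊙ H.A) ⊚◁ H.Δ) ≫ ζ M H.A H.A H.A ≫ ((M ⊚ H.A) ⊙◁ H.μ)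

/-- The free right `A`-module `M ∘ A`. -/
def freeMod (M : C) : RMod (hopfData H) where
  carrier := M ⊚ H.A
  act := (cAs M H.A H.A).hom ≫ (M ⊚◁ H.μ)
  act_one := by
    let _i : MonoidalCategory C := TwoMonoidal.circ
    let _j : MonObj H.A := H.mon
    change MonoidalCategory.whiskerLeft (MonoidalCategory.tensorObj M H.A) MonObj.one ≫
      (MonoidalCategory.associator M H.A H.A).hom ≫ MonoidalCategory.whiskerLeft M MonObj.mul =
        (MonoidalCategory.rightUnitor (MonoidalCategory.tensorObj M H.A)).hom
    simp [← MonoidalCategory.whiskerLeft_comp]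
  act_act := by
    let _i : MonoidalCategory C := TwoMonoidal.circ
    let _j : MonObj H.A := H.mon
    change MonoidalCategory.whiskerRight ((MonoidalCategory.associator M H.A H.A).hom ≫
        MonoidalCategory.whiskerLeft M MonObj.mul) H.A ≫
      (MonoidalCategory.associator M H.A H.A).hom ≫ MonoidalCategory.whiskerLeft M MonObj.mul =
        (MonoidalCategory.associator (MonoidalCategory.tensorObj M H.A) H.A H.A).hom ≫
        MonoidalCategory.whiskerLeft (MonoidalCategory.tensorObj M H.A) MonObj.mul ≫
        (MonoidalCategory.associator M H.A H.A).hom ≫ MonoidalCategory.whiskerLeft M MonObj.mul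
    simp [← MonoidalCategory.whiskerLeft_comp, MonObj.mul_assoc]
    rw [MonoidalCategory.whiskerLeft_comp, MonoidalCategory.pentagon_assoc]

/-- The endomorphism `⊓` of `A • I` whose splitting is the base object `L` (in `(M, ∘)`):
`A • I ⟶ (I • I) ∘ (A • I) ⟶ (A • A • I) ∘ (A • I) ⟶ (A ∘ A) • A • I ⟶ A • I`. -/
def sqcapL : H.A ⊙ unitI C ⟶ H.A ⊙ unitI C :=
  (cLu (H.A ⊙ unitI C)).inv ≫ (δ ▷⊚ (H.A ⊙ unitI C)) ≫
    ((((H.η ≫ H.Δ) ▷⊙ unitI C) ≫ (bAs H.A H.A (unitI C)).hom) ▷⊚ (H.A ⊙ unitI C)) ≫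
    ζ H.A (H.A ⊙ unitI C) H.A (unitI C) ≫
    ((H.μ ≫ H.ε) ⊙ₘ (cRu (H.A ⊙ unitI C)).hom) ≫ (bLu (H.A ⊙ unitI C)).hom

variable {H} (L : Splitting (sqcapL H))

/-- The multiplication of `L`, inherited from the `∘`-monoid `A • I`. -/
def baseMul : L.obj ⊚ L.obj ⟶ L.obj :=
  (L.ι ⊚ₘ L.ι) ≫ ζ H.A (unitI C) H.A (unitI C) ≫ (H.μ ⊙ₘ (cLu (unitI C)).hom) ≫ L.π

/-- The unit of `L`. -/
def baseOne : unitI C ⟶ L.obj := δ ≫ (H.η ▷⊙ unitI C) ≫ L.π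

/-- The right `I`-coaction on `L`, inherited from `A • I`. -/
def baseCoact : L.obj ⟶ L.obj ⊙ unitI C :=
  L.ι ≫ (H.A ⊙◁ δ) ≫ (bAs H.A (unitI C) (unitI C)).inv ≫ (L.π ▷⊙ unitI C)

/-- The morphism `ω : L ⟶ A • I ⟶ A`. -/
def baseω : L.obj ⟶ H.A := L.ι ≫ (H.A ⊙◁ τ) ≫ (bRu H.A).hom

/-- The left `L`-action on `A` induced by `ω`. -/
def baseAct : L.obj ⊚ H.A ⟶ H.A := (baseω L ▷⊚ H.A) ≫ H.μ

/-- The mixed data of `L`-modules in the category of right `I`-comodules: the monoid `L`, the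
comonoid `I`, and
`(P • I) ∘ L ⟶ (P • I) ∘ (L • I) ⟶ (P ∘ L) • (I ∘ I) ≅ (P ∘ L) • I`.
Precomposing the latter with `r ∘ L`, for a right `I`-coaction `r` on `P`, yields the
`I`-coaction of `P ∘ L`; so the field `compat` of `IsMixedCoaction` says that the `L`-action on `P` is a
morphism of `I`-comodules. -/
def baseData : MixedData C where
  X := L.obj
  mul := baseMul L
  one := baseOne L
  Y := unitI C
  comul := δ
  counit := τ
  ψ P := ((P ⊙ unitI C) ⊚◁ baseCoact L) ≫ ζ P (unitI C) L.obj (unitI C) ≫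
    ((P ⊚ L.obj) ⊙◁ (cLu (unitI C)).hom)

/-- `L`, with the above structure, is a monoid (with respect to `∘`) in the category of right
`I`-comodules. -/
structure IsComoduleMonoid : Prop where
  one_mul : (baseOne L ▷⊚ L.obj) ≫ baseMul L = (cLu L.obj).hom
  mul_one : (L.obj ⊚◁ baseOne L) ≫ baseMul L = (cRu L.obj).hom
  mul_assoc : (baseMul L ▷⊚ L.obj) ≫ baseMul L =
    (cAs L.obj L.obj L.obj).hom ≫ (L.obj ⊚◁ baseMul L) ≫ baseMul L
  coact_counit : baseCoact L ≫ (L.obj ⊙◁ τ) = (bRu L.obj).inv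
  coact_coact : baseCoact L ≫ (baseCoact L ▷⊙ unitI C) ≫
    (bAs L.obj (unitI C) (unitI C)).hom = baseCoact L ≫ (L.obj ⊙◁ δ)
  one_colinear : baseOne L ≫ baseCoact L = δ ≫ (baseOne L ▷⊙ unitI C)
  mul_colinear : baseMul L ≫ baseCoact L =
    (baseCoact L ⊚ₘ baseCoact L) ≫ ζ L.obj (unitI C) L.obj (unitI C) ≫
      (baseMul L ⊙ₘ (cLu (unitI C)).hom)

/-- The `L`-module tensor product functor `(-) ∘_L A` from right `L`-modules to right `A`-modules:
`P ∘_L A` is a coequalizer in `C` of `P ∘ L ∘ A ⇉ P ∘ A`, with the `A`-action inherited from the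
multiplication of `A`, and the functor is determined on the morphisms by naturality of `π`. -/
structure TensorOver where
  W : RMod (baseData L) ⥤ RMod (hopfData H)
  π : ∀ P : RMod (baseData L), P.carrier ⊚ H.A ⟶ (W.obj P).carrier
  balanced : ∀ P : RMod (baseData L),
    (P.act ▷⊚ H.A) ≫ π P =
      ((cAs P.carrier L.obj H.A).hom ≫ (P.carrier ⊚◁ baseAct L)) ≫ π P
  isCoeq : ∀ P : RMod (baseData L),
    Nonempty (Limits.IsColimit (Limits.Cofork.ofπ (π P) (balanced P)))
  natural : ∀ {P Q : RMod (baseData L)} (f : P ⟶ Q),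
    (f.hom ▷⊚ H.A) ≫ π Q = π P ≫ (W.map f).hom
  linear : ∀ P : RMod (baseData L),
    (freeMod H P.carrier).act ≫ π P = (π P ▷⊚ H.A) ≫ (W.obj P).act

/-- The morphism of right `A`-modules `P ∘ A ⟶ P ∘_L A`. -/
def TensorOver.πHom {L : Splitting (sqcapL H)} (T : TensorOver L) (P : RMod (baseData L)) :
    freeMod H P.carrier ⟶ T.W.obj P :=
  ⟨T.π P, T.linear P⟩

/-- The morphism `λ⁰ : (M • I) ∘ A ⟶ (M ∘ A) • A ⟶ (M ∘ A) •_R A`. -/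
def lambda0 (R : WeakLifting (hopfData H)) (M : C) :
    (M ⊙ unitI C) ⊚ H.A ⟶ (R.G.obj (freeMod H M)).carrier :=
  ((M ⊙ unitI C) ⊚◁ H.Δ) ≫ ζ M (unitI C) H.A H.A ≫ ((M ⊚ H.A) ⊙◁ (cLu H.A).hom) ≫
    R.π (freeMod H M)

end Base

end Duo

namespace Duo

open Duoidal

attribute [-simp] MonoidalCategory.tensor_whiskerLeft MonoidalCategory.whiskerRight_tensor
  MonoidalCategory.id_whiskerLeft MonoidalCategory.whiskerRight_id MonoidalCategory.whisker_assoc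

/-! ### Bifunctoriality and naturality for the two products. -/

section Whiskering

variable {C : Type u} [Category.{v} C] [TwoMonoidal C]

/-! Comonads. A coaction of `X` together with `ζ` gives a map `(M • Y) ∘ X ⟶ (M ∘ X) • Z` (`entw`).
For `Z = Y` it makes a `∘`-monoid `X` act on `Q • Y`, associatively but perhaps not unitally, for
every `X`-module `Q`. Acting by the unit is then an idempotent through which the action factors, and
its image carries the weakly lifted comonad (`MixedData.Law`, `liftComonad`). All of this is formal
except that the counit must be linear on the image. For the base monoid with `Y = I` the unit is
colinear, so the idempotent is the identity and the lifting is an honest one. A compatible coaction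
is fixed by the idempotent (`coact_idem`), so mixed modules are the coalgebras of the comonad,
whence comonadicity.

Weak bimonoid identities. `A • (-)` is a comonad on `(C, ∘)` and a lax monoidal functor whose binary
part respects the comultiplication (`LaxComonad`). Write `1₁ • 1₂` for the comultiplied unit. The
base is the image of `a ↦ ε(1₁ a) 1₂`. The unit axioms yield `Δ(a) = 1₁ a • 1₂ = a 1₁ • 1₂` on this
image, and the counit axiom yields `ε(a₁ b) a₂ = a 1₂ ε(1₁ b)` (`LaxComonad.star`). Hence the image
is a submonoid and `b ↦ ε(1₁ b) 1₂` is linear over it. Reversing both products turns `star` into the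
linearity of the counit still needed for the comonad `(-) •_R A`.

Tensor product. The map `a ↦ ε(1₁ a₁) 1₂ ∘ a₂` is an `L`-linear section of the action `L ∘ A ⟶ A`
(`baseSec`). Therefore `P ∘_L A` is the image of an idempotent on `P ∘ A`. As a split coequalizer it
is preserved by every functor, so it inherits the action of `A`.

The morphism `λ`. It comes from one more instance of `entw`, with the comultiplication of `A` and
the unitor `I ∘ A ≅ A`. The general lemmas on `entw` show that it is balanced, `A`-linear, and
compatible with comultiplications and counits. Being linear, it lands in the image of the
idempotent, so it factors as required. A comonad morphism carries coalgebras to coalgebras, and this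
gives the lifted functor. -/

theorem c_hom_def {X X' Y Y' : C} (f : X ⟶ X') (g : Y ⟶ Y') :
    f ⊚ₘ g = (f ▷⊚ Y) ≫ (X' ⊚◁ g) := TwoMonoidal.circ.tensorHom_def f g

theorem b_hom_def {X X' Y Y' : C} (f : X ⟶ X') (g : Y ⟶ Y') :
    f ⊙ₘ g = (f ▷⊙ Y) ≫ (X' ⊙◁ g) := TwoMonoidal.bull.tensorHom_def f g

theorem c_exch {X X' Y Y' : C} (f : X ⟶ X') (g : Y ⟶ Y') :
    (X ⊚◁ g) ≫ (f ▷⊚ Y') = (f ▷⊚ Y) ≫ (X' ⊚◁ g) :=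
  @MonoidalCategory.whisker_exchange _ _ TwoMonoidal.circ _ _ _ _ f g

theorem c_exch_assoc {X X' Y Y' Z : C} (f : X ⟶ X') (g : Y ⟶ Y') (h : X' ⊚ Y' ⟶ Z) :
    (X ⊚◁ g) ≫ (f ▷⊚ Y') ≫ h = (f ▷⊚ Y) ≫ (X' ⊚◁ g) ≫ h :=
  @MonoidalCategory.whisker_exchange_assoc _ _ TwoMonoidal.circ _ _ _ _ f g _ h

theorem b_exch {X X' Y Y' : C} (f : X ⟶ X') (g : Y ⟶ Y') :
    (X ⊙◁ g) ≫ (f ▷⊙ Y') = (f ▷⊙ Y) ≫ (X' ⊙◁ g) :=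
  @MonoidalCategory.whisker_exchange _ _ TwoMonoidal.bull _ _ _ _ f g

theorem b_exch_assoc {X X' Y Y' Z : C} (f : X ⟶ X') (g : Y ⟶ Y') (h : X' ⊙ Y' ⟶ Z) :
    (X ⊙◁ g) ≫ (f ▷⊙ Y') ≫ h = (f ▷⊙ Y) ≫ (X' ⊙◁ g) ≫ h :=
  @MonoidalCategory.whisker_exchange_assoc _ _ TwoMonoidal.bull _ _ _ _ f g _ h

theorem cR_comp {X Y Z : C} (f : X ⟶ Y) (g : Y ⟶ Z) (W : C) :
    (f ≫ g) ▷⊚ W = (f ▷⊚ W) ≫ (g ▷⊚ W) := TwoMonoidal.circ.comp_whiskerRight f g W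

theorem cL_comp (W : C) {X Y Z : C} (f : X ⟶ Y) (g : Y ⟶ Z) :
    W ⊚◁ (f ≫ g) = (W ⊚◁ f) ≫ (W ⊚◁ g) := TwoMonoidal.circ.whiskerLeft_comp W f g

theorem bR_comp {X Y Z : C} (f : X ⟶ Y) (g : Y ⟶ Z) (W : C) :
    (f ≫ g) ▷⊙ W = (f ▷⊙ W) ≫ (g ▷⊙ W) := TwoMonoidal.bull.comp_whiskerRight f g W

theorem bL_comp (W : C) {X Y Z : C} (f : X ⟶ Y) (g : Y ⟶ Z) :
    W ⊙◁ (f ≫ g) = (W ⊙◁ f) ≫ (W ⊙◁ g) := TwoMonoidal.bull.whiskerLeft_comp W f g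

theorem c_hom_comp {X Y Z X' Y' Z' : C} (f : X ⟶ Y) (g : Y ⟶ Z) (f' : X' ⟶ Y') (g' : Y' ⟶ Z') :
    (f ≫ g) ⊚ₘ (f' ≫ g') = (f ⊚ₘ f') ≫ (g ⊚ₘ g') :=
  (TwoMonoidal.circ.tensorHom_comp_tensorHom f f' g g').symm

theorem b_hom_comp {X Y Z X' Y' Z' : C} (f : X ⟶ Y) (g : Y ⟶ Z) (f' : X' ⟶ Y') (g' : Y' ⟶ Z') :
    (f ≫ g) ⊙ₘ (f' ≫ g') = (f ⊙ₘ f') ≫ (g ⊙ₘ g') :=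
  (TwoMonoidal.bull.tensorHom_comp_tensorHom f f' g g').symm

theorem c_hom_comp_assoc {X Y Z X' Y' Z' T : C} (f : X ⟶ Y) (g : Y ⟶ Z) (f' : X' ⟶ Y')
    (g' : Y' ⟶ Z') (h : Z ⊚ Z' ⟶ T) :
    ((f ≫ g) ⊚ₘ (f' ≫ g')) ≫ h = (f ⊚ₘ f') ≫ (g ⊚ₘ g') ≫ h := by
  rw [c_hom_comp, Category.assoc]

theorem cAs_nat₁ {X X' : C} (f : X ⟶ X') (Y Z : C) :
    ((f ▷⊚ Y) ▷⊚ Z) ≫ (cAs X' Y Z).hom = (cAs X Y Z).hom ≫ (f ▷⊚ (Y ⊚ Z)) :=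
  @MonoidalCategory.associator_naturality_left _ _ TwoMonoidal.circ _ _ f Y Z

theorem cAs_nat₁_assoc {X X' : C} (f : X ⟶ X') (Y Z : C) {T : C} (h : _ ⟶ T) :
    ((f ▷⊚ Y) ▷⊚ Z) ≫ (cAs X' Y Z).hom ≫ h = (cAs X Y Z).hom ≫ (f ▷⊚ (Y ⊚ Z)) ≫ h := by
  rw [← Category.assoc, cAs_nat₁, Category.assoc]

theorem cAs_nat₂ (X : C) {Y Y' : C} (f : Y ⟶ Y') (Z : C) :
    ((X ⊚◁ f) ▷⊚ Z) ≫ (cAs X Y' Z).hom = (cAs X Y Z).hom ≫ (X ⊚◁ (f ▷⊚ Z)) :=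
  @MonoidalCategory.associator_naturality_middle _ _ TwoMonoidal.circ X _ _ f Z

theorem cAs_nat₂_assoc (X : C) {Y Y' : C} (f : Y ⟶ Y') (Z : C) {T : C} (h : _ ⟶ T) :
    ((X ⊚◁ f) ▷⊚ Z) ≫ (cAs X Y' Z).hom ≫ h = (cAs X Y Z).hom ≫ (X ⊚◁ (f ▷⊚ Z)) ≫ h := by
  rw [← Category.assoc, cAs_nat₂, Category.assoc]

theorem cAs_nat₃ (X Y : C) {Z Z' : C} (f : Z ⟶ Z') :
    ((X ⊚ Y) ⊚◁ f) ≫ (cAs X Y Z').hom = (cAs X Y Z).hom ≫ (X ⊚◁ (Y ⊚◁ f)) :=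
  @MonoidalCategory.associator_naturality_right _ _ TwoMonoidal.circ X Y _ _ f

theorem cAs_nat₃_assoc (X Y : C) {Z Z' : C} (f : Z ⟶ Z') {T : C} (h : _ ⟶ T) :
    ((X ⊚ Y) ⊚◁ f) ≫ (cAs X Y Z').hom ≫ h = (cAs X Y Z).hom ≫ (X ⊚◁ (Y ⊚◁ f)) ≫ h := by
  rw [← Category.assoc, cAs_nat₃, Category.assoc]

theorem cAs_inv_nat₁ {X X' : C} (f : X ⟶ X') (Y Z : C) :
    (f ▷⊚ (Y ⊚ Z)) ≫ (cAs X' Y Z).inv = (cAs X Y Z).inv ≫ ((f ▷⊚ Y) ▷⊚ Z) :=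
  @MonoidalCategory.associator_inv_naturality_left _ _ TwoMonoidal.circ _ _ f Y Z

theorem cAs_inv_nat₁_assoc {X X' : C} (f : X ⟶ X') (Y Z : C) {T : C} (h : _ ⟶ T) :
    (f ▷⊚ (Y ⊚ Z)) ≫ (cAs X' Y Z).inv ≫ h = (cAs X Y Z).inv ≫ ((f ▷⊚ Y) ▷⊚ Z) ≫ h := by
  rw [← Category.assoc, cAs_inv_nat₁, Category.assoc]

theorem cAs_inv_nat₂ (X : C) {Y Y' : C} (f : Y ⟶ Y') (Z : C) :
    (X ⊚◁ (f ▷⊚ Z)) ≫ (cAs X Y' Z).inv = (cAs X Y Z).inv ≫ ((X ⊚◁ f) ▷⊚ Z) :=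
  @MonoidalCategory.associator_inv_naturality_middle _ _ TwoMonoidal.circ X _ _ f Z

theorem cAs_inv_nat₂_assoc (X : C) {Y Y' : C} (f : Y ⟶ Y') (Z : C) {T : C} (h : _ ⟶ T) :
    (X ⊚◁ (f ▷⊚ Z)) ≫ (cAs X Y' Z).inv ≫ h = (cAs X Y Z).inv ≫ ((X ⊚◁ f) ▷⊚ Z) ≫ h := by
  rw [← Category.assoc, cAs_inv_nat₂, Category.assoc]

theorem cAs_inv_nat₃ (X Y : C) {Z Z' : C} (f : Z ⟶ Z') :
    (X ⊚◁ (Y ⊚◁ f)) ≫ (cAs X Y Z').inv = (cAs X Y Z).inv ≫ ((X ⊚ Y) ⊚◁ f) :=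
  @MonoidalCategory.associator_inv_naturality_right _ _ TwoMonoidal.circ X Y _ _ f

theorem cAs_inv_nat₃_assoc (X Y : C) {Z Z' : C} (f : Z ⟶ Z') {T : C} (h : _ ⟶ T) :
    (X ⊚◁ (Y ⊚◁ f)) ≫ (cAs X Y Z').inv ≫ h = (cAs X Y Z).inv ≫ ((X ⊚ Y) ⊚◁ f) ≫ h := by
  rw [← Category.assoc, cAs_inv_nat₃, Category.assoc]

theorem cLu_nat {X Y : C} (f : X ⟶ Y) :
    ((unitI C) ⊚◁ f) ≫ (cLu Y).hom = (cLu X).hom ≫ f :=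
  TwoMonoidal.circ.leftUnitor_naturality f

theorem cRu_nat {X Y : C} (f : X ⟶ Y) :
    (f ▷⊚ (unitI C)) ≫ (cRu Y).hom = (cRu X).hom ≫ f :=
  TwoMonoidal.circ.rightUnitor_naturality f

theorem cLu_inv_nat {X Y : C} (f : X ⟶ Y) :
    f ≫ (cLu Y).inv = (cLu X).inv ≫ ((unitI C) ⊚◁ f) :=
  @MonoidalCategory.leftUnitor_inv_naturality _ _ TwoMonoidal.circ _ _ f

theorem cLu_inv_nat_assoc {X Y : C} (f : X ⟶ Y) {T : C} (h : _ ⟶ T) :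
    f ≫ (cLu Y).inv ≫ h = (cLu X).inv ≫ ((unitI C) ⊚◁ f) ≫ h := by
  rw [← Category.assoc, cLu_inv_nat, Category.assoc]

theorem cRu_inv_nat {X Y : C} (f : X ⟶ Y) :
    f ≫ (cRu Y).inv = (cRu X).inv ≫ (f ▷⊚ (unitI C)) :=
  @MonoidalCategory.rightUnitor_inv_naturality _ _ TwoMonoidal.circ _ _ f

theorem cRu_inv_nat_assoc {X Y : C} (f : X ⟶ Y) {T : C} (h : _ ⟶ T) :
    f ≫ (cRu Y).inv ≫ h = (cRu X).inv ≫ (f ▷⊚ (unitI C)) ≫ h := by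
  rw [← Category.assoc, cRu_inv_nat, Category.assoc]

theorem bAs_nat₁ {X X' : C} (f : X ⟶ X') (Y Z : C) :
    ((f ▷⊙ Y) ▷⊙ Z) ≫ (bAs X' Y Z).hom = (bAs X Y Z).hom ≫ (f ▷⊙ (Y ⊙ Z)) :=
  @MonoidalCategory.associator_naturality_left _ _ TwoMonoidal.bull _ _ f Y Z

theorem bAs_nat₁_assoc {X X' : C} (f : X ⟶ X') (Y Z : C) {T : C} (h : _ ⟶ T) :
    ((f ▷⊙ Y) ▷⊙ Z) ≫ (bAs X' Y Z).hom ≫ h = (bAs X Y Z).hom ≫ (f ▷⊙ (Y ⊙ Z)) ≫ h := by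
  rw [← Category.assoc, bAs_nat₁, Category.assoc]

theorem bAs_nat₂ (X : C) {Y Y' : C} (f : Y ⟶ Y') (Z : C) :
    ((X ⊙◁ f) ▷⊙ Z) ≫ (bAs X Y' Z).hom = (bAs X Y Z).hom ≫ (X ⊙◁ (f ▷⊙ Z)) :=
  @MonoidalCategory.associator_naturality_middle _ _ TwoMonoidal.bull X _ _ f Z

theorem bAs_nat₂_assoc (X : C) {Y Y' : C} (f : Y ⟶ Y') (Z : C) {T : C} (h : _ ⟶ T) :
    ((X ⊙◁ f) ▷⊙ Z) ≫ (bAs X Y' Z).hom ≫ h = (bAs X Y Z).hom ≫ (X ⊙◁ (f ▷⊙ Z)) ≫ h := by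
  rw [← Category.assoc, bAs_nat₂, Category.assoc]

theorem bAs_nat₃ (X Y : C) {Z Z' : C} (f : Z ⟶ Z') :
    ((X ⊙ Y) ⊙◁ f) ≫ (bAs X Y Z').hom = (bAs X Y Z).hom ≫ (X ⊙◁ (Y ⊙◁ f)) :=
  @MonoidalCategory.associator_naturality_right _ _ TwoMonoidal.bull X Y _ _ f

theorem bAs_nat₃_assoc (X Y : C) {Z Z' : C} (f : Z ⟶ Z') {T : C} (h : _ ⟶ T) :
    ((X ⊙ Y) ⊙◁ f) ≫ (bAs X Y Z').hom ≫ h = (bAs X Y Z).hom ≫ (X ⊙◁ (Y ⊙◁ f)) ≫ h := by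
  rw [← Category.assoc, bAs_nat₃, Category.assoc]

theorem bAs_inv_nat₁ {X X' : C} (f : X ⟶ X') (Y Z : C) :
    (f ▷⊙ (Y ⊙ Z)) ≫ (bAs X' Y Z).inv = (bAs X Y Z).inv ≫ ((f ▷⊙ Y) ▷⊙ Z) :=
  @MonoidalCategory.associator_inv_naturality_left _ _ TwoMonoidal.bull _ _ f Y Z

theorem bAs_inv_nat₁_assoc {X X' : C} (f : X ⟶ X') (Y Z : C) {T : C} (h : _ ⟶ T) :
    (f ▷⊙ (Y ⊙ Z)) ≫ (bAs X' Y Z).inv ≫ h = (bAs X Y Z).inv ≫ ((f ▷⊙ Y) ▷⊙ Z) ≫ h := by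
  rw [← Category.assoc, bAs_inv_nat₁, Category.assoc]

theorem bAs_inv_nat₂ (X : C) {Y Y' : C} (f : Y ⟶ Y') (Z : C) :
    (X ⊙◁ (f ▷⊙ Z)) ≫ (bAs X Y' Z).inv = (bAs X Y Z).inv ≫ ((X ⊙◁ f) ▷⊙ Z) :=
  @MonoidalCategory.associator_inv_naturality_middle _ _ TwoMonoidal.bull X _ _ f Z

theorem bAs_inv_nat₃ (X Y : C) {Z Z' : C} (f : Z ⟶ Z') :
    (X ⊙◁ (Y ⊙◁ f)) ≫ (bAs X Y Z').inv = (bAs X Y Z).inv ≫ ((X ⊙ Y) ⊙◁ f) :=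
  @MonoidalCategory.associator_inv_naturality_right _ _ TwoMonoidal.bull X Y _ _ f

theorem bLu_nat {X Y : C} (f : X ⟶ Y) :
    ((unitJ C) ⊙◁ f) ≫ (bLu Y).hom = (bLu X).hom ≫ f :=
  TwoMonoidal.bull.leftUnitor_naturality f

theorem bLu_nat_assoc {X Y : C} (f : X ⟶ Y) {T : C} (h : _ ⟶ T) :
    ((unitJ C) ⊙◁ f) ≫ (bLu Y).hom ≫ h = (bLu X).hom ≫ f ≫ h := by
  rw [← Category.assoc, bLu_nat, Category.assoc]

theorem bRu_nat {X Y : C} (f : X ⟶ Y) :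
    (f ▷⊙ (unitJ C)) ≫ (bRu Y).hom = (bRu X).hom ≫ f :=
  TwoMonoidal.bull.rightUnitor_naturality f

theorem bRu_inv_nat {X Y : C} (f : X ⟶ Y) :
    f ≫ (bRu Y).inv = (bRu X).inv ≫ (f ▷⊙ (unitJ C)) :=
  @MonoidalCategory.rightUnitor_inv_naturality _ _ TwoMonoidal.bull _ _ f

theorem cR_comp_assoc {X Y Z : C} (f : X ⟶ Y) (g : Y ⟶ Z) (W : C) {T : C} (h : Z ⊚ W ⟶ T) :
    ((f ≫ g) ▷⊚ W) ≫ h = (f ▷⊚ W) ≫ (g ▷⊚ W) ≫ h := by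
  rw [cR_comp, Category.assoc]

theorem cL_comp_assoc (W : C) {X Y Z : C} (f : X ⟶ Y) (g : Y ⟶ Z) {T : C} (h : W ⊚ Z ⟶ T) :
    (W ⊚◁ (f ≫ g)) ≫ h = (W ⊚◁ f) ≫ (W ⊚◁ g) ≫ h := by
  rw [cL_comp, Category.assoc]

theorem cR_hom_inv_assoc {X Y : C} (e : X ≅ Y) (Z : C) {T : C} (h : X ⊚ Z ⟶ T) :
    (e.hom ▷⊚ Z) ≫ (e.inv ▷⊚ Z) ≫ h = h :=
  @MonoidalCategory.hom_inv_whiskerRight_assoc _ _ TwoMonoidal.circ _ _ e Z _ h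

theorem bR_comp_assoc {X Y Z : C} (f : X ⟶ Y) (g : Y ⟶ Z) (W : C) {T : C} (h : Z ⊙ W ⟶ T) :
    ((f ≫ g) ▷⊙ W) ≫ h = (f ▷⊙ W) ≫ (g ▷⊙ W) ≫ h := by
  rw [bR_comp, Category.assoc]

theorem bL_comp_assoc (W : C) {X Y Z : C} (f : X ⟶ Y) (g : Y ⟶ Z) {T : C} (h : W ⊙ Z ⟶ T) :
    (W ⊙◁ (f ≫ g)) ≫ h = (W ⊙◁ f) ≫ (W ⊙◁ g) ≫ h := by
  rw [bL_comp, Category.assoc]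

theorem bL_hom_inv_assoc (Z : C) {X Y : C} (e : X ≅ Y) {T : C} (h : Z ⊙ X ⟶ T) :
    (Z ⊙◁ e.hom) ≫ (Z ⊙◁ e.inv) ≫ h = h :=
  @MonoidalCategory.whiskerLeft_hom_inv_assoc _ _ TwoMonoidal.bull Z _ _ e _ h

end Whiskering

/-! ### Naturality of the interchange law in each variable. -/

section Interchange

variable {C : Type u} [Category.{v} C] [Duoidal C]

theorem ζ_nat₁ {X X' : C} (f : X ⟶ X') (Y Z W : C) :
    ((f ▷⊙ Y) ▷⊚ (Z ⊙ W)) ≫ ζ X' Y Z W = ζ X Y Z W ≫ ((f ▷⊚ Z) ▷⊙ (Y ⊚ W)) := by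
  simpa using ζ_natural f (𝟙 Y) (𝟙 Z) (𝟙 W)

theorem ζ_nat₂ (X : C) {Y Y' : C} (f : Y ⟶ Y') (Z W : C) :
    ((X ⊙◁ f) ▷⊚ (Z ⊙ W)) ≫ ζ X Y' Z W = ζ X Y Z W ≫ ((X ⊚ Z) ⊙◁ (f ▷⊚ W)) := by
  simpa using ζ_natural (𝟙 X) f (𝟙 Z) (𝟙 W)

theorem ζ_nat₃ (X Y : C) {Z Z' : C} (f : Z ⟶ Z') (W : C) :
    ((X ⊙ Y) ⊚◁ (f ▷⊙ W)) ≫ ζ X Y Z' W = ζ X Y Z W ≫ ((X ⊚◁ f) ▷⊙ (Y ⊚ W)) := by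
  simpa using ζ_natural (𝟙 X) (𝟙 Y) f (𝟙 W)

theorem ζ_nat₄ (X Y Z : C) {W W' : C} (f : W ⟶ W') :
    ((X ⊙ Y) ⊚◁ (Z ⊙◁ f)) ≫ ζ X Y Z W' = ζ X Y Z W ≫ ((X ⊚ Z) ⊙◁ (Y ⊚◁ f)) := by
  simpa using ζ_natural (𝟙 X) (𝟙 Y) (𝟙 Z) f

theorem ζ_nat₁_assoc {X X' : C} (f : X ⟶ X') (Y Z W : C) {T : C} (h : _ ⟶ T) :
    ((f ▷⊙ Y) ▷⊚ (Z ⊙ W)) ≫ ζ X' Y Z W ≫ h = ζ X Y Z W ≫ ((f ▷⊚ Z) ▷⊙ (Y ⊚ W)) ≫ h := by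
  rw [← Category.assoc, ζ_nat₁, Category.assoc]

theorem ζ_nat₂_assoc (X : C) {Y Y' : C} (f : Y ⟶ Y') (Z W : C) {T : C} (h : _ ⟶ T) :
    ((X ⊙◁ f) ▷⊚ (Z ⊙ W)) ≫ ζ X Y' Z W ≫ h = ζ X Y Z W ≫ ((X ⊚ Z) ⊙◁ (f ▷⊚ W)) ≫ h := by
  rw [← Category.assoc, ζ_nat₂, Category.assoc]

theorem ζ_nat₃_assoc (X Y : C) {Z Z' : C} (f : Z ⟶ Z') (W : C) {T : C} (h : _ ⟶ T) :
    ((X ⊙ Y) ⊚◁ (f ▷⊙ W)) ≫ ζ X Y Z' W ≫ h = ζ X Y Z W ≫ ((X ⊚◁ f) ▷⊙ (Y ⊚ W)) ≫ h := by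
  rw [← Category.assoc, ζ_nat₃, Category.assoc]

theorem ζ_nat₄_assoc (X Y Z : C) {W W' : C} (f : W ⟶ W') {T : C} (h : _ ⟶ T) :
    ((X ⊙ Y) ⊚◁ (Z ⊙◁ f)) ≫ ζ X Y Z W' ≫ h = ζ X Y Z W ≫ ((X ⊚ Z) ⊙◁ (Y ⊚◁ f)) ≫ h := by
  rw [← Category.assoc, ζ_nat₄, Category.assoc]

end Interchange

/-! ### Maps `(M • Y) ∘ X ⟶ (M ∘ X) • Z` built from a coaction and the interchange law. -/

section Entwining

variable {C : Type u} [Category.{v} C] [Duoidal C]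

/-- The map `(M • Y) ∘ X ⟶ (M ∘ X) • Z` induced by `c : X ⟶ X • Y'` and `m : Y ∘ Y' ⟶ Z`. -/
def entw {X Y Y' Z : C} (c : X ⟶ X ⊙ Y') (m : Y ⊚ Y' ⟶ Z) (M : C) :
    (M ⊙ Y) ⊚ X ⟶ (M ⊚ X) ⊙ Z :=
  ((M ⊙ Y) ⊚◁ c) ≫ ζ M Y X Y' ≫ ((M ⊚ X) ⊙◁ m)

theorem entw_natural {X Y Y' Z : C} (c : X ⟶ X ⊙ Y') (m : Y ⊚ Y' ⟶ Z) {M N : C} (f : M ⟶ N) :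
    ((f ▷⊙ Y) ▷⊚ X) ≫ entw c m N = entw c m M ≫ ((f ▷⊚ X) ▷⊙ Z) := by
  simp only [entw, Category.assoc, b_exch]
  rw [← ζ_nat₁_assoc, c_exch_assoc]

/-- The `∘`-associativity of `ζ` reduces the claim to multiplicativity of the coactions (`hp`) and
associativity on the second factor (`hm`). The objects and coactions are kept distinct so that one
statement covers the multiplicativity of both maps `ψ` as well as the linearity and the balancedness
of `preLam`. -/
theorem entw_mul {X Y Y' Z X₂ Y₂' W X₃ Y₃' : C}
    {c : X ⟶ X ⊙ Y'} {m : Y ⊚ Y' ⟶ Z} {c₂ : X₂ ⟶ X₂ ⊙ Y₂'} {m₂ : Z ⊚ Y₂' ⟶ W}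
    {c₃ : X₃ ⟶ X₃ ⊙ Y₃'} {m₃ : Y ⊚ Y₃' ⟶ W} {p : X ⊚ X₂ ⟶ X₃} {m' : Y' ⊚ Y₂' ⟶ Y₃'}
    (hp : p ≫ c₃ = (c ⊚ₘ c₂) ≫ ζ X Y' X₂ Y₂' ≫ (p ⊙ₘ m'))
    (hm : (m ▷⊚ Y₂') ≫ m₂ = (cAs Y Y' Y₂').hom ≫ (Y ⊚◁ m') ≫ m₃) (M : C) :
    (cAs (M ⊙ Y) X X₂).hom ≫ ((M ⊙ Y) ⊚◁ p) ≫ entw c₃ m₃ M =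
      (entw c m M ▷⊚ X₂) ≫ entw c₂ m₂ (M ⊚ X) ≫
        (((cAs M X X₂).hom ≫ (M ⊚◁ p)) ▷⊙ W) := by
  have h1 := ζ_circ_assoc M Y X Y' X₂ Y₂'
  have h2 : ((M ⊙ Y) ⊚◁ (p ⊙ₘ m')) ≫ ζ M Y X₃ Y₃' =
      ζ M Y (X ⊚ X₂) (Y' ⊚ Y₂') ≫ ((M ⊚◁ p) ⊙ₘ (Y ⊚◁ m')) := by
    simpa using ζ_natural (𝟙 M) (𝟙 Y) p m'
  calc _ = (cAs (M ⊙ Y) X X₂).hom ≫ ((M ⊙ Y) ⊚◁ (c ⊚ₘ c₂)) ≫ ((M ⊙ Y) ⊚◁ ζ X Y' X₂ Y₂') ≫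
        ζ M Y (X ⊚ X₂) (Y' ⊚ Y₂') ≫ ((M ⊚◁ p) ⊙ₘ ((Y ⊚◁ m') ≫ m₃)) := by
        rw [entw, ← Category.assoc ((M ⊙ Y) ⊚◁ p), ← cL_comp, hp, cL_comp, cL_comp,
          Category.assoc, Category.assoc, ← Category.assoc (_ ⊚◁ (p ⊙ₘ m')), h2]
        simp only [b_hom_def, bL_comp, Category.assoc]
    _ = (((M ⊙ Y) ⊚◁ c) ⊚ₘ c₂) ≫ (ζ M Y X Y' ▷⊚ (X₂ ⊙ Y₂')) ≫ ζ (M ⊚ X) (Y ⊚ Y') X₂ Y₂' ≫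
        (((cAs M X X₂).hom ≫ (M ⊚◁ p)) ⊙ₘ ((m ▷⊚ Y₂') ≫ m₂)) := by
        rw [hm, b_hom_comp, reassoc_of% h1]
        simp only [c_hom_def, cL_comp, Category.assoc, cAs_nat₂_assoc,
          cAs_nat₃_assoc]
    _ = _ := by
        simp only [entw, c_hom_def, b_hom_def, cR_comp, bR_comp, bL_comp, Category.assoc]
        rw [← c_exch_assoc, ← c_exch_assoc, ζ_nat₂_assoc]
        simp only [b_exch, b_exch_assoc, c_exch_assoc]

/-- The `•`-associativity of `ζ`, combined with coassociativity of `c` and comultiplicativity of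
`m`. It serves both maps `ψ` and the comultiplication law for `λ`. -/
theorem entw_comul {X Y Y' Z : C} {c : X ⟶ X ⊙ Y'} {m : Y ⊚ Y' ⟶ Z}
    {dY : Y ⟶ Y ⊙ Y} {dY' : Y' ⟶ Y' ⊙ Y'} {dZ : Z ⟶ Z ⊙ Z}
    (hc : c ≫ (c ▷⊙ Y') ≫ (bAs X Y' Y').hom = c ≫ (X ⊙◁ dY'))
    (hm : m ≫ dZ = (dY ⊚ₘ dY') ≫ ζ Y Y Y' Y' ≫ (m ⊙ₘ m)) (M : C) :
    (((M ⊙◁ dY) ≫ (bAs M Y Y).inv) ▷⊚ X) ≫ entw c m (M ⊙ Y) ≫ (entw c m M ▷⊙ Z) ≫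
      (bAs (M ⊚ X) Z Z).hom = entw c m M ≫ ((M ⊚ X) ⊙◁ dZ) := by
  have h1 := ζ_bull_assoc M Y Y X Y' Y'
  have h2 : ((M ⊙◁ dY) ⊚ₘ (X ⊙◁ dY')) ≫ ζ M (Y ⊙ Y) X (Y' ⊙ Y') =
      ζ M Y X Y' ≫ ((M ⊚ X) ⊙◁ (dY ⊚ₘ dY')) := by
    simpa using ζ_natural (𝟙 M) dY (𝟙 X) dY'
  have h3 : (((M ⊙ Y) ⊙ Y) ⊚◁ (c ▷⊙ Y')) ≫ ζ (M ⊙ Y) Y (X ⊙ Y') Y' =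
      ζ (M ⊙ Y) Y X Y' ≫ (((M ⊙ Y) ⊚◁ c) ▷⊙ (Y ⊚ Y')) := ζ_nat₃ _ _ c _
  calc _ = (((M ⊙◁ dY) ≫ (bAs M Y Y).inv) ⊚ₘ (c ≫ (c ▷⊙ Y'))) ≫
        ζ (M ⊙ Y) Y (X ⊙ Y') Y' ≫ (ζ M Y X Y' ▷⊙ (Y ⊚ Y')) ≫ (bAs (M ⊚ X) (Y ⊚ Y') (Y ⊚ Y')).hom ≫
          ((M ⊚ X) ⊙◁ (m ⊙ₘ m)) := by
        simp only [entw, c_hom_def, b_hom_def, cR_comp, cL_comp, bR_comp, bL_comp, Category.assoc]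
        rw [reassoc_of% h3]
        simp only [← bAs_nat₃, ← bAs_nat₂_assoc, b_exch_assoc]
    _ = ((M ⊙◁ dY) ⊚ₘ (c ≫ (X ⊙◁ dY'))) ≫ ζ M (Y ⊙ Y) X (Y' ⊙ Y') ≫
          ((M ⊚ X) ⊙◁ (ζ Y Y Y' Y' ≫ (m ⊙ₘ m))) := by
        rw [reassoc_of% h1, ← Category.assoc (_ ⊚ₘ _), ← c_hom_comp]
        simp only [Category.assoc, Iso.inv_hom_id, Category.comp_id, hc, bL_comp]
    _ = _ := by
        have h4 : ((M ⊙◁ dY) ⊚ₘ (c ≫ (X ⊙◁ dY'))) =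
          ((M ⊙ Y) ⊚◁ c) ≫ ((M ⊙◁ dY) ⊚ₘ (X ⊙◁ dY')) := by
          simp only [c_hom_def, cL_comp, c_exch_assoc]
        rw [h4, Category.assoc, reassoc_of% h2]
        simp only [entw, ← bL_comp, hm, Category.assoc]

/-- The unit law of `ζ` with respect to `ϖ`. It applies to the base and to `λ`. For Hopf modules
`hm` would say that `ε` is multiplicative, which is not available in a weak bimonoid; there the
weaker law `weak_counit` takes its place. -/
theorem entw_counit {X Y Y' Z : C} {c : X ⟶ X ⊙ Y'} {m : Y ⊚ Y' ⟶ Z}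
    {eY : Y ⟶ unitJ C} {eY' : Y' ⟶ unitJ C} {eZ : Z ⟶ unitJ C}
    (hc : c ≫ (X ⊙◁ eY') = (bRu X).inv) (hm : m ≫ eZ = (eY ⊚ₘ eY') ≫ ϖ) (M : C) :
    entw c m M ≫ ((M ⊚ X) ⊙◁ eZ) ≫ (bRu (M ⊚ X)).hom =
      ((M ⊙◁ eY) ≫ (bRu M).hom) ▷⊚ X := by
  have h2 : ((M ⊙◁ eY) ⊚ₘ (X ⊙◁ eY')) ≫ ζ M (unitJ C) X (unitJ C) =
      ζ M Y X Y' ≫ ((M ⊚ X) ⊙◁ (eY ⊚ₘ eY')) := by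
    simpa using ζ_natural (𝟙 M) eY (𝟙 X) eY'
  have h3 := ζ_ϖ_right M X
  calc _ = ((M ⊙ Y) ⊚◁ c) ≫ ζ M Y X Y' ≫ ((M ⊚ X) ⊙◁ (eY ⊚ₘ eY')) ≫ ((M ⊚ X) ⊙◁ ϖ) ≫
        (bRu (M ⊚ X)).hom := by
        simp only [entw, Category.assoc, ← bL_comp_assoc, hm]
    _ = ((((M ⊙◁ eY) ≫ (bRu M).hom) ▷⊚ X) ≫ ((bRu M).inv ⊚ₘ (bRu X).inv)) ≫
        ζ M (unitJ C) X (unitJ C) ≫ ((M ⊚ X) ⊙◁ ϖ) ≫ (bRu (M ⊚ X)).hom := by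
        rw [← reassoc_of% h2]
        simp only [c_hom_def, ← hc, Category.assoc, cL_comp, cR_comp, cR_hom_inv_assoc,
          c_exch_assoc]
    _ = _ := by rw [Category.assoc, h3, Category.comp_id]

end Entwining

end Duo

namespace Duo

open Duoidal

/-! ### Split idempotents. -/

section Splitting

variable {C : Type u} [Category.{v} C]

theorem exists_splitting [IsIdempotentComplete C] {X : C} {e : X ⟶ X} (he : e ≫ e = e) :
    Nonempty (Splitting e) := by
  obtain ⟨Y, i, p, h1, h2⟩ := IsIdempotentComplete.idempotents_split X e he
  exact ⟨⟨Y, i, p, h1, h2⟩⟩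

namespace Splitting

variable {X : C} {e : X ⟶ X} (S : Splitting e)

theorem ι_idem : S.ι ≫ e = S.ι := by
  have := congrArg (S.ι ≫ ·) S.π_ι
  simpa only [reassoc_of% S.ι_π] using this.symm

theorem idem_π : e ≫ S.π = S.π := by
  have := congrArg (· ≫ S.π) S.π_ι
  simpa only [Category.assoc, S.ι_π, Category.comp_id] using this.symm

theorem ι_cancel {T : C} {f g : T ⟶ S.obj} (w : f ≫ S.ι = g ≫ S.ι) : f = g := by
  have := congrArg (· ≫ S.π) w
  simpa only [Category.assoc, S.ι_π, Category.comp_id] using this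

theorem π_cancel {T : C} {f g : S.obj ⟶ T} (w : S.π ≫ f = S.π ≫ g) : f = g := by
  have := congrArg (S.ι ≫ ·) w
  simpa only [reassoc_of% S.ι_π] using this

end Splitting

end Splitting

/-! ### Weak lifting of the comonad `(-) • Y` to modules. -/

section MixedTheory

variable {C : Type u} [Category.{v} C] [TwoMonoidal C]

/-- The (in general non-unital) action of `X` on `Q • Y`. -/
def MixedData.nuAct (D : MixedData C) (Q : RMod D) : (Q.carrier ⊙ D.Y) ⊚ D.X ⟶ Q.carrier ⊙ D.Y :=
  D.ψ Q.carrier ≫ (Q.act ▷⊙ D.Y)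

/-- Acting by the unit: the idempotent of `Q • Y` split by a weak lifting. -/
def MixedData.idem (D : MixedData C) (Q : RMod D) : Q.carrier ⊙ D.Y ⟶ Q.carrier ⊙ D.Y :=
  (cRu (Q.carrier ⊙ D.Y)).inv ≫ ((Q.carrier ⊙ D.Y) ⊚◁ D.one) ≫ D.nuAct Q

/-- The map `Q • Y ⟶ Q` induced by the counit of `Y`. -/
def MixedData.cou (D : MixedData C) (Q : RMod D) : Q.carrier ⊙ D.Y ⟶ Q.carrier :=
  (Q.carrier ⊙◁ D.counit) ≫ (bRu Q.carrier).hom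

/-- The map `Q • Y ⟶ (Q • Y) • Y` induced by the comultiplication of `Y`. -/
def MixedData.com (D : MixedData C) (Q : RMod D) :
    Q.carrier ⊙ D.Y ⟶ (Q.carrier ⊙ D.Y) ⊙ D.Y :=
  (Q.carrier ⊙◁ D.comul) ≫ (bAs Q.carrier D.Y D.Y).inv

theorem RMod.id_hom {D : MixedData C} (Q : RMod D) : RMod.Hom.hom (𝟙 Q) = 𝟙 Q.carrier := rfl

theorem RMod.comp_hom {D : MixedData C} {P Q R : RMod D} (f : P ⟶ Q) (g : Q ⟶ R) :
    (f ≫ g).hom = f.hom ≫ g.hom := rfl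

theorem RMod.hom_ext {D : MixedData C} {P Q : RMod D} {f g : P ⟶ Q} (h : f.hom = g.hom) : f = g :=
  RMod.Hom.ext h

theorem MixedData.cou_natural {D : MixedData C} {Q Q' : RMod D} (f : Q ⟶ Q') :
    (f.hom ▷⊙ D.Y) ≫ D.cou Q' = D.cou Q ≫ f.hom := by
  rw [cou, cou, ← b_exch_assoc, bRu_nat, Category.assoc]

theorem MixedData.com_natural (D : MixedData C) {Q Q' : RMod D} (f : Q ⟶ Q') :
    (f.hom ▷⊙ D.Y) ≫ D.com Q' = D.com Q ≫ ((f.hom ▷⊙ D.Y) ▷⊙ D.Y) := by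
  rw [com, com, ← b_exch_assoc, bAs_inv_nat₁, Category.assoc]

/-- The conditions on mixed data under which the comonad `(-) • Y` lifts weakly. -/
structure MixedData.Law (D : MixedData C) : Prop where
  mul_one : (D.X ⊚◁ D.one) ≫ D.mul = (cRu D.X).hom
  counit_left : D.comul ≫ (D.counit ▷⊙ D.Y) = (bLu D.Y).inv
  counit_right : D.comul ≫ (D.Y ⊙◁ D.counit) = (bRu D.Y).inv
  coassoc : D.comul ≫ (D.comul ▷⊙ D.Y) ≫ (bAs D.Y D.Y D.Y).hom = D.comul ≫ (D.Y ⊙◁ D.comul)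
  ψ_natural : ∀ {M N : C} (f : M ⟶ N),
    ((f ▷⊙ D.Y) ▷⊚ D.X) ≫ D.ψ N = D.ψ M ≫ ((f ▷⊚ D.X) ▷⊙ D.Y)
  ψ_mul : ∀ M : C, (cAs (M ⊙ D.Y) D.X D.X).hom ≫ ((M ⊙ D.Y) ⊚◁ D.mul) ≫ D.ψ M =
    (D.ψ M ▷⊚ D.X) ≫ D.ψ (M ⊚ D.X) ≫ (((cAs M D.X D.X).hom ≫ (M ⊚◁ D.mul)) ▷⊙ D.Y)
  ψ_comul : ∀ M : C, (((M ⊙◁ D.comul) ≫ (bAs M D.Y D.Y).inv) ▷⊚ D.X) ≫ D.ψ (M ⊙ D.Y) ≫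
    (D.ψ M ▷⊙ D.Y) ≫ (bAs (M ⊚ D.X) D.Y D.Y).hom = D.ψ M ≫ ((M ⊚ D.X) ⊙◁ D.comul)
  weak_counit : ∀ Q : RMod D, (D.idem Q ▷⊚ D.X) ≫ (D.cou Q ▷⊚ D.X) ≫ Q.act = D.nuAct Q ≫ D.cou Q

namespace MixedData.Law

variable {D : MixedData C} (h : D.Law)
include h

theorem nuAct_natural {Q Q' : RMod D} (f : Q ⟶ Q') :
    ((f.hom ▷⊙ D.Y) ▷⊚ D.X) ≫ D.nuAct Q' = D.nuAct Q ≫ (f.hom ▷⊙ D.Y) := by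
  rw [nuAct, nuAct, reassoc_of% h.ψ_natural, ← bR_comp, ← f.linear, bR_comp, Category.assoc]

theorem nuAct_assoc (Q : RMod D) :
    (cAs _ D.X D.X).hom ≫ ((Q.carrier ⊙ D.Y) ⊚◁ D.mul) ≫ D.nuAct Q =
      (D.nuAct Q ▷⊚ D.X) ≫ D.nuAct Q := by
  simp only [nuAct, reassoc_of% h.ψ_mul, cR_comp, Category.assoc, reassoc_of% h.ψ_natural]
  simp only [← bR_comp, Q.act_act, Category.assoc]

/-- Acting by `x` and then by `1` is acting by `x 1 = x`. So the action takes values in the image of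
the idempotent even though it need not be unital, and taking `x = 1` gives idempotency. -/
theorem nuAct_idem (Q : RMod D) : D.nuAct Q ≫ D.idem Q = D.nuAct Q := by
  rw [idem, reassoc_of% @cRu_inv_nat, ← c_exch_assoc, ← h.nuAct_assoc, reassoc_of% cAs_nat₃,
    ← cL_comp_assoc, h.mul_one]
  simp

theorem idem_idem (Q : RMod D) : D.idem Q ≫ D.idem Q = D.idem Q := by
  nth_rw 1 [idem]
  rw [Category.assoc, Category.assoc, h.nuAct_idem, ← idem]

theorem idem_natural {Q Q' : RMod D} (f : Q ⟶ Q') :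
    (f.hom ▷⊙ D.Y) ≫ D.idem Q' = D.idem Q ≫ (f.hom ▷⊙ D.Y) := by
  rw [idem, idem, reassoc_of% @cRu_inv_nat, ← c_exch_assoc, h.nuAct_natural]
  simp

end MixedData.Law

/-- Modules carried by the images of the idempotents of `Q • Y`. -/
structure ModSplitting (D : MixedData C) where
  obj : RMod D → RMod D
  ι : ∀ Q : RMod D, (obj Q).carrier ⟶ Q.carrier ⊙ D.Y
  π : ∀ Q : RMod D, Q.carrier ⊙ D.Y ⟶ (obj Q).carrier
  ι_π : ∀ Q : RMod D, ι Q ≫ π Q = 𝟙 _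
  π_ι : ∀ Q : RMod D, π Q ≫ ι Q = D.idem Q
  act_ι : ∀ Q : RMod D, (obj Q).act ≫ ι Q = (ι Q ▷⊚ D.X) ≫ D.nuAct Q

namespace MixedData.Law

variable {D : MixedData C} (h : D.Law) (S : ∀ Q : RMod D, Splitting (D.idem Q))

/-- The image of the idempotent on `Q • Y`, as a right module. -/
def liftObj (Q : RMod D) : RMod D where
  carrier := (S Q).obj
  act := ((S Q).ι ▷⊚ D.X) ≫ D.nuAct Q ≫ (S Q).π
  act_one := by
    rw [c_exch_assoc]
    have : (S Q).ι ≫ (cRu _).inv ≫ ((Q.carrier ⊙ D.Y) ⊚◁ D.one) ≫ D.nuAct Q = (S Q).ι :=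
      (S Q).ι_idem
    rw [← cancel_epi (cRu _).inv, ← reassoc_of% @cRu_inv_nat, reassoc_of% this, (S Q).ι_π,
      Iso.inv_hom_id]
  act_act := by
    simp only [cR_comp, Category.assoc]
    rw [← cR_comp_assoc (S Q).π, (S Q).π_ι, ← cR_comp_assoc _ (D.idem Q), h.nuAct_idem,
      ← reassoc_of% h.nuAct_assoc, reassoc_of% cAs_nat₁, c_exch_assoc]

/-- The modules `liftObj`, with the given splittings. -/
def modSplitting : ModSplitting D where
  obj := h.liftObj S
  ι Q := (S Q).ι
  π Q := (S Q).π
  ι_π Q := (S Q).ι_π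
  π_ι Q := (S Q).π_ι
  act_ι Q := by
    change (((S Q).ι ▷⊚ D.X) ≫ D.nuAct Q ≫ (S Q).π) ≫ (S Q).ι = _
    rw [Category.assoc, Category.assoc, (S Q).π_ι, h.nuAct_idem]
    rfl

end MixedData.Law

namespace ModSplitting

variable {D : MixedData C} (S : ModSplitting D)

theorem ι_idem (Q : RMod D) : S.ι Q ≫ D.idem Q = S.ι Q := by
  rw [← S.π_ι, reassoc_of% S.ι_π]

theorem ι_cancel (Q : RMod D) {T : C} {f g : T ⟶ (S.obj Q).carrier}
    (w : f ≫ S.ι Q = g ≫ S.ι Q) : f = g := by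
  have := congrArg (· ≫ S.π Q) w
  simpa only [Category.assoc, S.ι_π, Category.comp_id] using this

theorem ιι_cancel (Q : RMod D) {T : C} {f g : T ⟶ (S.obj (S.obj Q)).carrier}
    (w : f ≫ S.ι (S.obj Q) ≫ (S.ι Q ▷⊙ D.Y) = g ≫ S.ι (S.obj Q) ≫ (S.ι Q ▷⊙ D.Y)) : f = g := by
  refine S.ι_cancel _ ?_
  have := congrArg (· ≫ (S.π Q ▷⊙ D.Y)) w
  simpa only [Category.assoc, ← bR_comp, S.ι_π, TwoMonoidal.bull.id_whiskerRight,
    Category.comp_id] using this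

end ModSplitting

namespace MixedData.Law

variable {D : MixedData C} (h : D.Law) (S : ModSplitting D)
include h

/-- The functoriality of the split idempotents. -/
def liftMap {Q Q' : RMod D} (f : Q ⟶ Q') : S.obj Q ⟶ S.obj Q' where
  hom := S.ι Q ≫ (f.hom ▷⊙ D.Y) ≫ S.π Q'
  linear := S.ι_cancel _ <| by
    simp only [Category.assoc, S.act_ι, cR_comp, S.π_ι, h.idem_natural,
      reassoc_of% h.nuAct_idem, reassoc_of% S.act_ι]
    rw [← cR_comp_assoc (S.π Q'), S.π_ι, ← cR_comp_assoc (f.hom ▷⊙ D.Y), h.idem_natural,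
      ← cR_comp_assoc, reassoc_of% S.ι_idem, cR_comp, Category.assoc, h.nuAct_natural]

theorem liftMap_ι {Q Q' : RMod D} (f : Q ⟶ Q') :
    (h.liftMap S f).hom ≫ S.ι Q' = S.ι Q ≫ (f.hom ▷⊙ D.Y) := by
  simp only [liftMap, Category.assoc, S.π_ι, h.idem_natural, reassoc_of% S.ι_idem]

/-- The functor underlying the weakly lifted comonad. -/
def liftFunctor : RMod D ⥤ RMod D where
  obj := S.obj
  map := h.liftMap S
  map_id Q := RMod.hom_ext <| S.ι_cancel _ <| by
    rw [liftMap_ι, RMod.id_hom, RMod.id_hom, Category.id_comp, bR,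
      TwoMonoidal.bull.id_whiskerRight, Category.comp_id]
  map_comp {Q Q' Q''} f g := RMod.hom_ext <| S.ι_cancel _ <| by
    rw [liftMap_ι, RMod.comp_hom, RMod.comp_hom, Category.assoc, liftMap_ι,
      reassoc_of% h.liftMap_ι, bR_comp]

/-- The counit of the weakly lifted comonad. -/
def liftCounit (Q : RMod D) : S.obj Q ⟶ Q where
  hom := S.ι Q ≫ D.cou Q
  linear := by
    -- The counit of `Y` need be linear only on the image of the idempotent, which is what
    -- `weak_counit` expresses.
    rw [reassoc_of% S.act_ι, ← h.weak_counit, cR_comp, Category.assoc, ← cR_comp_assoc,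
      S.ι_idem]

/-- By `ψ_comul`, `com` intertwines the nonunital actions on `Q • Y` and `(Q • Y) • Y`; evaluated at
the unit, this intertwines `idem` with `idemTwo`. -/
theorem com_linear (Q : RMod D) :
    (D.com Q ▷⊚ D.X) ≫ D.ψ (Q.carrier ⊙ D.Y) ≫ (D.nuAct Q ▷⊙ D.Y) = D.nuAct Q ≫ D.com Q := by
  have := h.ψ_comul Q.carrier
  rw [← Category.assoc, ← Category.assoc, ← Iso.eq_comp_inv] at this
  rw [nuAct, com, bR_comp, ← Category.assoc (D.ψ _), ← Category.assoc (_ ▷⊚ _), ← com,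
    ← Category.assoc (_ ▷⊚ _), com, this]
  simp only [Category.assoc, ← b_exch_assoc, ← bAs_inv_nat₁]

/-- Acting by the unit on `(Q • Y) • Y`. -/
def idemTwo (_h : D.Law) (Q : RMod D) :
    (Q.carrier ⊙ D.Y) ⊙ D.Y ⟶ (Q.carrier ⊙ D.Y) ⊙ D.Y :=
  (cRu _).inv ≫ (_ ⊚◁ D.one) ≫ D.ψ (Q.carrier ⊙ D.Y) ≫ (D.nuAct Q ▷⊙ D.Y)

theorem com_idemTwo (Q : RMod D) : D.com Q ≫ h.idemTwo Q = D.idem Q ≫ D.com Q := by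
  rw [idemTwo, reassoc_of% @cRu_inv_nat, ← c_exch_assoc, h.com_linear, idem, Category.assoc,
    Category.assoc]

theorem idemTwo_idem (Q : RMod D) : h.idemTwo Q ≫ (D.idem Q ▷⊙ D.Y) = h.idemTwo Q := by
  simp only [idemTwo, Category.assoc, ← bR_comp, h.nuAct_idem]

theorem idem_ι (Q : RMod D) :
    D.idem (S.obj Q) ≫ (S.ι Q ▷⊙ D.Y) = (S.ι Q ▷⊙ D.Y) ≫ h.idemTwo Q := by
  rw [idemTwo, reassoc_of% @cRu_inv_nat, ← c_exch_assoc, reassoc_of% h.ψ_natural, idem, nuAct]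
  simp only [Category.assoc, ← bR_comp, S.act_ι]

/-- On the image of `idem`, the values of `com` are fixed by `idemTwo`, and `idemTwo` absorbs `idem
• Y`. Hence `com` restricts to the image of `idem` in both places, so no information is lost by the
projections in `comulHom`. -/
theorem ι_com_idem (Q : RMod D) :
    S.ι Q ≫ D.com Q ≫ (D.idem Q ▷⊙ D.Y) = S.ι Q ≫ D.com Q := by
  have h1 : S.ι Q ≫ D.com Q ≫ h.idemTwo Q = S.ι Q ≫ D.com Q := by
    rw [h.com_idemTwo, reassoc_of% S.ι_idem]
  conv_lhs => rw [← reassoc_of% h1, h.idemTwo_idem, h1]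

/-- The underlying morphism of the comultiplication of the weakly lifted comonad. -/
def comulHom (_h : D.Law) (S : ModSplitting D) (Q : RMod D) :
    (S.obj Q).carrier ⟶ (S.obj (S.obj Q)).carrier :=
  S.ι Q ≫ D.com Q ≫ (S.π Q ▷⊙ D.Y) ≫ S.π (S.obj Q)

theorem comulHom_ι (Q : RMod D) :
    h.comulHom S Q ≫ S.ι (S.obj Q) ≫ (S.ι Q ▷⊙ D.Y) = S.ι Q ≫ D.com Q := by
  simp only [comulHom, Category.assoc, reassoc_of% S.π_ι, h.idem_ι]
  rw [← bR_comp_assoc, S.π_ι, reassoc_of% h.ι_com_idem, h.com_idemTwo, reassoc_of% S.ι_idem]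

/-- The comultiplication of the weakly lifted comonad. -/
def liftComul (Q : RMod D) : S.obj Q ⟶ S.obj (S.obj Q) where
  hom := h.comulHom S Q
  linear := S.ιι_cancel _ <| by
    rw [Category.assoc, h.comulHom_ι, reassoc_of% S.act_ι, ← h.com_linear, Category.assoc,
      reassoc_of% S.act_ι, MixedData.nuAct.eq_1 D (S.obj Q), Category.assoc, ← bR_comp,
      S.act_ι, bR_comp,
      ← reassoc_of% h.ψ_natural, ← cR_comp_assoc, ← cR_comp_assoc, ← cR_comp_assoc,
      Category.assoc, h.comulHom_ι]

theorem com_com (Q : RMod D) :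
    D.com Q ≫ (D.com Q ▷⊙ D.Y) =
      D.com Q ≫ ((Q.carrier ⊙ D.Y) ⊙◁ D.comul) ≫ (bAs (Q.carrier ⊙ D.Y) D.Y D.Y).inv := by
  simp only [com, bR_comp, Category.assoc, ← reassoc_of% @bAs_inv_nat₂,
    ← reassoc_of% @bAs_inv_nat₃]
  have := congrArg (Q.carrier ⊙◁ ·) h.coassoc
  simp only [bL_comp] at this
  rw [← reassoc_of% this, ← @MonoidalCategory.pentagon_inv _ _ TwoMonoidal.bull,
    bL_hom_inv_assoc]

theorem com_cou_right (Q : RMod D) :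
    D.com Q ≫ ((Q.carrier ⊙ D.Y) ⊙◁ D.counit) ≫ (bRu (Q.carrier ⊙ D.Y)).hom = 𝟙 _ := by
  rw [com, Category.assoc, ← reassoc_of% @bAs_inv_nat₃, ← bL_comp_assoc, h.counit_right]
  simp

theorem com_cou_left (Q : RMod D) : D.com Q ≫ (D.cou Q ▷⊙ D.Y) = 𝟙 _ := by
  rw [com, cou, Category.assoc, bR_comp, ← reassoc_of% @bAs_inv_nat₂, ← bL_comp_assoc,
    h.counit_left]
  simp

theorem comulHom_natural {Q Q' : RMod D} (f : Q ⟶ Q') :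
    (h.liftMap S f).hom ≫ h.comulHom S Q' =
      h.comulHom S Q ≫ (h.liftMap S (h.liftMap S f)).hom := S.ιι_cancel _ <| by
  rw [Category.assoc, h.comulHom_ι, reassoc_of% h.liftMap_ι, com_natural, Category.assoc,
    reassoc_of% h.liftMap_ι, ← bR_comp, h.liftMap_ι, bR_comp, reassoc_of% h.comulHom_ι]

theorem comulHom_coassoc (Q : RMod D) :
    h.comulHom S Q ≫ (h.liftMap S (h.liftComul S Q)).hom =
      h.comulHom S Q ≫ h.comulHom S (S.obj Q) := S.ιι_cancel _ <| by
  -- A third inclusion embeds the target into `((Q • Y) • Y) • Y`, where the identity becomes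
  -- coassociativity of `Y`.
  have h1 : IsSplitMono ((S.ι Q ▷⊙ D.Y) ▷⊙ D.Y) := ⟨⟨⟨(S.π Q ▷⊙ D.Y) ▷⊙ D.Y, by
    simp only [← bR_comp, S.ι_π, TwoMonoidal.bull.id_whiskerRight]⟩⟩⟩
  rw [← cancel_mono ((S.ι Q ▷⊙ D.Y) ▷⊙ D.Y)]
  have h2 : D.com (S.obj Q) ≫ ((S.ι Q ▷⊙ D.Y) ▷⊙ D.Y) =
      (S.ι Q ▷⊙ D.Y) ≫ ((Q.carrier ⊙ D.Y) ⊙◁ D.comul) ≫ (bAs (Q.carrier ⊙ D.Y) D.Y D.Y).inv := by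
    rw [com, Category.assoc, ← bAs_inv_nat₁, b_exch_assoc]
  simp only [Category.assoc, h.comulHom_ι, reassoc_of% h.liftMap_ι, h2]
  rw [← bR_comp, ← bR_comp, liftComul, h.comulHom_ι, bR_comp, reassoc_of% h.comulHom_ι,
    reassoc_of% h.comulHom_ι, h.com_com]

theorem comulHom_left_counit (Q : RMod D) :
    h.comulHom S Q ≫ S.ι (S.obj Q) ≫ D.cou (S.obj Q) = 𝟙 _ := S.ι_cancel _ <| by
  rw [Category.id_comp, cou, Category.assoc, Category.assoc, Category.assoc, ← bRu_nat,
    b_exch_assoc, reassoc_of% h.comulHom_ι, h.com_cou_right, Category.comp_id]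

theorem comulHom_right_counit (Q : RMod D) :
    h.comulHom S Q ≫ (h.liftMap S (h.liftCounit S Q)).hom = 𝟙 _ := S.ι_cancel _ <| by
  rw [Category.assoc, h.liftMap_ι, liftCounit, bR_comp, reassoc_of% h.comulHom_ι,
    h.com_cou_left, Category.comp_id, Category.id_comp]

/-- The weakly lifted comonad. -/
def liftComonad : Comonad (RMod D) where
  toFunctor := h.liftFunctor S
  ε :=
    { app := h.liftCounit S
      naturality Q Q' f := RMod.hom_ext <| by
        change (h.liftMap S f).hom ≫ S.ι Q' ≫ D.cou Q' = (S.ι Q ≫ D.cou Q) ≫ f.hom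
        rw [reassoc_of% h.liftMap_ι, cou_natural, Category.assoc] }
  δ :=
    { app := h.liftComul S
      naturality _ _ f := RMod.hom_ext (h.comulHom_natural S f) }
  coassoc Q := RMod.hom_ext (h.comulHom_coassoc S Q)
  left_counit Q := RMod.hom_ext (h.comulHom_left_counit S Q)
  right_counit Q := RMod.hom_ext (h.comulHom_right_counit S Q)

theorem liftMap_π {Q Q' : RMod D} (f : Q ⟶ Q') :
    (f.hom ▷⊙ D.Y) ≫ S.π Q' = S.π Q ≫ (h.liftMap S f).hom := S.ι_cancel _ <| by
  rw [Category.assoc, Category.assoc, h.liftMap_ι, S.π_ι, reassoc_of% S.π_ι, h.idem_natural]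

theorem comulHom_ι_assoc (Q : RMod D) :
    h.comulHom S Q ≫ S.ι (S.obj Q) ≫ (S.ι Q ▷⊙ D.Y) ≫ (bAs Q.carrier D.Y D.Y).hom =
      S.ι Q ≫ (Q.carrier ⊙◁ D.comul) := by
  rw [reassoc_of% h.comulHom_ι, com, Category.assoc, Iso.inv_hom_id, Category.comp_id]

theorem act_eq (Q : RMod D) :
    (S.obj Q).act = (S.ι Q ▷⊚ D.X) ≫ D.ψ Q.carrier ≫ (Q.act ▷⊙ D.Y) ≫ S.π Q :=
  S.ι_cancel _ <| by
    rw [S.act_ι, Category.assoc, Category.assoc, Category.assoc, S.π_ι]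
    have := h.nuAct_idem Q
    rw [nuAct, Category.assoc] at this
    rw [this, nuAct]

/-- The weak lifting of the comonad `(-) • Y`. -/
def weakLifting : WeakLifting D where
  G := h.liftComonad S
  ι := S.ι
  π := S.π
  ι_natural f := h.liftMap_ι S f
  π_natural f := h.liftMap_π S f
  ι_π := S.ι_π
  π_ι := S.π_ι
  act_eq := h.act_eq S
  counit_eq _ := rfl
  comul_eq := h.comulHom_ι_assoc S

theorem nonempty_modSplitting [IsIdempotentComplete C] : Nonempty (ModSplitting D) :=
  ⟨h.modSplitting fun Q => (exists_splitting (h.idem_idem Q)).some⟩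

theorem nonempty_weakLifting [IsIdempotentComplete C] : Nonempty (WeakLifting D) :=
  h.nonempty_modSplitting.map h.weakLifting

theorem nonempty_lifting [IsIdempotentComplete C] (h1 : ∀ Q, D.idem Q = 𝟙 _) :
    Nonempty (Lifting D) :=
  h.nonempty_modSplitting.map fun S => ⟨h.weakLifting S, fun Q => (S.π_ι Q).trans (h1 Q)⟩

end MixedData.Law

end MixedTheory

/-! ### Mixed modules as coalgebras of the weakly lifted comonad. -/

section Comonadic

variable {C : Type u} [Category.{v} C] [TwoMonoidal C] {D : MixedData C}

theorem WeakLifting.π_ι_eq (R : WeakLifting D) (Q : RMod D) : R.π Q ≫ R.ι Q = D.idem Q := R.π_ι Q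

/-- The splittings underlying a weak lifting. -/
def WeakLifting.toModSplitting (R : WeakLifting D) (h : D.Law) : ModSplitting D where
  obj := R.G.obj
  ι := R.ι
  π := R.π
  ι_π := R.ι_π
  π_ι := R.π_ι
  act_ι Q := by
    rw [R.act_eq, Category.assoc, Category.assoc, Category.assoc, R.π_ι_eq]
    have := h.nuAct_idem Q
    rw [MixedData.nuAct, Category.assoc] at this
    rw [this, MixedData.nuAct]

namespace WeakLifting

variable (R : WeakLifting D) (h : D.Law)
include h

theorem ι_cancel (Q : RMod D) {T : C} {f g : T ⟶ (R.G.obj Q).carrier}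
    (w : f ≫ R.ι Q = g ≫ R.ι Q) : f = g := (R.toModSplitting h).ι_cancel Q w

theorem ιι_cancel (Q : RMod D) {T : C} {f g : T ⟶ (R.G.obj (R.G.obj Q)).carrier}
    (w : f ≫ R.ι (R.G.obj Q) ≫ (R.ι Q ▷⊙ D.Y) = g ≫ R.ι (R.G.obj Q) ≫ (R.ι Q ▷⊙ D.Y)) : f = g :=
  (R.toModSplitting h).ιι_cancel Q w

theorem act_ι (Q : RMod D) : (R.G.obj Q).act ≫ R.ι Q = (R.ι Q ▷⊚ D.X) ≫ D.nuAct Q :=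
  (R.toModSplitting h).act_ι Q

/-- A coalgebra of a weakly lifted comonad is a mixed module. -/
theorem isMixedCoaction {Q : RMod D} (c : Q ⟶ R.G.obj Q) (h1 : c ≫ R.G.ε.app Q = 𝟙 Q)
    (h2 : c ≫ R.G.δ.app Q = c ≫ R.G.map c) : IsMixedCoaction Q (c.hom ≫ R.ι Q) where
  coact_counit := by
    have := congrArg RMod.Hom.hom h1
    rw [RMod.comp_hom, R.counit_eq, RMod.id_hom] at this
    rw [← cancel_mono (bRu Q.carrier).hom, Iso.inv_hom_id, Category.assoc, Category.assoc]
    exact this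
  coact_coact := by
    have h3 := congrArg RMod.Hom.hom h2
    rw [RMod.comp_hom, RMod.comp_hom] at h3
    rw [bR_comp, Category.assoc, Category.assoc, ← reassoc_of% R.ι_natural, ← reassoc_of% h3,
      Category.assoc]
    congr 1
    exact R.comul_eq Q
  compat := by
    rw [reassoc_of% c.linear, R.act_ι h, cR_comp, Category.assoc, MixedData.nuAct]

end WeakLifting

/-- The underlying module morphism of a morphism of mixed modules. -/
def MixedMod.homToRMod {P Q : MixedMod D} (f : P ⟶ Q) : P.toRMod ⟶ Q.toRMod := ⟨f.hom, f.linear⟩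

namespace IsMixedCoaction

variable {Q : RMod D} {r : Q.carrier ⟶ Q.carrier ⊙ D.Y} (hr : IsMixedCoaction Q r)
include hr

/-- By compatibility, acting by `1` on `r(q)` gives `r(q 1) = r(q)`. So a coaction factors through
the image of the idempotent, which turns a mixed module into a coalgebra. -/
theorem coact_idem : r ≫ D.idem Q = r := by
  rw [MixedData.idem, reassoc_of% @cRu_inv_nat, ← c_exch_assoc, MixedData.nuAct, ← hr.compat,
    reassoc_of% Q.act_one, Iso.inv_hom_id_assoc]

theorem π_ι (R : WeakLifting D) : (r ≫ R.π Q) ≫ R.ι Q = r := by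
  rw [Category.assoc, R.π_ι_eq, hr.coact_idem]

/-- The coalgebra structure map of a mixed module. -/
def toHom (R : WeakLifting D) (h : D.Law) : Q ⟶ R.G.obj Q where
  hom := r ≫ R.π Q
  linear := R.ι_cancel h _ <| by
    rw [Category.assoc, hr.π_ι R, Category.assoc, R.act_ι h, ← cR_comp_assoc, hr.π_ι R, hr.compat,
      MixedData.nuAct]

theorem toHom_ι (R : WeakLifting D) (h : D.Law) : (hr.toHom R h).hom ≫ R.ι Q = r := hr.π_ι R

theorem toHom_counit (R : WeakLifting D) (h : D.Law) : hr.toHom R h ≫ R.G.ε.app Q = 𝟙 Q :=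
  RMod.hom_ext <| by
    rw [RMod.comp_hom, R.counit_eq, reassoc_of% hr.toHom_ι R h, reassoc_of% hr.coact_counit,
      Iso.inv_hom_id, RMod.id_hom]

theorem toHom_comul (R : WeakLifting D) (h : D.Law) :
    hr.toHom R h ≫ R.G.δ.app Q = hr.toHom R h ≫ R.G.map (hr.toHom R h) :=
  RMod.hom_ext <| R.ιι_cancel h _ <| by
    rw [RMod.comp_hom, RMod.comp_hom, Category.assoc, Category.assoc, reassoc_of% R.ι_natural,
      ← bR_comp, hr.toHom_ι, reassoc_of% hr.toHom_ι R h,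
      ← cancel_mono (bAs Q.carrier D.Y D.Y).hom, Category.assoc, Category.assoc, Category.assoc,
      Category.assoc, hr.coact_coact]
    have := R.comul_eq Q
    dsimp at this
    rw [this, reassoc_of% hr.toHom_ι R h]

end IsMixedCoaction

theorem MixedMod.hom_ext {P Q : MixedMod D} {f g : P ⟶ Q} (h : f.hom = g.hom) : f = g :=
  MixedMod.Hom.ext h

namespace WeakLifting

variable (R : WeakLifting D) (h : D.Law)

/-- The coalgebra structure map of a mixed module. -/
def coalg (P : MixedMod D) : P.toRMod ⟶ R.G.obj P.toRMod := P.isMixed.toHom R h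

theorem coalg_ι (P : MixedMod D) : (R.coalg h P).hom ≫ R.ι P.toRMod = P.coact :=
  P.isMixed.toHom_ι R h

theorem coalg_natural {P Q : MixedMod D} (f : P ⟶ Q) :
    R.coalg h P ≫ R.G.map (MixedMod.homToRMod f) =
      MixedMod.homToRMod f ≫ R.coalg h Q := RMod.hom_ext <| R.ι_cancel h _ <| by
  rw [RMod.comp_hom, RMod.comp_hom, Category.assoc, Category.assoc, R.ι_natural, R.coalg_ι,
    reassoc_of% R.coalg_ι]
  exact f.colinear.symm

/-- The cofree mixed module. -/
def cofreeObj (Q : RMod D) : MixedMod D where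
  toRMod := R.G.obj Q
  coact := (R.G.δ.app Q).hom ≫ R.ι (R.G.obj Q)
  isMixed := R.isMixedCoaction h (R.G.δ.app Q) (R.G.left_counit Q) (R.G.coassoc Q).symm

/-- The comonad of the adjunction `forgetAdj` has as comultiplication the unit at a cofree object;
this identifies it with that of `R.G`, so that coalgebras for the two comonads agree. -/
theorem coalg_cofreeObj (Q : RMod D) : R.coalg h (R.cofreeObj h Q) = R.G.δ.app Q :=
  RMod.hom_ext <| R.ι_cancel h _ <| R.coalg_ι h (R.cofreeObj h Q)

/-- The cofree mixed module functor. -/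
def cofree : RMod D ⥤ MixedMod D where
  obj := R.cofreeObj h
  map {Q Q'} f := ⟨(R.G.map f).hom, (R.G.map f).linear, by
    have h1 := congrArg RMod.Hom.hom (R.G.δ.naturality f)
    change (R.G.map f).hom ≫ (R.G.δ.app Q').hom ≫ R.ι (R.G.obj Q') =
      ((R.G.δ.app Q).hom ≫ R.ι (R.G.obj Q)) ≫ ((R.G.map f).hom ▷⊙ D.Y)
    change (R.G.map f).hom ≫ (R.G.δ.app Q').hom =
      (R.G.δ.app Q).hom ≫ (R.G.map (R.G.map f)).hom at h1
    rw [Category.assoc, ← R.ι_natural, reassoc_of% h1]⟩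
  map_id Q := MixedMod.hom_ext (congrArg RMod.Hom.hom (R.G.map_id Q))
  map_comp f g := MixedMod.hom_ext (congrArg RMod.Hom.hom (R.G.map_comp f g))

/-- A mixed module embeds into a cofree one. -/
def unitHom (P : MixedMod D) : P ⟶ R.cofreeObj h P.toRMod where
  hom := (R.coalg h P).hom
  linear := (R.coalg h P).linear
  colinear := by
    have h1 := congrArg RMod.Hom.hom (P.isMixed.toHom_comul R h)
    change (R.coalg h P).hom ≫ (R.G.δ.app P.toRMod).hom =
      (R.coalg h P).hom ≫ (R.G.map (R.coalg h P)).hom at h1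
    change (R.coalg h P).hom ≫ (R.G.δ.app P.toRMod).hom ≫ R.ι (R.G.obj P.toRMod) =
      P.coact ≫ _
    rw [reassoc_of% h1, R.ι_natural, reassoc_of% R.coalg_ι]
    rfl

/-- The forgetful functor from mixed modules is left adjoint to the cofree functor. -/
def forgetAdj : MixedMod.forget D ⊣ R.cofree h where
  unit :=
    { app := R.unitHom h
      naturality _ _ f := MixedMod.hom_ext (congrArg RMod.Hom.hom (R.coalg_natural h f)).symm }
  counit :=
    { app := R.G.ε.app
      naturality _ _ f := R.G.ε.naturality f }
  left_triangle_components P := P.isMixed.toHom_counit R h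
  right_triangle_components Q := MixedMod.hom_ext <| by
    have := congrArg RMod.Hom.hom (R.G.right_counit Q)
    rw [← R.coalg_cofreeObj h] at this
    exact this

/-- Fullness holds because a coalgebra morphism becomes colinear after composing with `ι`. Essential
surjectivity holds because `c ≫ ι` is a coaction whose associated coalgebra map is `c` again, `ι`
being monic. -/
theorem comparison_isEquivalence : (Comonad.comparison (R.forgetAdj h)).IsEquivalence where
  faithful := ⟨fun {P Q f g} w => MixedMod.hom_ext
    (congrArg (fun k => RMod.Hom.hom (Comonad.Coalgebra.Hom.f k)) w)⟩
  full := ⟨fun {P Q} f => by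
    let g : P.toRMod ⟶ Q.toRMod := f.f
    have h1 : (R.coalg h P).hom ≫ (R.G.map g).hom = g.hom ≫ (R.coalg h Q).hom :=
      congrArg RMod.Hom.hom f.h
    refine ⟨⟨g.hom, g.linear, ?_⟩, rfl⟩
    have h2 := congrArg (· ≫ R.ι Q.toRMod) h1
    simp only [Category.assoc] at h2
    rw [R.ι_natural, R.coalg_ι, reassoc_of% R.coalg_ι] at h2
    exact h2.symm⟩
  essSurj := ⟨fun X => by
    let c : X.A ⟶ R.G.obj X.A := X.a
    have h1 : c ≫ R.G.ε.app X.A = 𝟙 X.A := X.counit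
    have h2 : c ≫ R.G.δ.app X.A = c ≫ R.G.map c := by
      have h3 : c ≫ R.coalg h (R.cofreeObj h X.A) = c ≫ R.G.map c := X.coassoc
      rwa [R.coalg_cofreeObj] at h3
    let P : MixedMod D := ⟨X.A, c.hom ≫ R.ι X.A, R.isMixedCoaction h c h1 h2⟩
    refine ⟨P, ⟨Comonad.Coalgebra.isoMk (Iso.refl X.A) ?_⟩⟩
    have h4 : R.coalg h P = c := RMod.hom_ext <| R.ι_cancel h _ <| R.coalg_ι h P
    change R.coalg h P ≫ R.G.map (𝟙 X.A) = 𝟙 X.A ≫ c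
    rw [h4, R.G.map_id, Category.comp_id, Category.id_comp]⟩

/-- The forgetful functor from mixed modules is comonadic. -/
theorem nonempty_comonadic (R : WeakLifting D) (h : D.Law) :
    Nonempty (ComonadicLeftAdjoint (MixedMod.forget D)) :=
  ⟨{ R := R.cofree h, adj := R.forgetAdj h, eqv := R.comparison_isEquivalence h }⟩

end WeakLifting

end Comonadic

/-! ### Comonads with a lax monoidal structure: the weak bimonoid identities in Sweedler form. -/

section WeakBicomonads

open MonoidalCategory

variable (V : Type u) [Category.{v} V] [MonoidalCategory V]

/-- A comonad which is also a lax monoidal functor, such that the comultiplication is compatible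
with the binary part of the lax monoidal structure. -/
structure LaxComonad where
  T : V ⥤ V
  m : ∀ X Y : V, T.obj X ⊗ T.obj Y ⟶ T.obj (X ⊗ Y)
  i : 𝟙_ V ⟶ T.obj (𝟙_ V)
  δ : ∀ X : V, T.obj X ⟶ T.obj (T.obj X)
  e : ∀ X : V, T.obj X ⟶ X
  m_nat_left : ∀ {X X' : V} (f : X ⟶ X') (Y : V),
    (T.map f ▷ T.obj Y) ≫ m X' Y = m X Y ≫ T.map (f ▷ Y)
  m_nat_right : ∀ (X : V) {Y Y' : V} (f : Y ⟶ Y'),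
    (T.obj X ◁ T.map f) ≫ m X Y' = m X Y ≫ T.map (X ◁ f)
  m_assoc : ∀ X Y Z : V, (m X Y ▷ T.obj Z) ≫ m (X ⊗ Y) Z ≫ T.map (α_ X Y Z).hom =
    (α_ _ _ _).hom ≫ (T.obj X ◁ m Y Z) ≫ m X (Y ⊗ Z)
  m_left : ∀ X : V, (i ▷ T.obj X) ≫ m (𝟙_ V) X ≫ T.map (λ_ X).hom = (λ_ (T.obj X)).hom
  m_right : ∀ X : V, (T.obj X ◁ i) ≫ m X (𝟙_ V) ≫ T.map (ρ_ X).hom = (ρ_ (T.obj X)).hom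
  δ_nat : ∀ {X Y : V} (f : X ⟶ Y), T.map f ≫ δ Y = δ X ≫ T.map (T.map f)
  e_nat : ∀ {X Y : V} (f : X ⟶ Y), T.map f ≫ e Y = e X ≫ f
  δ_e : ∀ X : V, δ X ≫ e (T.obj X) = 𝟙 _
  δ_map_e : ∀ X : V, δ X ≫ T.map (e X) = 𝟙 _
  coassoc : ∀ X : V, δ X ≫ T.map (δ X) = δ X ≫ δ (T.obj X)
  m_δ : ∀ X Y : V, m X Y ≫ δ (X ⊗ Y) =
    (δ X ▷ T.obj Y) ≫ (T.obj (T.obj X) ◁ δ Y) ≫ m (T.obj X) (T.obj Y) ≫ T.map (m X Y)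

namespace LaxComonad

variable {V} (D : LaxComonad V)

/-- In Sweedler notation, `a ∘ b ↦ ε(a₁ b) a₂`. -/
def s (X Y : V) : D.T.obj X ⊗ D.T.obj Y ⟶ D.T.obj X ⊗ Y :=
  (D.δ X ▷ D.T.obj Y) ≫ D.m (D.T.obj X) Y ≫ D.e (D.T.obj X ⊗ Y)

/-- In Sweedler notation, `b ↦ ε(1₁ b) 1₂`. -/
def κ (Y : V) : D.T.obj Y ⟶ D.T.obj (𝟙_ V) ⊗ Y :=
  (λ_ _).inv ≫ (D.i ▷ D.T.obj Y) ≫ D.s (𝟙_ V) Y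

/-- The endomorphism of `T I` whose image is the base object. -/
def sq : D.T.obj (𝟙_ V) ⟶ D.T.obj (𝟙_ V) := D.κ (𝟙_ V) ≫ (ρ_ _).hom

/-- The right action of the monoid `T I` on `T X`. -/
def rmul (X : V) : D.T.obj X ⊗ D.T.obj (𝟙_ V) ⟶ D.T.obj X := D.m X (𝟙_ V) ≫ D.T.map (ρ_ X).hom

/-- The left action of the monoid `T I` on `T X`. -/
def lmul (X : V) : D.T.obj (𝟙_ V) ⊗ D.T.obj X ⟶ D.T.obj X := D.m (𝟙_ V) X ≫ D.T.map (λ_ X).hom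

/-- In Sweedler notation, `a ↦ 1₁ a • 1₂`. -/
def N : D.T.obj (𝟙_ V) ⟶ D.T.obj (D.T.obj (𝟙_ V)) :=
  (λ_ _).inv ≫ ((D.i ≫ D.δ (𝟙_ V)) ▷ D.T.obj (𝟙_ V)) ≫ D.rmul (D.T.obj (𝟙_ V))

/-- In Sweedler notation, `a ↦ a 1₁ • 1₂`. -/
def N' : D.T.obj (𝟙_ V) ⟶ D.T.obj (D.T.obj (𝟙_ V)) :=
  (ρ_ _).inv ≫ (D.T.obj (𝟙_ V) ◁ (D.i ≫ D.δ (𝟙_ V))) ≫ D.lmul (D.T.obj (𝟙_ V))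

theorem s_δ (X Y : V) : D.s X Y ≫ (D.δ X ▷ Y) = (D.δ X ▷ D.T.obj Y) ≫ D.s (D.T.obj X) Y := by
  rw [s, s, Category.assoc, Category.assoc, ← D.e_nat, ← reassoc_of% D.m_nat_left,
    ← comp_whiskerRight_assoc, ← comp_whiskerRight_assoc, D.coassoc]

/-- Counitality applied to `Δ(a x) = a₁ x₁ • a₂ x₂` gives `a x = ε(a₁ x₁) a₂ x₂`. -/
theorem rmul_eq (X : V) : D.rmul X = (D.δ X ▷ D.T.obj (𝟙_ V)) ≫
    (D.T.obj (D.T.obj X) ◁ D.δ (𝟙_ V)) ≫ D.m (D.T.obj X) (D.T.obj (𝟙_ V)) ≫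
      D.e (D.T.obj X ⊗ D.T.obj (𝟙_ V)) ≫ D.rmul X := by
  have h1 := D.m_δ X (𝟙_ V)
  rw [rmul, ← reassoc_of% D.e_nat, ← reassoc_of% h1, reassoc_of% D.δ_e]

/-- In Sweedler notation, `a 1₂ ε(1₁ b) = ε(a₁ 1₂) ε(1₁ b) a₂ 1₃ = ε(a₁ 1₁ b) a₂ 1₂ = ε(a₁ b) a₂`.
The three equalities use `rmul_eq`, the counit axiom `hC` in the form `ε(x y₂) ε(y₁ z) = ε(x y z)`,
and `Δ(a) Δ(1) = Δ(a)`. -/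
theorem star
    (hC : ∀ X Y Z : V, (D.T.obj X ◁ D.s Y Z) ≫ (α_ _ _ _).inv ≫ ((D.m X Y ≫ D.e (X ⊗ Y)) ▷ Z) =
      (D.T.obj X ◁ D.m Y Z) ≫ D.m X (Y ⊗ Z) ≫ D.e _ ≫ (α_ _ _ _).inv) (X Y : V) :
    D.s X Y = (D.T.obj X ◁ D.κ Y) ≫ (α_ _ _ _).inv ≫ (D.rmul X ▷ Y) := by
  have h1 : (D.T.obj X ◁ D.i) ≫ (D.δ X ▷ _) ≫ (_ ◁ D.δ (𝟙_ V)) ≫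
      D.m (D.T.obj X) (D.T.obj (𝟙_ V)) ≫ D.T.map (D.rmul X) = (ρ_ _).hom ≫ D.δ X := by
    rw [rmul, D.T.map_comp, ← reassoc_of% D.m_δ, ← D.δ_nat, reassoc_of% D.m_right]
  have h2 : (α_ (D.T.obj (D.T.obj X)) (D.T.obj (D.T.obj (𝟙_ V))) (D.T.obj Y)).inv ≫
      ((D.m (D.T.obj X) (D.T.obj (𝟙_ V)) ≫ D.T.map (D.rmul X)) ▷ D.T.obj Y) ≫ D.m (D.T.obj X) Y =
      (_ ◁ D.m (D.T.obj (𝟙_ V)) Y) ≫ D.m (D.T.obj X) (D.T.obj (𝟙_ V) ⊗ Y) ≫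
        D.T.map ((α_ _ _ _).inv ≫ (D.rmul X ▷ Y)) := by
    rw [comp_whiskerRight, Category.assoc, D.m_nat_left, Iso.inv_comp_eq, D.T.map_comp,
      ← reassoc_of% D.m_assoc, ← D.T.map_comp_assoc, Iso.hom_inv_id, D.T.map_id, Category.id_comp]
  symm
  calc _ = (D.T.obj X ◁ ((λ_ _).inv ≫ (D.i ▷ D.T.obj Y) ≫ D.s (𝟙_ V) Y ≫ (D.δ (𝟙_ V) ▷ Y))) ≫
        (D.δ X ▷ _) ≫ (α_ _ _ _).inv ≫ ((D.m (D.T.obj X) (D.T.obj (𝟙_ V)) ≫ D.e _) ▷ Y) ≫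
          (D.rmul X ▷ Y) := by
        nth_rw 1 [rmul_eq]
        rw [κ]
        simp only [whiskerLeft_comp, comp_whiskerRight, Category.assoc]
        rw [whisker_exchange_assoc, associator_inv_naturality_middle_assoc,
          associator_inv_naturality_left_assoc]
    _ = (D.T.obj X ◁ ((λ_ _).inv ≫ (D.i ▷ D.T.obj Y) ≫ (D.δ (𝟙_ V) ▷ D.T.obj Y))) ≫
        (D.δ X ▷ _) ≫ (_ ◁ D.m (D.T.obj (𝟙_ V)) Y) ≫ D.m (D.T.obj X) (D.T.obj (𝟙_ V) ⊗ Y) ≫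
        D.T.map ((α_ _ _ _).inv ≫ (D.rmul X ▷ Y)) ≫ D.e _ := by
        rw [D.e_nat, D.s_δ]
        simp only [whiskerLeft_comp, Category.assoc]
        rw [whisker_exchange_assoc, reassoc_of% hC]
    _ = (D.T.obj X ◁ (λ_ _).inv) ≫ (α_ _ _ _).inv ≫ (((D.T.obj X ◁ D.i) ≫ (D.δ X ▷ _) ≫
          (_ ◁ D.δ (𝟙_ V)) ≫ D.m (D.T.obj X) (D.T.obj (𝟙_ V)) ≫ D.T.map (D.rmul X)) ▷ D.T.obj Y) ≫
        D.m (D.T.obj X) Y ≫ D.e _ := by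
        rw [← reassoc_of% h2]
        simp only [whiskerLeft_comp, comp_whiskerRight, Category.assoc]
        rw [whisker_exchange_assoc, associator_inv_naturality_middle_assoc,
          associator_inv_naturality_left_assoc, associator_inv_naturality_middle_assoc]
    _ = _ := by
        rw [h1, s]
        simp

theorem lmul_nat {X Y : V} (f : X ⟶ Y) :
    D.lmul X ≫ D.T.map f = (_ ◁ D.T.map f) ≫ D.lmul Y := by
  rw [lmul, lmul, reassoc_of% D.m_nat_right, Category.assoc, ← D.T.map_comp, ← D.T.map_comp,
    leftUnitor_naturality]

theorem sq_eq : D.sq = D.N ≫ D.e _ := by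
  rw [sq, N, κ, s, rmul]
  simp only [Category.assoc, comp_whiskerRight, D.e_nat]

/-- The values `ε(1₁ b) 1₂` involve only the second leg of `Δ(1)`, so two maps that agree on that
leg agree after `κ`. This is how the unit axioms are extended to the whole image of `sq`. -/
theorem κ_comp_eq {W : V} {f g : D.T.obj (𝟙_ V) ⟶ W}
    (h : D.i ≫ D.δ _ ≫ D.T.map f = D.i ≫ D.δ _ ≫ D.T.map g) (Y : V) :
    D.κ Y ≫ (f ▷ Y) = D.κ Y ≫ (g ▷ Y) := by
  simp only [κ, s, Category.assoc, ← D.e_nat, ← reassoc_of% D.m_nat_left]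
  simp only [← comp_whiskerRight_assoc, h]

theorem sq_comp_eq {W : V} {f g : D.T.obj (𝟙_ V) ⟶ W}
    (h : D.i ≫ D.δ _ ≫ D.T.map f = D.i ≫ D.δ _ ≫ D.T.map g) : D.sq ≫ f = D.sq ≫ g := by
  rw [sq, Category.assoc, Category.assoc, ← rightUnitor_naturality, ← rightUnitor_naturality,
    reassoc_of% D.κ_comp_eq h]

theorem i_sq : D.i ≫ D.sq = D.i := by
  rw [sq_eq, N, Category.assoc, leftUnitor_inv_naturality_assoc, Category.assoc,
    whisker_exchange_assoc, rmul, Category.assoc, reassoc_of% D.m_right,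
    rightUnitor_naturality_assoc,
    Category.assoc, D.δ_e, ← unitors_equal]
  simp

section LeftUnitAxiom

variable (hN : D.i ≫ D.δ _ ≫ D.T.map D.N = D.i ≫ D.δ _ ≫ D.δ _)
include hN

/-- Applying the counit to the middle leg of the unit axiom `hN` gives `1₁ • sq(1₂) = 1₁ • 1₂`.
Idempotency of `sq` follows from this. -/
theorem i_δ_sq : D.i ≫ D.δ _ ≫ D.T.map D.sq = D.i ≫ D.δ _ := by
  rw [sq_eq, D.T.map_comp, reassoc_of% hN, D.δ_map_e, Category.comp_id]

theorem κ_sq (Y : V) : D.κ Y ≫ (D.sq ▷ Y) = D.κ Y := by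
  have := D.κ_comp_eq (f := D.sq) (g := 𝟙 _)
    (by rw [D.i_δ_sq hN, D.T.map_id, Category.comp_id]) Y
  rwa [id_whiskerRight, Category.comp_id] at this

theorem sq_sq : D.sq ≫ D.sq = D.sq := by
  have := D.sq_comp_eq (f := D.sq) (g := 𝟙 _)
    (by rw [D.i_δ_sq hN, D.T.map_id, Category.comp_id])
  rwa [Category.comp_id] at this

/-- The axiom `hN` states the identity `Δ(a) = 1₁ a • 1₂` for the second leg of `Δ(1)`, and
`sq_comp_eq` extends it to the image of `sq`. The other unit axiom gives `Δ(a) = a 1₁ • 1₂` in the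
same way (`sq_δ'`). -/
theorem sq_δ : D.sq ≫ D.δ _ = D.sq ≫ D.N :=
  D.sq_comp_eq (by rw [hN, D.coassoc])

end LeftUnitAxiom

theorem sq_δ' (hN : D.i ≫ D.δ _ ≫ D.T.map D.N' = D.i ≫ D.δ _ ≫ D.δ _) :
    D.sq ≫ D.δ _ = D.sq ≫ D.N' :=
  D.sq_comp_eq (by rw [hN, D.coassoc])

theorem lmul_κ (Y : V) : D.lmul Y ≫ D.κ Y = (D.N ▷ D.T.obj Y) ≫ D.m _ Y ≫ D.e _ := by
  have h1 : (_ ◁ D.lmul Y) ≫ D.m (D.T.obj (𝟙_ V)) Y =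
      (α_ _ _ _).inv ≫ (D.rmul (D.T.obj (𝟙_ V)) ▷ _) ≫ D.m (D.T.obj (𝟙_ V)) Y := by
    rw [Iso.eq_inv_comp, lmul, whiskerLeft_comp, Category.assoc, D.m_nat_right,
      ← reassoc_of% D.m_assoc, ← D.T.map_comp, triangle, rmul, comp_whiskerRight, Category.assoc,
      D.m_nat_left]
  rw [κ, s, reassoc_of% leftUnitor_inv_naturality, whisker_exchange_assoc, whisker_exchange_assoc,
    reassoc_of% h1, N]
  simp

/-- For `a` in the image of `sq`, `κ(a b) = ε(1₁ a b) 1₂ = ε(a₁ b) a₂ = a κ(b)`, where the second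
equality is `sq_δ` and the last is `star`. -/
theorem lmul_linear (hN : D.i ≫ D.δ _ ≫ D.T.map D.N = D.i ≫ D.δ _ ≫ D.δ _)
    (hC : ∀ X Y Z : V, (D.T.obj X ◁ D.s Y Z) ≫ (α_ _ _ _).inv ≫ ((D.m X Y ≫ D.e (X ⊗ Y)) ▷ Z) =
      (D.T.obj X ◁ D.m Y Z) ≫ D.m X (Y ⊗ Z) ≫ D.e _ ≫ (α_ _ _ _).inv) (Y : V) :
    (D.sq ▷ _) ≫ D.lmul Y ≫ D.κ Y =
      (D.sq ▷ _) ≫ (_ ◁ D.κ Y) ≫ (α_ _ _ _).inv ≫ (D.rmul (𝟙_ V) ▷ Y) := by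
  rw [← D.star hC, lmul_κ, ← comp_whiskerRight_assoc, ← D.sq_δ hN, s, comp_whiskerRight_assoc]

theorem lmul_δ (Y : V) : D.lmul Y ≫ D.δ Y = (D.δ _ ▷ _) ≫ (_ ◁ D.δ Y) ≫ D.m _ _ ≫
    D.T.map (D.lmul Y) := by
  rw [lmul, Category.assoc, D.δ_nat, reassoc_of% D.m_δ, D.T.map_comp]

theorem i_lmul (Y : V) : (D.i ▷ _) ≫ D.lmul Y = (λ_ _).hom := D.m_left Y

theorem lmul_m (X Y : V) : (D.lmul X ▷ _) ≫ D.m X Y =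
    (α_ _ _ _).hom ≫ (_ ◁ D.m X Y) ≫ D.lmul (X ⊗ Y) := by
  rw [lmul, comp_whiskerRight, Category.assoc, D.m_nat_left, lmul, ← reassoc_of% D.m_assoc,
    ← D.T.map_comp, leftUnitor_tensor_hom, Iso.hom_inv_id_assoc]

/-- For `a` in the image of `sq`, `Δ(a y) = a 1₁ y₁ • 1₂ y₂ = a y₁ • y₂`, by `sq_δ'` and `Δ(1) Δ(y)
= Δ(y)`. -/
theorem sq_lmul_δ (hN : D.i ≫ D.δ _ ≫ D.T.map D.N' = D.i ≫ D.δ _ ≫ D.δ _) (Y : V) :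
    (D.sq ▷ _) ≫ D.lmul Y ≫ D.δ Y = (D.sq ▷ _) ≫ (_ ◁ D.δ Y) ≫ D.lmul (D.T.obj Y) := by
  have h1 : (λ_ _).inv ≫ ((D.i ≫ D.δ _) ▷ _) ≫ (_ ◁ D.δ Y) ≫ D.m _ _ ≫ D.T.map (D.lmul Y) =
      D.δ Y := by
    rw [comp_whiskerRight, Category.assoc, ← D.lmul_δ, reassoc_of% D.i_lmul,
      Iso.inv_hom_id_assoc]
  rw [lmul_δ, ← comp_whiskerRight_assoc, D.sq_δ' hN, comp_whiskerRight_assoc, N',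
    comp_whiskerRight, comp_whiskerRight, Category.assoc, Category.assoc,
    ← whisker_exchange_assoc, reassoc_of% D.lmul_m, D.lmul_nat]
  conv_rhs => rw [← h1]
  simp only [whiskerLeft_comp, Category.assoc]
  rw [associator_naturality_right_assoc, comp_whiskerRight_assoc,
    associator_naturality_middle_assoc, associator_naturality_middle_assoc,
    triangle_assoc_comp_right_inv_assoc, comp_whiskerRight, whiskerLeft_comp_assoc]

/-- The composite is `y ↦ ε(1₁ y₁) 1₂ y₂`, the counit applied to `Δ(1 y)`. It later provides the
section of the base action on `A`. -/
theorem δ_κ_lmul (Y : V) : D.δ Y ≫ D.κ (D.T.obj Y) ≫ D.lmul Y = 𝟙 _ := by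
  rw [κ, s, Category.assoc, Category.assoc, Category.assoc, Category.assoc, ← D.e_nat,
    leftUnitor_inv_naturality_assoc, whisker_exchange_assoc, whisker_exchange_assoc,
    ← reassoc_of% D.lmul_δ, D.δ_e, Category.comp_id, D.i_lmul, Iso.inv_hom_id]

theorem lmul_assoc (Y : V) : (D.lmul (𝟙_ V) ▷ _) ≫ D.lmul Y =
    (α_ _ _ _).hom ≫ (_ ◁ D.lmul Y) ≫ D.lmul Y := by
  conv_lhs => rw [lmul.eq_1 D Y]
  rw [reassoc_of% D.lmul_m, D.lmul_nat, ← whiskerLeft_comp_assoc]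
  rfl

theorem rmul_unit_eq : D.rmul (𝟙_ V) = D.lmul (𝟙_ V) := by
  rw [rmul, lmul, unitors_equal]

/-- `sq` is `κ` at the unit object, so this is a case of `lmul_linear`. It makes the image of `sq`
closed under multiplication. -/
theorem sq_lmul_sq (hN : D.i ≫ D.δ _ ≫ D.T.map D.N = D.i ≫ D.δ _ ≫ D.δ _)
    (hC : ∀ X Y Z : V, (D.T.obj X ◁ D.s Y Z) ≫ (α_ _ _ _).inv ≫ ((D.m X Y ≫ D.e (X ⊗ Y)) ▷ Z) =
      (D.T.obj X ◁ D.m Y Z) ≫ D.m X (Y ⊗ Z) ≫ D.e _ ≫ (α_ _ _ _).inv) :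
    (D.sq ▷ _) ≫ D.lmul (𝟙_ V) ≫ D.sq = (D.sq ▷ _) ≫ (_ ◁ D.sq) ≫ D.lmul (𝟙_ V) := by
  have h1 := D.lmul_linear hN hC (𝟙_ V)
  have h2 := congrArg (· ≫ (ρ_ _).hom) h1
  simp only [Category.assoc, rightUnitor_naturality, rmul_unit_eq] at h2
  have h3 : D.κ (𝟙_ V) ≫ (ρ_ _).hom = D.sq := rfl
  rw [h3] at h2
  rw [h2, ← h3, whiskerLeft_comp, whiskerLeft_rightUnitor]
  simp

end LaxComonad

end WeakBicomonads

end Duo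

namespace Duo

open Duoidal

attribute [-simp] MonoidalCategory.tensor_whiskerLeft MonoidalCategory.whiskerRight_tensor
  MonoidalCategory.id_whiskerLeft MonoidalCategory.whiskerRight_id MonoidalCategory.whisker_assoc

/-! ### The monoid and comonoid laws of `A`. -/

section MonComonLaws

variable {C : Type u} [Category.{v} C] [TwoMonoidal C] (H : MonComon C)

theorem MonComon.one_mul : (H.η ▷⊚ H.A) ≫ H.μ = (cLu H.A).hom := H.mon.one_mul
theorem MonComon.mul_one : (H.A ⊚◁ H.η) ≫ H.μ = (cRu H.A).hom := H.mon.mul_one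
theorem MonComon.mul_assoc :
    (H.μ ▷⊚ H.A) ≫ H.μ = (cAs H.A H.A H.A).hom ≫ (H.A ⊚◁ H.μ) ≫ H.μ := H.mon.mul_assoc
theorem MonComon.counit_comul : H.Δ ≫ (H.ε ▷⊙ H.A) = (bLu H.A).inv := H.comon.counit_comul
theorem MonComon.comul_counit : H.Δ ≫ (H.A ⊙◁ H.ε) = (bRu H.A).inv := H.comon.comul_counit
theorem MonComon.comul_assoc :
    H.Δ ≫ (H.Δ ▷⊙ H.A) ≫ (bAs H.A H.A H.A).hom = H.Δ ≫ (H.A ⊙◁ H.Δ) := H.comon.comul_assoc.symm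

end MonComonLaws

/-! ### The comonad `A • (-)` on `(C, ∘)` and the translation of the axioms. -/

section LeftComonad

variable {C : Type u} [Category.{v} C] [Duoidal C] (H : MonComon C)

/-- The lax monoidal structure of `A • (-)`. -/
def lm (X Y : C) : (H.A ⊙ X) ⊚ (H.A ⊙ Y) ⟶ H.A ⊙ (X ⊚ Y) :=
  ζ H.A X H.A Y ≫ (H.μ ▷⊙ (X ⊚ Y))

/-- The unit of the lax monoidal structure of `A • (-)`. -/
def li : unitI C ⟶ H.A ⊙ unitI C := δ ≫ (H.η ▷⊙ unitI C)

/-- The comultiplication of the comonad `A • (-)`. -/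
def lδ (X : C) : H.A ⊙ X ⟶ H.A ⊙ (H.A ⊙ X) := (H.Δ ▷⊙ X) ≫ (bAs H.A H.A X).hom

/-- The counit of the comonad `A • (-)`. -/
def lε (X : C) : H.A ⊙ X ⟶ X := (H.ε ▷⊙ X) ≫ (bLu X).hom

theorem ζ_unit_left (X Y : C) : (δ ▷⊚ (X ⊙ Y)) ≫ ζ (unitI C) (unitI C) X Y ≫
    ((cLu X).hom ⊙ₘ (cLu Y).hom) = (cLu (X ⊙ Y)).hom := by
  rw [← cancel_epi (cLu (X ⊙ Y)).inv, ζ_δ_left, Iso.inv_hom_id]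

theorem ζ_unit_right (X Y : C) : ((X ⊙ Y) ⊚◁ δ) ≫ ζ X Y (unitI C) (unitI C) ≫
    ((cRu X).hom ⊙ₘ (cRu Y).hom) = (cRu (X ⊙ Y)).hom := by
  rw [← cancel_epi (cRu (X ⊙ Y)).inv, ζ_δ_right, Iso.inv_hom_id]

theorem lm_nat_left {X X' : C} (f : X ⟶ X') (Y : C) :
    ((H.A ⊙◁ f) ▷⊚ (H.A ⊙ Y)) ≫ lm H X' Y = lm H X Y ≫ (H.A ⊙◁ (f ▷⊚ Y)) := by
  rw [lm, lm, ζ_nat₂_assoc, b_exch, Category.assoc]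

theorem lm_nat_right (X : C) {Y Y' : C} (f : Y ⟶ Y') :
    ((H.A ⊙ X) ⊚◁ (H.A ⊙◁ f)) ≫ lm H X Y' = lm H X Y ≫ (H.A ⊙◁ (X ⊚◁ f)) := by
  rw [lm, lm, ζ_nat₄_assoc, b_exch, Category.assoc]

theorem lm_assoc (X Y Z : C) :
    (lm H X Y ▷⊚ (H.A ⊙ Z)) ≫ lm H (X ⊚ Y) Z ≫ (H.A ⊙◁ (cAs X Y Z).hom) =
      (cAs _ _ _).hom ≫ ((H.A ⊙ X) ⊚◁ lm H Y Z) ≫ lm H X (Y ⊚ Z) := by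
  have h1 := ζ_circ_assoc H.A X H.A Y H.A Z
  simp only [lm, cR_comp, cL_comp, Category.assoc, ζ_nat₁_assoc, ζ_nat₃_assoc]
  have h2 := congrArg (· ▷⊙ ((X ⊚ Y) ⊚ Z)) H.mul_assoc
  simp only [bR_comp] at h2
  rw [← reassoc_of% h1, b_hom_def, Category.assoc, b_exch_assoc, b_exch, reassoc_of% h2]

theorem lm_left (X : C) :
    (li H ▷⊚ (H.A ⊙ X)) ≫ lm H (unitI C) X ≫ (H.A ⊙◁ (cLu X).hom) = (cLu (H.A ⊙ X)).hom := by
  rw [← ζ_unit_left, li, lm, cR_comp, Category.assoc, Category.assoc, ζ_nat₁_assoc,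
    ← bR_comp_assoc, H.one_mul, b_hom_def]

theorem lm_right (X : C) :
    ((H.A ⊙ X) ⊚◁ li H) ≫ lm H X (unitI C) ≫ (H.A ⊙◁ (cRu X).hom) = (cRu (H.A ⊙ X)).hom := by
  rw [← ζ_unit_right, li, lm, cL_comp, Category.assoc, Category.assoc, ζ_nat₃_assoc,
    ← bR_comp_assoc, H.mul_one, b_hom_def]

-- The `•`-associativity of `ζ` reduces the claim to comultiplicativity of `μ`, which is the axiom
-- `hH`.
variable {H} in
theorem lm_δ (hH : AxWB H) (X Y : C) : lm H X Y ≫ lδ H (X ⊚ Y) =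
    (lδ H X ▷⊚ (H.A ⊙ Y)) ≫ ((H.A ⊙ (H.A ⊙ X)) ⊚◁ lδ H Y) ≫ lm H (H.A ⊙ X) (H.A ⊙ Y) ≫
      (H.A ⊙◁ lm H X Y) := by
  have h1 := ζ_bull_assoc H.A H.A X H.A H.A Y
  have h2 : ((H.Δ ▷⊙ X) ⊚ₘ (H.Δ ▷⊙ Y)) ≫ ζ (H.A ⊙ H.A) X (H.A ⊙ H.A) Y =
      ζ H.A X H.A Y ≫ ((H.Δ ⊚ₘ H.Δ) ▷⊙ (X ⊚ Y)) := by
    simpa using ζ_natural H.Δ (𝟙 X) H.Δ (𝟙 Y)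
  calc _ = ζ H.A X H.A Y ≫ (((H.Δ ⊚ₘ H.Δ) ≫ ζ H.A H.A H.A H.A ≫ (H.μ ⊙ₘ H.μ)) ▷⊙ (X ⊚ Y)) ≫
        (bAs _ _ _).hom := by
        rw [← hH, lm, lδ, bR_comp, Category.assoc, Category.assoc]
    _ = ((H.Δ ▷⊙ X) ⊚ₘ (H.Δ ▷⊙ Y)) ≫ ζ (H.A ⊙ H.A) X (H.A ⊙ H.A) Y ≫
        (ζ H.A H.A H.A H.A ▷⊙ (X ⊚ Y)) ≫ (bAs _ _ _).hom ≫
          (H.μ ▷⊙ _) ≫ (H.A ⊙◁ (H.μ ▷⊙ (X ⊚ Y))) := by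
        rw [reassoc_of% h2, b_hom_def]
        simp only [bR_comp, Category.assoc, bAs_nat₁_assoc, bAs_nat₂]
    _ = _ := by
        rw [reassoc_of% h1, ← Category.assoc (_ ⊚ₘ _), ← c_hom_comp, ← lδ, ← lδ, c_hom_def, lm, lm,
          bL_comp, b_exch_assoc]
        simp only [Category.assoc]

theorem lδ_nat {X Y : C} (f : X ⟶ Y) :
    (H.A ⊙◁ f) ≫ lδ H Y = lδ H X ≫ (H.A ⊙◁ (H.A ⊙◁ f)) := by
  rw [lδ, lδ, b_exch_assoc, bAs_nat₃, Category.assoc]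

theorem lε_nat {X Y : C} (f : X ⟶ Y) : (H.A ⊙◁ f) ≫ lε H Y = lε H X ≫ f := by
  rw [lε, lε, b_exch_assoc, bLu_nat, Category.assoc]

theorem lδ_lε (X : C) : lδ H X ≫ lε H (H.A ⊙ X) = 𝟙 _ := by
  rw [lδ, lε, Category.assoc, ← bAs_nat₁_assoc, ← bR_comp_assoc, H.counit_comul]
  simp

theorem lδ_map_lε (X : C) : lδ H X ≫ (H.A ⊙◁ lε H X) = 𝟙 _ := by
  rw [lδ, lε, bL_comp, Category.assoc, ← bAs_nat₂_assoc, ← bR_comp_assoc, H.comul_counit]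
  simp

theorem lδ_coassoc (X : C) : lδ H X ≫ (H.A ⊙◁ lδ H X) = lδ H X ≫ lδ H (H.A ⊙ X) := by
  have h1 := congrArg (· ▷⊙ X) H.comul_assoc
  simp only [bR_comp] at h1
  simp only [lδ, bL_comp, Category.assoc]
  rw [← bAs_nat₂_assoc, ← bAs_nat₁_assoc, ← reassoc_of% h1]
  simp

variable {H} in
/-- The comonad `A • (-)` on `(C, ∘)`. -/
@[reducible]
def leftComonad (hH : AxWB H) : @LaxComonad C _ TwoMonoidal.circ :=
  letI := (TwoMonoidal.circ (C := C))
  { T :=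
      { obj := fun X => H.A ⊙ X
        map := fun f => H.A ⊙◁ f
        map_id := fun _ => TwoMonoidal.bull.whiskerLeft_id _ _
        map_comp := fun f g => bL_comp _ f g }
    m := lm H
    i := li H
    δ := lδ H
    e := lε H
    m_nat_left := lm_nat_left H
    m_nat_right := lm_nat_right H
    m_assoc := lm_assoc H
    m_left := lm_left H
    m_right := lm_right H
    δ_nat := lδ_nat H
    e_nat := lε_nat H
    δ_e := lδ_lε H
    δ_map_e := lδ_map_lε H
    coassoc := lδ_coassoc H
    m_δ := lm_δ hH }

/-- In Sweedler notation, `a ∘ b ↦ ε(a₁ b) a₂`. -/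
def ls (X Y : C) : (H.A ⊙ X) ⊚ (H.A ⊙ Y) ⟶ (H.A ⊙ X) ⊚ Y :=
  (lδ H X ▷⊚ (H.A ⊙ Y)) ≫ lm H (H.A ⊙ X) Y ≫ lε H ((H.A ⊙ X) ⊚ Y)

/-- In Sweedler notation, `b ↦ ε(1₁ b) 1₂`. -/
def lκ (Y : C) : H.A ⊙ Y ⟶ (H.A ⊙ unitI C) ⊚ Y :=
  (cLu _).inv ≫ (li H ▷⊚ (H.A ⊙ Y)) ≫ ls H (unitI C) Y

/-- The left action of the monoid `A • I` on `A • X`. -/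
def lmul (X : C) : (H.A ⊙ unitI C) ⊚ (H.A ⊙ X) ⟶ H.A ⊙ X :=
  lm H (unitI C) X ≫ (H.A ⊙◁ (cLu X).hom)

/-- The right action of the monoid `A • I` on `A • X`. -/
def lrmul (X : C) : (H.A ⊙ X) ⊚ (H.A ⊙ unitI C) ⟶ H.A ⊙ X :=
  lm H X (unitI C) ≫ (H.A ⊙◁ (cRu X).hom)

/-- The counit axiom of the weak bimonoid, in terms of the comonad `A • (-)`. -/
def LeftCounit : Prop := ∀ X Y Z : C,
  ((H.A ⊙ X) ⊚◁ ls H Y Z) ≫ (cAs _ _ _).inv ≫ ((lm H X Y ≫ lε H (X ⊚ Y)) ▷⊚ Z) =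
    ((H.A ⊙ X) ⊚◁ lm H Y Z) ≫ lm H X (Y ⊚ Z) ≫ lε H _ ≫ (cAs _ _ _).inv

variable {H}

theorem ls_eq (hH : AxWB H) (hC : LeftCounit H) (X Y : C) :
    ls H X Y = ((H.A ⊙ X) ⊚◁ lκ H Y) ≫ (cAs _ _ _).inv ≫ (lrmul H X ▷⊚ Y) :=
  @LaxComonad.star C _ TwoMonoidal.circ (leftComonad hH) hC X Y

variable (H) in
/-- In Sweedler notation, `a ↦ 1₁ a • 1₂`. -/
def lN : H.A ⊙ unitI C ⟶ H.A ⊙ (H.A ⊙ unitI C) :=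
  (cLu _).inv ≫ ((li H ≫ lδ H _) ▷⊚ (H.A ⊙ unitI C)) ≫ lrmul H (H.A ⊙ unitI C)

variable (H) in
/-- In Sweedler notation, `a ↦ a 1₁ • 1₂`. -/
def lN' : H.A ⊙ unitI C ⟶ H.A ⊙ (H.A ⊙ unitI C) :=
  (cRu _).inv ≫ ((H.A ⊙ unitI C) ⊚◁ (li H ≫ lδ H _)) ≫ lmul H (H.A ⊙ unitI C)

theorem sqcapL_eq (hH : AxWB H) : sqcapL H = lκ H (unitI C) ≫ (cRu _).hom := by
  refine Eq.trans ?_ (@LaxComonad.sq_eq C _ TwoMonoidal.circ (leftComonad hH)).symm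
  change _ = lN H ≫ lε H _
  simp only [lN, lrmul, sqcapL, li, lδ, lm, lε, bR_comp, cR_comp, b_hom_def, Category.assoc,
    ← b_exch_assoc]

theorem left_unit_axiom (hU : AxLLU H) :
    li H ≫ lδ H _ ≫ (H.A ⊙◁ lN H) = li H ≫ lδ H _ ≫ lδ H _ := by
  have h1 := hU
  simp only [AxLLU, unitPathL, b_hom_def, bR_comp, bL_comp, cR_comp, Category.assoc] at h1
  simp only [lN, lrmul, li, lδ, lm, bL_comp, cR_comp, Category.assoc]
  exact h1

theorem right_unit_axiom (hU : AxLRU H) :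
    li H ≫ lδ H _ ≫ (H.A ⊙◁ lN' H) = li H ≫ lδ H _ ≫ lδ H _ := by
  have h1 := hU
  simp only [AxLRU, unitPathL, b_hom_def, bR_comp, bL_comp, cL_comp, Category.assoc] at h1
  simp only [lN', lmul, li, lδ, lm, bL_comp, cL_comp, Category.assoc]
  exact h1

theorem ϖ_unit_right {X : C} (f : X ⟶ unitJ C) :
    (X ⊚◁ τ) ≫ (f ▷⊚ unitJ C) ≫ ϖ = (cRu X).hom ≫ f := by
  rw [c_exch_assoc, ϖ_one_right, cRu_nat]

variable (H) in
/-- In Sweedler notation, `y ∘ b ↦ ε(y₁ b) y₂ ∘ J`. -/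
def counitStep : H.A ⊚ H.A ⟶ H.A ⊚ unitJ C :=
  (H.Δ ▷⊚ H.A) ≫ ((H.A ⊙ H.A) ⊚◁ (bRu H.A).inv) ≫ ζ H.A H.A H.A (unitJ C) ≫
    ((H.μ ≫ H.ε) ▷⊙ (H.A ⊚ unitJ C)) ≫ (bLu (H.A ⊚ unitJ C)).hom

variable (H) in
/-- In Sweedler notation, `a ∘ b ∘ J ↦ ε(a b)`. -/
def counitEnd : H.A ⊚ (H.A ⊚ unitJ C) ⟶ unitJ C :=
  (cAs H.A H.A (unitJ C)).inv ≫ ((H.μ ≫ H.ε) ▷⊚ unitJ C) ≫ ϖ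

variable (H) in
/-- The morphism `A ≅ A ∘ I ⟶ A ∘ J`. -/
def insJ : H.A ⟶ H.A ⊚ unitJ C := (cRu H.A).inv ≫ (H.A ⊚◁ τ)

theorem insJ_counitEnd {X : C} (f : X ⊚ H.A ⟶ unitJ C) :
    (X ⊚◁ insJ H) ≫ (cAs X H.A (unitJ C)).inv ≫ (f ▷⊚ unitJ C) ≫ ϖ = f := by
  rw [insJ, cL_comp, Category.assoc, cAs_inv_nat₃_assoc, ϖ_unit_right]
  simp

/-- The axiom carries a spare factor `J`. Precomposing with `A ≅ A ∘ I ⟶ A ∘ J` and using that `τ`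
is the unit of `ϖ` removes it, leaving `ε(y₁ b) ε(x y₂) = ε(x y b)`. -/
theorem counitStep_counitEnd (hC : AxRRC H) :
    (H.A ⊚◁ counitStep H) ≫ counitEnd H = (H.A ⊚◁ H.μ) ≫ H.μ ≫ H.ε := by
  have h1 : (H.A ⊚◁ (H.A ⊚◁ insJ H)) ≫ _ = _ ≫ counitPathL H :=
    congrArg ((H.A ⊚◁ (H.A ⊚◁ insJ H)) ≫ ·) hC
  have h2 : (H.A ⊚◁ insJ H) ≫ ((H.Δ ▷⊚ (H.A ⊚ unitJ C)) ≫
      ((H.A ⊙ H.A) ⊚◁ (bRu (H.A ⊚ unitJ C)).inv) ≫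
      ζ H.A H.A (H.A ⊚ unitJ C) (unitJ C) ≫
      (((cAs H.A H.A (unitJ C)).inv ≫ ((H.μ ≫ H.ε) ▷⊚ unitJ C) ≫ ϖ) ▷⊙ (H.A ⊚ unitJ C)) ≫
      (bLu (H.A ⊚ unitJ C)).hom) = counitStep H := by
    rw [c_exch_assoc, ← cL_comp_assoc, bRu_inv_nat, cL_comp_assoc, ζ_nat₃_assoc, ← bR_comp_assoc,
      insJ_counitEnd, counitStep]
  have h3 : (H.A ⊚◁ (H.A ⊚◁ insJ H)) ≫ counitPathL H = (H.A ⊚◁ H.μ) ≫ H.μ ≫ H.ε := by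
    rw [counitPathL, cAs_inv_nat₃_assoc, c_exch_assoc, ← cR_comp_assoc H.μ H.ε, insJ_counitEnd,
      reassoc_of% H.mul_assoc, Iso.inv_hom_id_assoc]
  rw [h3, ← cL_comp_assoc, h2] at h1
  exact h1

/-- Reading `Z` as `J • Z` allows the next interchange to be performed; by the `•`-associativity of
`ζ` everything on the `A`-side then collects into `counitStep`. The factor `J` left there is the
trace of `Z`. -/
theorem ls_ζ (Y Z : C) : ls H Y Z ≫ ((H.A ⊙ Y) ⊚◁ (bLu Z).inv) ≫ ζ H.A Y (unitJ C) Z =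
    ζ H.A Y H.A Z ≫ (counitStep H ▷⊙ (Y ⊚ Z)) := by
  have h1 := ζ_bull_assoc H.A H.A Y H.A (unitJ C) Z
  have h2 : (bLu (H.A ⊚ unitJ C)).hom ▷⊙ (Y ⊚ Z) = (bAs _ _ _).hom ≫ (bLu _).hom :=
    @MonoidalCategory.leftUnitor_whiskerRight _ _ TwoMonoidal.bull _ _
  have h3 : ((bRu H.A).inv ▷⊙ Z) ≫ (bAs H.A (unitJ C) Z).hom = H.A ⊙◁ (bLu Z).inv := by
    simp
  symm
  simp only [counitStep, bR_comp, h2]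
  simp only [Category.assoc]
  rw [← ζ_nat₁_assoc, ← ζ_nat₃_assoc, bAs_nat₁_assoc, bAs_nat₁_assoc, reassoc_of% h1, c_hom_def,
    b_exch_assoc, b_exch_assoc, bLu_nat, Category.assoc, c_exch_assoc, ← cL_comp_assoc, h3,
    ζ_nat₄_assoc, b_exch_assoc, b_exch_assoc, bLu_nat_assoc]
  simp only [ls, lδ, lm, lε, cR_comp, Category.assoc]

/-- The companion of `ls_ζ`: with `Z` read as `J • Z`, the `∘`-associativity of `ζ` collects the
second evaluation into `counitEnd`. Together they separate the `A`-factors from `X`, `Y`, `Z`, so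
that an identity for `A` alone implies `LeftCounit`. -/
theorem cAs_lm_lε (X Y Z : C) :
    (cAs (H.A ⊙ X) (H.A ⊙ Y) Z).inv ≫ ((lm H X Y ≫ lε H (X ⊚ Y)) ▷⊚ Z) =
      ((H.A ⊙ X) ⊚◁ (((H.A ⊙ Y) ⊚◁ (bLu Z).inv) ≫ ζ H.A Y (unitJ C) Z)) ≫
        ζ H.A X (H.A ⊚ unitJ C) (Y ⊚ Z) ≫ (counitEnd H ▷⊙ _) ≫ (bLu _).hom ≫ (cAs X Y Z).inv := by
  have h1 := ζ_circ_assoc H.A X H.A Y (unitJ C) Z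
  have h2 := ζ_ϖ_left (X ⊚ Y) Z
  have h3 : ((bLu (X ⊚ Y)).hom ▷⊚ Z) =
      (_ ⊚◁ (bLu Z).inv) ≫ ζ (unitJ C) (X ⊚ Y) (unitJ C) Z ≫ (ϖ ▷⊙ _) ≫ (bLu _).hom := by
    rw [← cancel_epi ((bLu (X ⊚ Y)).inv ▷⊚ Z), ← reassoc_of% @c_hom_def, h2]
    simp
  rw [← cancel_epi (cAs _ _ _).hom, ← cancel_mono (cAs _ _ _).hom]
  simp only [Category.assoc, Iso.hom_inv_id_assoc, Iso.inv_hom_id, Category.comp_id, cL_comp]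
  have h4 : ((cAs H.A H.A (unitJ C)).hom ⊙ₘ (cAs X Y Z).hom) ≫ (counitEnd H ▷⊙ _) =
      (((H.μ ≫ H.ε) ▷⊚ unitJ C) ▷⊙ _) ≫ (ϖ ▷⊙ _) ≫ (_ ⊙◁ (cAs X Y Z).hom) := by
    rw [b_hom_def, Category.assoc, b_exch, ← bR_comp_assoc, counitEnd, Iso.hom_inv_id_assoc,
      bR_comp_assoc]
  rw [← cAs_nat₃_assoc, ← reassoc_of% h1, reassoc_of% h4, bLu_nat, lm, lε, ← bR_comp_assoc,
    cR_comp, cR_comp, cR_comp, h3]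
  simp only [Category.assoc, ← cR_comp_assoc]
  simp only [cR_comp, bR_comp, Category.assoc, ← c_exch_assoc, ← ζ_nat₁_assoc]

theorem leftCounit_of_axRRC (hC : AxRRC H) : LeftCounit H := by
  intro X Y Z
  rw [cAs_lm_lε, ← cL_comp_assoc, ls_ζ, cL_comp_assoc, ζ_nat₃_assoc, ← bR_comp_assoc,
    counitStep_counitEnd hC]
  simp only [lm, lε, cL_comp, Category.assoc, bR_comp, ζ_nat₃_assoc]

end LeftComonad

end Duo

namespace Duo

open Duoidal

/-! ### The base idempotent of a weak bimonoid. -/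

section BaseIdempotent

variable {C : Type u} [Category.{v} C] [Duoidal C] {H : MonComon C}

theorem lκ_nat {Y Y' : C} (f : Y ⟶ Y') :
    (H.A ⊙◁ f) ≫ lκ H Y' = lκ H Y ≫ ((H.A ⊙ unitI C) ⊚◁ f) := by
  rw [lκ, lκ, cLu_inv_nat_assoc, c_exch_assoc, ls, ls, c_exch_assoc, reassoc_of% @lm_nat_right,
    lε_nat]
  simp only [Category.assoc]

theorem lmul_nat {X Y : C} (f : X ⟶ Y) :
    lmul H X ≫ (H.A ⊙◁ f) = (_ ⊚◁ (H.A ⊙◁ f)) ≫ lmul H Y := by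
  rw [lmul, lmul, reassoc_of% @lm_nat_right, Category.assoc, ← bL_comp, ← bL_comp, cLu_nat]

theorem li_lmul (Y : C) : (li H ▷⊚ (H.A ⊙ Y)) ≫ lmul H Y = (cLu _).hom := lm_left H Y

theorem lrmul_unit : lrmul H (unitI C) = lmul H (unitI C) := by
  have h1 : (cLu (unitI C)).hom = (cRu (unitI C)).hom :=
    @MonoidalCategory.unitors_equal _ _ TwoMonoidal.circ
  rw [lrmul, lmul, h1]

theorem lmul_li : ((H.A ⊙ unitI C) ⊚◁ li H) ≫ lmul H (unitI C) = (cRu _).hom := by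
  rw [← lrmul_unit]
  exact lm_right H _

variable (hH : IsWeakBimonoid H)
include hH

theorem IsWeakBimonoid.sqcapL_def :
    sqcapL H = @LaxComonad.sq C _ TwoMonoidal.circ (leftComonad hH.right.wb) :=
  sqcapL_eq hH.right.wb

theorem IsWeakBimonoid.sqcapL_sqcapL : sqcapL H ≫ sqcapL H = sqcapL H := by
  rw [hH.sqcapL_def]
  exact @LaxComonad.sq_sq C _ TwoMonoidal.circ (leftComonad hH.right.wb)
    (left_unit_axiom hH.left.llu)

theorem IsWeakBimonoid.li_sqcapL : li H ≫ sqcapL H = li H := by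
  rw [hH.sqcapL_def]
  exact @LaxComonad.i_sq C _ TwoMonoidal.circ (leftComonad hH.right.wb)

theorem IsWeakBimonoid.lκ_sqcapL (Y : C) : lκ H Y ≫ (sqcapL H ▷⊚ Y) = lκ H Y := by
  rw [hH.sqcapL_def]
  exact @LaxComonad.κ_sq C _ TwoMonoidal.circ (leftComonad hH.right.wb)
    (left_unit_axiom hH.left.llu) Y

theorem IsWeakBimonoid.sqcapL_lmul_sqcapL :
    (sqcapL H ▷⊚ _) ≫ lmul H (unitI C) ≫ sqcapL H =
      (sqcapL H ▷⊚ _) ≫ (_ ⊚◁ sqcapL H) ≫ lmul H (unitI C) := by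
  rw [hH.sqcapL_def]
  exact @LaxComonad.sq_lmul_sq C _ TwoMonoidal.circ (leftComonad hH.right.wb)
    (left_unit_axiom hH.left.llu) (leftCounit_of_axRRC hH.left.rrc)

theorem IsWeakBimonoid.lmul_assoc (Y : C) : (lmul H (unitI C) ▷⊚ _) ≫ lmul H Y =
    (cAs _ _ _).hom ≫ (_ ⊚◁ lmul H Y) ≫ lmul H Y :=
  @LaxComonad.lmul_assoc C _ TwoMonoidal.circ (leftComonad hH.right.wb) Y

theorem IsWeakBimonoid.lmul_lκ (Y : C) : (sqcapL H ▷⊚ _) ≫ lmul H Y ≫ lκ H Y =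
    (sqcapL H ▷⊚ _) ≫ (_ ⊚◁ lκ H Y) ≫ (cAs _ _ _).inv ≫ (lmul H (unitI C) ▷⊚ Y) := by
  rw [hH.sqcapL_def, ← lrmul_unit]
  exact @LaxComonad.lmul_linear C _ TwoMonoidal.circ (leftComonad hH.right.wb)
    (left_unit_axiom hH.left.llu) (leftCounit_of_axRRC hH.left.rrc) Y

theorem IsWeakBimonoid.lmul_lδ (Y : C) : (sqcapL H ▷⊚ _) ≫ lmul H Y ≫ lδ H Y =
    (sqcapL H ▷⊚ _) ≫ (_ ⊚◁ lδ H Y) ≫ lmul H (H.A ⊙ Y) := by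
  rw [hH.sqcapL_def]
  exact @LaxComonad.sq_lmul_δ C _ TwoMonoidal.circ (leftComonad hH.right.wb)
    (right_unit_axiom hH.right.lru) Y

theorem IsWeakBimonoid.lδ_lκ_lmul (Y : C) : lδ H Y ≫ lκ H (H.A ⊙ Y) ≫ lmul H Y = 𝟙 _ :=
  @LaxComonad.δ_κ_lmul C _ TwoMonoidal.circ (leftComonad hH.right.wb) Y

end BaseIdempotent

/-! ### Colinearity over the comonoid `I`. -/

section Colinearity

variable {C : Type u} [Category.{v} C] [Duoidal C]

/-- The morphism `f` is compatible with the morphisms `r` and `s`, thought of as coactions of the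
`•`-comonoid `I`. -/
def Colinear {X Y : C} (r : X ⟶ X ⊙ unitI C) (s : Y ⟶ Y ⊙ unitI C) (f : X ⟶ Y) : Prop :=
  f ≫ s = r ≫ (f ▷⊙ unitI C)

theorem Colinear.comp {X Y Z : C} {r : X ⟶ X ⊙ unitI C} {s : Y ⟶ Y ⊙ unitI C}
    {t : Z ⟶ Z ⊙ unitI C} {f : X ⟶ Y} {g : Y ⟶ Z} (hf : Colinear r s f) (hg : Colinear s t g) :
    Colinear r t (f ≫ g) := by
  rw [Colinear] at *
  rw [Category.assoc, hg, reassoc_of% hf, bR_comp]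

theorem Colinear.inv {X Y : C} {r : X ⟶ X ⊙ unitI C} {s : Y ⟶ Y ⊙ unitI C}
    {f : X ≅ Y} (hf : Colinear r s f.hom) : Colinear s r f.inv := by
  rw [Colinear] at *
  rw [Iso.inv_comp_eq, ← Category.assoc, hf]
  simp

/-- The coaction on a `∘`-product. -/
def tensorCoact {X Y : C} (r : X ⟶ X ⊙ unitI C) (s : Y ⟶ Y ⊙ unitI C) :
    X ⊚ Y ⟶ (X ⊚ Y) ⊙ unitI C :=
  (r ⊚ₘ s) ≫ ζ X (unitI C) Y (unitI C) ≫ ((X ⊚ Y) ⊙◁ (cLu (unitI C)).hom)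

theorem Colinear.whiskerRight {X X' Y : C} {r : X ⟶ X ⊙ unitI C} {r' : X' ⟶ X' ⊙ unitI C}
    {f : X ⟶ X'} (hf : Colinear r r' f) (s : Y ⟶ Y ⊙ unitI C) :
    Colinear (tensorCoact r s) (tensorCoact r' s) (f ▷⊚ Y) := by
  rw [Colinear] at *
  rw [tensorCoact, tensorCoact, c_hom_def, c_hom_def, Category.assoc, ← cR_comp_assoc, hf, cR_comp,
    Category.assoc, Category.assoc, ← c_exch_assoc, ζ_nat₁_assoc]
  simp only [Category.assoc, b_exch]

theorem colinear_cLu {X : C} (r : X ⟶ X ⊙ unitI C) :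
    Colinear (tensorCoact δ r) r (cLu X).hom := by
  rw [Colinear, tensorCoact, Category.assoc, Category.assoc, b_exch, ← b_hom_def, c_hom_def,
    ← c_exch, ← cLu_nat, ← ζ_unit_left X (unitI C), Category.assoc]

theorem colinear_cRu {X : C} (r : X ⟶ X ⊙ unitI C) :
    Colinear (tensorCoact r δ) r (cRu X).hom := by
  have h1 : (cLu (unitI C)).hom = (cRu (unitI C)).hom :=
    @MonoidalCategory.unitors_equal _ _ TwoMonoidal.circ
  rw [Colinear, tensorCoact, Category.assoc, Category.assoc, b_exch, ← b_hom_def, c_hom_def,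
    h1, Category.assoc, ζ_unit_right X (unitI C), cRu_nat]

variable (H : MonComon C)

/-- The coaction on `A • X`. -/
def leftCoact {X : C} (r : X ⟶ X ⊙ unitI C) : H.A ⊙ X ⟶ (H.A ⊙ X) ⊙ unitI C :=
  (H.A ⊙◁ r) ≫ (bAs H.A X (unitI C)).inv

variable {H}

theorem Colinear.left {X Y : C} {r : X ⟶ X ⊙ unitI C} {s : Y ⟶ Y ⊙ unitI C} {f : X ⟶ Y}
    (hf : Colinear r s f) : Colinear (leftCoact H r) (leftCoact H s) (H.A ⊙◁ f) := by
  rw [Colinear] at *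
  rw [leftCoact, leftCoact, ← bL_comp_assoc, hf, bL_comp, Category.assoc, Category.assoc,
    bAs_inv_nat₂]

theorem colinear_lm {X Y : C} (r : X ⟶ X ⊙ unitI C) (s : Y ⟶ Y ⊙ unitI C) :
    Colinear (tensorCoact (leftCoact H r) (leftCoact H s)) (leftCoact H (tensorCoact r s))
      (lm H X Y) := by
  have h1 := ζ_bull_assoc H.A X (unitI C) H.A Y (unitI C)
  have h2 : ((H.A ⊙◁ r) ⊚ₘ (H.A ⊙◁ s)) ≫ ζ H.A (X ⊙ unitI C) H.A (Y ⊙ unitI C) =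
      ζ H.A X H.A Y ≫ ((H.A ⊚ H.A) ⊙◁ (r ⊚ₘ s)) := by
    simpa using ζ_natural (𝟙 H.A) r (𝟙 H.A) s
  rw [Colinear, ← cancel_mono (bAs _ _ _).hom]
  have h3 : tensorCoact (leftCoact H r) (leftCoact H s) ≫ (lm H X Y ▷⊙ unitI C) ≫
      (bAs _ _ _).hom = ((H.A ⊙◁ r) ⊚ₘ (H.A ⊙◁ s)) ≫ ((bAs _ _ _).inv ⊚ₘ (bAs _ _ _).inv) ≫
        (ζ (H.A ⊙ X) (unitI C) (H.A ⊙ Y) (unitI C) ≫ (ζ H.A X H.A Y ▷⊙ _) ≫ (bAs _ _ _).hom) ≫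
          (H.μ ▷⊙ _) ≫ (H.A ⊙◁ (_ ⊙◁ (cLu (unitI C)).hom)) := by
    rw [tensorCoact, leftCoact, leftCoact, c_hom_comp, lm, bR_comp]
    simp only [Category.assoc, b_exch_assoc]
    rw [bAs_nat₃, bAs_nat₁_assoc]
  rw [Category.assoc, Category.assoc, h3, h1, ← c_hom_comp_assoc]
  simp only [Category.assoc]
  rw [← c_hom_comp_assoc]
  simp only [Category.assoc, Iso.inv_hom_id, Category.comp_id]
  rw [reassoc_of% h2, leftCoact, tensorCoact, Category.assoc, Iso.inv_hom_id, Category.comp_id, lm,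
    Category.assoc]
  simp only [b_exch_assoc, bL_comp]

theorem colinear_lδ {X : C} (r : X ⟶ X ⊙ unitI C) :
    Colinear (leftCoact H r) (leftCoact H (leftCoact H r)) (lδ H X) := by
  have h1 : (bAs H.A H.A X).hom ▷⊙ unitI C = (bAs _ _ _).hom ≫ (bAs _ _ _).hom ≫
      (H.A ⊙◁ (bAs _ _ _).inv) ≫ (bAs _ _ _).inv := by
    simp
  simp only [Colinear, leftCoact, lδ, bR_comp, bL_comp, Category.assoc]
  rw [h1, ← bAs_inv_nat₁_assoc, Iso.inv_hom_id_assoc, b_exch_assoc, bAs_nat₃_assoc]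

theorem colinear_lε {X : C} (r : X ⟶ X ⊙ unitI C) : Colinear (leftCoact H r) r (lε H X) := by
  have h1 : (bLu X).hom ▷⊙ unitI C = (bAs _ _ _).hom ≫ (bLu _).hom :=
    @MonoidalCategory.leftUnitor_whiskerRight _ _ TwoMonoidal.bull _ _
  rw [Colinear, leftCoact, lε, bR_comp, Category.assoc, Category.assoc, h1, ← bAs_inv_nat₁_assoc,
    Iso.inv_hom_id_assoc, b_exch_assoc, bLu_nat]

theorem colinear_li : Colinear δ (leftCoact H δ) (li H) := by
  rw [Colinear, leftCoact, li, bR_comp, Category.assoc, ← b_exch_assoc, ← reassoc_of% δ_coassoc,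
    bAs_inv_nat₁, Iso.hom_inv_id_assoc]

theorem colinear_lmul {X : C} (r : X ⟶ X ⊙ unitI C) :
    Colinear (tensorCoact (leftCoact H δ) (leftCoact H r)) (leftCoact H r) (lmul H X) :=
  (colinear_lm δ r).comp (colinear_cLu r).left

/-- The idempotent is a composite of structure maps of `A • (-)` and unitors, each of them colinear.
Hence its image inherits the coaction of `A • I`. -/
theorem colinear_sqcapL (hH : AxWB H) : Colinear (leftCoact H δ) (leftCoact H δ) (sqcapL H) := by
  have h1 : sqcapL H = (cLu _).inv ≫ ((li H ≫ lδ H _) ▷⊚ (H.A ⊙ unitI C)) ≫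
      (lm H (H.A ⊙ unitI C) (unitI C) ≫ (H.A ⊙◁ (cRu _).hom)) ≫ lε H _ := by
    refine (sqcapL_eq hH).trans ((@LaxComonad.sq_eq C _ TwoMonoidal.circ (leftComonad hH)).trans ?_)
    change lN H ≫ lε H _ = _
    simp only [lN, lrmul, Category.assoc]
  rw [h1]
  exact (colinear_cLu _).inv.comp (((colinear_li.comp (colinear_lδ δ)).whiskerRight _).comp
    (((colinear_lm _ _).comp (colinear_cRu _).left).comp (colinear_lε _)))

end Colinearity

/-! ### The unit `I` as a monoid and comonoid. -/

section Unit

variable {C : Type u} [Category.{v} C] [Duoidal C]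

theorem cLu_δ : (cLu (unitI C)).hom ≫ δ = (δ ⊚ₘ δ) ≫ ζ (unitI C) (unitI C) (unitI C) (unitI C) ≫
    ((cLu (unitI C)).hom ⊙ₘ (cLu (unitI C)).hom) := by
  rw [c_hom_def, Category.assoc, ← c_exch_assoc, ζ_unit_left, cLu_nat]

theorem cLu_τ : (cLu (unitI C)).hom ≫ τ = (τ ⊚ₘ τ) ≫ ϖ := by
  rw [c_hom_def, Category.assoc, ← c_exch_assoc, ϖ_one_left, cLu_nat]

theorem cLu_unit_assoc (X : C) : ((cLu (unitI C)).hom ▷⊚ X) ≫ (cLu X).hom =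
    (cAs (unitI C) (unitI C) X).hom ≫ (unitI C ⊚◁ (cLu X).hom) ≫ (cLu X).hom := by
  simp

theorem entw_act_counit {X Y Y' Z : C} {c : X ⟶ X ⊙ Y'} {m : Y ⊚ Y' ⟶ Z}
    {eY : Y ⟶ unitJ C} {eY' : Y' ⟶ unitJ C} {eZ : Z ⟶ unitJ C}
    (hc : c ≫ (X ⊙◁ eY') = (bRu X).inv) (hm : m ≫ eZ = (eY ⊚ₘ eY') ≫ ϖ) {M : C}
    (a : M ⊚ X ⟶ M) :
    (entw c m M ≫ (a ▷⊙ Z)) ≫ (M ⊙◁ eZ) ≫ (bRu M).hom =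
      (((M ⊙◁ eY) ≫ (bRu M).hom) ▷⊚ X) ≫ a := by
  rw [Category.assoc, ← b_exch_assoc, bRu_nat, reassoc_of% entw_counit hc hm M]

end Unit

/-! ### The base monoid and the lifting of `(-) • I`. -/

section BaseMonoid

variable {C : Type u} [Category.{v} C] [Duoidal C] {H : MonComon C} (L : Splitting (sqcapL H))

theorem leftCoact_counit : leftCoact H δ ≫ ((H.A ⊙ unitI C) ⊙◁ τ) = (bRu (H.A ⊙ unitI C)).inv := by
  rw [leftCoact, Category.assoc, ← bAs_inv_nat₃, ← bL_comp_assoc, δ_counit_right]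
  simp

theorem leftCoact_coassoc : leftCoact H δ ≫ (leftCoact H δ ▷⊙ unitI C) ≫ (bAs _ _ _).hom =
    leftCoact H δ ≫ ((H.A ⊙ unitI C) ⊙◁ δ) := by
  have h1 := congrArg (H.A ⊙◁ ·) (δ_coassoc (C := C))
  simp only [bL_comp] at h1
  have h2 : (bAs H.A (unitI C) (unitI C)).inv ▷⊙ unitI C ≫ (bAs _ _ _).hom =
      (bAs _ _ _).hom ≫ (H.A ⊙◁ (bAs _ _ _).hom) ≫ (bAs _ _ _).inv := by
    simp
  rw [leftCoact, bR_comp, Category.assoc, Category.assoc, Category.assoc, h2,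
    ← bAs_inv_nat₃, ← reassoc_of% h1, reassoc_of% @bAs_nat₂, Iso.inv_hom_id_assoc]

theorem baseMul_eq : baseMul L = (L.ι ⊚ₘ L.ι) ≫ lmul H (unitI C) ≫ L.π := by
  rw [baseMul, lmul, lm, b_hom_def]
  simp only [Category.assoc]

theorem baseOne_eq : baseOne L = li H ≫ L.π := by
  rw [baseOne, li, Category.assoc]

theorem baseCoact_eq : baseCoact L = L.ι ≫ leftCoact H δ ≫ (L.π ▷⊙ unitI C) := by
  rw [baseCoact, leftCoact, Category.assoc]

theorem Colinear.whiskerLeft {X Y Y' : C} {s : Y ⟶ Y ⊙ unitI C} {s' : Y' ⟶ Y' ⊙ unitI C}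
    {f : Y ⟶ Y'} (r : X ⟶ X ⊙ unitI C) (hf : Colinear s s' f) :
    Colinear (tensorCoact r s) (tensorCoact r s') (X ⊚◁ f) := by
  rw [Colinear] at *
  rw [tensorCoact, tensorCoact, c_hom_def, c_hom_def, Category.assoc, c_exch_assoc,
    ← cL_comp_assoc, hf, cL_comp, Category.assoc, Category.assoc, Category.assoc, ζ_nat₃_assoc]
  simp only [Category.assoc, b_exch]

variable (hH : IsWeakBimonoid H)
include hH

/-- For `a` and `b` in the image, `sq(a b) = a sq(b) = a b`. So the projection in `baseMul` is
harmless, `ι` is multiplicative, and the monoid laws can be checked in `A • I`. -/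
theorem IsWeakBimonoid.baseMul_ι : baseMul L ≫ L.ι = (L.ι ⊚ₘ L.ι) ≫ lmul H (unitI C) := by
  have h1 : L.ι ⊚ₘ L.ι = (L.ι ▷⊚ _) ≫ (sqcapL H ▷⊚ _) ≫ (_ ⊚◁ L.ι) := by
    rw [c_hom_def, ← cR_comp_assoc, L.ι_idem]
  rw [baseMul_eq, Category.assoc, Category.assoc, L.π_ι, h1]
  simp only [Category.assoc, ← c_exch_assoc]
  rw [hH.sqcapL_lmul_sqcapL]
  simp only [c_exch_assoc, ← cL_comp_assoc, L.ι_idem]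

theorem IsWeakBimonoid.baseOne_ι : baseOne L ≫ L.ι = li H := by
  rw [baseOne_eq, Category.assoc, L.π_ι, hH.li_sqcapL]

theorem IsWeakBimonoid.colinear_ι : Colinear (baseCoact L) (leftCoact H δ) L.ι := by
  have h1 : sqcapL H ≫ leftCoact H δ = _ := colinear_sqcapL hH.right.wb
  rw [Colinear, baseCoact_eq, Category.assoc, Category.assoc, ← bR_comp, L.π_ι, ← h1,
    reassoc_of% L.ι_idem]

theorem IsWeakBimonoid.colinear_π : Colinear (leftCoact H δ) (baseCoact L) L.π := by
  have h1 : sqcapL H ≫ leftCoact H δ = _ := colinear_sqcapL hH.right.wb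
  rw [Colinear, baseCoact_eq, reassoc_of% L.π_ι, reassoc_of% h1, ← bR_comp, L.idem_π]

/-- The base object is a monoid in the category of right `I`-comodules. -/
theorem IsWeakBimonoid.isComoduleMonoid : IsComoduleMonoid L where
  one_mul := L.ι_cancel <| by
    rw [Category.assoc, hH.baseMul_ι, c_hom_def, Category.assoc, ← cR_comp_assoc, hH.baseOne_ι,
      ← c_exch_assoc, li_lmul, cLu_nat]
  mul_one := L.ι_cancel <| by
    rw [Category.assoc, hH.baseMul_ι, c_hom_def, Category.assoc, c_exch_assoc, ← cL_comp_assoc,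
      hH.baseOne_ι, lmul_li, cRu_nat]
  mul_assoc := L.ι_cancel <| by
    rw [Category.assoc, Category.assoc, Category.assoc, hH.baseMul_ι, c_hom_def, Category.assoc,
      c_exch_assoc, ← cL_comp_assoc, hH.baseMul_ι, ← cR_comp_assoc, hH.baseMul_ι, c_hom_def,
      cR_comp, cR_comp, cL_comp, cL_comp]
    simp only [Category.assoc]
    rw [← c_exch_assoc, hH.lmul_assoc, cAs_nat₃_assoc, cAs_nat₂_assoc, cAs_nat₁_assoc]
  coact_counit := by
    rw [baseCoact_eq, Category.assoc, Category.assoc, ← b_exch, reassoc_of% @leftCoact_counit,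
      ← bRu_inv_nat, reassoc_of% L.ι_π]
  coact_coact := by
    have h1 : L.π ≫ baseCoact L = _ := hH.colinear_π L
    nth_rw 1 [baseCoact_eq]
    rw [Category.assoc, Category.assoc, ← bR_comp_assoc, h1, bR_comp_assoc, bAs_nat₁,
      reassoc_of% @leftCoact_coassoc, b_exch, baseCoact_eq]
    simp only [Category.assoc]
  one_colinear := by
    rw [baseOne_eq]
    exact colinear_li.comp (hH.colinear_π L)
  mul_colinear := by
    have h1 := ((hH.colinear_ι L).whiskerRight (baseCoact L)).comp
      ((Colinear.whiskerLeft _ (hH.colinear_ι L)).comp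
        ((colinear_lmul δ).comp (hH.colinear_π L)))
    rw [Colinear, ← Category.assoc, ← c_hom_def, ← baseMul_eq, tensorCoact, Category.assoc,
      Category.assoc, b_exch, ← b_hom_def] at h1
    exact h1

/-- Colinearity of the unit of `L` replaces its coaction by `δ`, after which the unit law of `ζ`
applies. This is why `(-) • I` lifts without passing to a retract. -/
theorem IsWeakBimonoid.entw_baseOne {M : C} {a : M ⊚ L.obj ⟶ M}
    (ha : (M ⊚◁ baseOne L) ≫ a = (cRu M).hom) :
    (cRu (M ⊙ unitI C)).inv ≫ ((M ⊙ unitI C) ⊚◁ baseOne L) ≫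
      entw (baseCoact L) (cLu (unitI C)).hom M ≫ (a ▷⊙ unitI C) = 𝟙 _ := by
  have h3 : (cLu (unitI C)).hom = (cRu (unitI C)).hom :=
    @MonoidalCategory.unitors_equal _ _ TwoMonoidal.circ
  rw [entw, Category.assoc, ← cL_comp_assoc, (hH.isComoduleMonoid L).one_colinear, cL_comp_assoc,
    Category.assoc, b_exch, ζ_nat₃_assoc, ← bR_comp_assoc, ha, h3, ← b_hom_def, ζ_unit_right,
    Iso.inv_hom_id]

theorem baseData_idem (Q : RMod (baseData L)) : (baseData L).idem Q = 𝟙 _ :=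
  hH.entw_baseOne L Q.act_one

theorem baseData_law : (baseData L).Law where
  mul_one := (hH.isComoduleMonoid L).mul_one
  counit_left := δ_counit_left
  counit_right := δ_counit_right
  coassoc := δ_coassoc
  ψ_natural := entw_natural (baseCoact L) (cLu (unitI C)).hom
  ψ_mul := entw_mul (hH.isComoduleMonoid L).mul_colinear (cLu_unit_assoc (unitI C))
  ψ_comul := entw_comul (hH.isComoduleMonoid L).coact_coact cLu_δ
  weak_counit Q := by
    rw [baseData_idem L hH]
    have h2 : ∀ {X Y Z : C} (f : X ⊚ Y ⟶ Z), (𝟙 X ▷⊚ Y) ≫ f = f := by simp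
    exact (h2 _).trans
      (entw_act_counit (hH.isComoduleMonoid L).coact_counit cLu_τ (M := Q.carrier) Q.act).symm

end BaseMonoid

/-! ### The base acting on `A`, and a linear section of the action. -/

section BaseAction

variable {C : Type u} [Category.{v} C] [Duoidal C] {H : MonComon C}

variable (H) in
/-- The morphism `A • I ⟶ A` induced by `τ`. -/
def proj : H.A ⊙ unitI C ⟶ H.A := (H.A ⊙◁ τ) ≫ (bRu H.A).hom

/-- Through `A ≅ A • J`, the results on `A • Y` specialize to `A` itself; the action of `A • I`
becomes multiplication after `proj`, because `τ` is the unit of `ϖ`. -/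
theorem lmul_J : lmul H (unitJ C) ≫ (bRu H.A).hom =
    (_ ⊚◁ (bRu H.A).hom) ≫ (proj H ▷⊚ H.A) ≫ H.μ := by
  have h1 := ζ_ϖ_right H.A H.A
  have h2 : ζ H.A (unitJ C) H.A (unitJ C) ≫ ((H.A ⊚ H.A) ⊙◁ ϖ) ≫ (bRu (H.A ⊚ H.A)).hom =
      (_ ⊚◁ (bRu H.A).hom) ≫ ((bRu H.A).hom ▷⊚ _) := by
    rw [← cancel_epi ((bRu H.A).inv ⊚ₘ (bRu H.A).inv), h1, c_hom_def,
      Category.assoc]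
    simp
  rw [lmul, lm, Category.assoc, Category.assoc, ← b_exch_assoc, bRu_nat, ← ϖ_one_left, bL_comp,
    Category.assoc, ← ζ_nat₂_assoc, reassoc_of% h2, proj, cR_comp, ← c_exch_assoc]
  simp only [Category.assoc]

theorem lδ_J : lδ H (unitJ C) ≫ (H.A ⊙◁ (bRu H.A).hom) = (bRu H.A).hom ≫ H.Δ := by
  rw [lδ, ← bRu_nat]
  simp

theorem bRu_inv_lδ_J : (bRu H.A).inv ≫ lδ H (unitJ C) ≫ (H.A ⊙◁ (bRu H.A).hom) = H.Δ := by
  rw [lδ_J, Iso.inv_hom_id_assoc]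

variable (L : Splitting (sqcapL H))

theorem baseAct_eq : baseAct L = (L.ι ▷⊚ H.A) ≫ (proj H ▷⊚ H.A) ≫ H.μ := by
  rw [baseAct, baseω, ← proj, cR_comp_assoc]

/-- A section of the left action of the base object on `A`; in Sweedler notation,
`a ↦ ε(1₁ a₁) 1₂ ∘ a₂`. -/
def baseSec : H.A ⟶ L.obj ⊚ H.A := H.Δ ≫ lκ H H.A ≫ (L.π ▷⊚ H.A)

variable (hH : IsWeakBimonoid H)
include hH

theorem IsWeakBimonoid.baseSec_ι : baseSec L ≫ (L.ι ▷⊚ H.A) = H.Δ ≫ lκ H H.A := by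
  rw [baseSec, Category.assoc, Category.assoc, ← cR_comp, L.π_ι, hH.lκ_sqcapL]

/-- This is `ε(1₁ a₁) 1₂ a₂ = a`, the case `Y = J` of `lδ_lκ_lmul`. -/
theorem IsWeakBimonoid.baseSec_baseAct : baseSec L ≫ baseAct L = 𝟙 _ := by
  rw [baseAct_eq, reassoc_of% hH.baseSec_ι L, ← cancel_epi (bRu H.A).hom, ← reassoc_of% @lδ_J,
    reassoc_of% @lκ_nat, ← lmul_J, reassoc_of% hH.lδ_lκ_lmul, Category.comp_id]

/-- The case `Y = J` of `lmul_lδ`: for `l` in the base, `Δ(l a) = l a₁ • a₂`. -/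
theorem IsWeakBimonoid.baseAct_comul_lmul :
    baseAct L ≫ H.Δ = (L.ι ▷⊚ H.A) ≫ (_ ⊚◁ H.Δ) ≫ lmul H H.A := by
  have h1 := congrArg ((L.ι ▷⊚ (H.A ⊙ unitJ C)) ≫ ·) (hH.lmul_lδ (unitJ C))
  simp only [← cR_comp_assoc, L.ι_idem] at h1
  have h2 := congrArg (((L.obj ⊚◁ (bRu H.A).inv) ≫ ·) ∘ (· ≫ (H.A ⊙◁ (bRu H.A).hom))) h1
  simp only [Function.comp, Category.assoc, lδ_J, lmul_nat] at h2
  rw [reassoc_of% @lmul_J] at h2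
  simp only [c_exch_assoc, ← cL_comp_assoc, bRu_inv_lδ_J] at h2
  rw [← h2, baseAct_eq]
  simp

/-- The left action of the base object on `A` is compatible with the comultiplication. -/
theorem IsWeakBimonoid.baseAct_comul : baseAct L ≫ H.Δ =
    (baseCoact L ⊚ₘ H.Δ) ≫ ζ L.obj (unitI C) H.A H.A ≫ (baseAct L ⊙ₘ (cLu H.A).hom) := by
  have h1 : baseCoact L ≫ (L.ι ▷⊙ unitI C) = _ := (hH.colinear_ι L).symm
  -- The coaction on `A • I` duplicates `I` and `proj` deletes the first copy, so the action of `A •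
  -- I` can be written with the coaction of `L` and `ω`.
  have h2 : leftCoact H δ ≫ (proj H ▷⊙ unitI C) = 𝟙 _ := by
    have h3 : (bRu H.A).hom ▷⊙ unitI C = (bAs _ _ _).hom ≫ (H.A ⊙◁ (bLu _).hom) := by simp
    rw [leftCoact, proj, bR_comp, Category.assoc, h3, reassoc_of% @bAs_nat₂, Iso.inv_hom_id_assoc,
      ← bL_comp_assoc, δ_counit_left]
    simp
  rw [hH.baseAct_comul_lmul, baseAct_eq, c_hom_def, b_hom_def, bR_comp, bR_comp]
  simp only [Category.assoc]
  rw [← ζ_nat₁_assoc, ← ζ_nat₁_assoc, c_exch_assoc, c_exch_assoc, ← cR_comp_assoc, h1,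
    ← cR_comp_assoc, Category.assoc, h2, Category.comp_id, lmul, lm, Category.assoc]

/-- The section of the left action is left linear. -/
theorem IsWeakBimonoid.baseAct_baseSec :
    baseAct L ≫ baseSec L = (L.obj ⊚◁ baseSec L) ≫ (cAs _ _ _).inv ≫ (baseMul L ▷⊚ H.A) := by
  -- On the base, `κ(l b) = l κ(b)`; together with `Δ(l a) = l a₁ • a₂` this moves `l` out of the
  -- section.
  have h1 := congrArg ((L.ι ▷⊚ (H.A ⊙ H.A)) ≫ ·) (hH.lmul_lκ H.A)
  simp only [← cR_comp_assoc, L.ι_idem] at h1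
  rw [baseMul_eq, c_hom_def]
  simp only [cR_comp, Category.assoc]
  rw [← cAs_inv_nat₁_assoc, ← cAs_inv_nat₂_assoc, c_exch_assoc, ← cL_comp_assoc,
    hH.baseSec_ι, cL_comp_assoc, baseSec, reassoc_of% hH.baseAct_comul_lmul L,
    ← c_exch_assoc, reassoc_of% h1, c_exch_assoc]

end BaseAction

/-! ### The idempotent on `M ∘ A` defining the tensor product over `L`. -/

section TensorIdempotent

variable {C : Type u} [Category.{v} C] [Duoidal C] {H : MonComon C} {L : Splitting (sqcapL H)}

/-- The morphism `f` coequalizes the two morphisms `M ∘ L ∘ A ⇉ M ∘ A`. -/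
def Balanced {M : C} (a : M ⊚ L.obj ⟶ M) {T : C} (f : M ⊚ H.A ⟶ T) : Prop :=
  (a ▷⊚ H.A) ≫ f = ((cAs M L.obj H.A).hom ≫ (M ⊚◁ baseAct L)) ≫ f

/-- The idempotent on `M ∘ A` whose image is `M ∘_L A`. -/
def tensorIdem {M : C} (a : M ⊚ L.obj ⟶ M) : M ⊚ H.A ⟶ M ⊚ H.A :=
  (M ⊚◁ baseSec L) ≫ (cAs M L.obj H.A).inv ≫ (a ▷⊚ H.A)

variable {M : C} {a : M ⊚ L.obj ⟶ M} {T : C}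

/-- A balanced morphism lets the base component of the section act on `A` instead of on `M`, where
it recombines to the identity by `baseSec_baseAct`. -/
theorem Balanced.tensorIdem_comp (hH : IsWeakBimonoid H) {f : M ⊚ H.A ⟶ T} (hf : Balanced a f) :
    tensorIdem a ≫ f = f := by
  rw [Balanced] at hf
  rw [tensorIdem, Category.assoc, Category.assoc, hf, Category.assoc, Iso.inv_hom_id_assoc,
    ← cL_comp_assoc, hH.baseSec_baseAct]
  simp

/-- Left linearity of the section and associativity of `a`. With `Balanced.tensorIdem_comp` it
follows that `tensorIdem a` is idempotent and that its image is the coequalizer. -/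
theorem balanced_tensorIdem (hH : IsWeakBimonoid H)
    (ha : (a ▷⊚ L.obj) ≫ a = (cAs M L.obj L.obj).hom ≫ (M ⊚◁ baseMul L) ≫ a) :
    Balanced a (tensorIdem a) := by
  rw [Balanced, tensorIdem, Category.assoc, ← cL_comp_assoc, hH.baseAct_baseSec, ← c_exch_assoc,
    cAs_inv_nat₁_assoc, ← cR_comp, ha]
  simp only [cL_comp, cR_comp, Category.assoc]
  rw [cAs_inv_nat₂_assoc, ← cAs_nat₃_assoc]
  simp

theorem Balanced.comp {f : M ⊚ H.A ⟶ T} (hf : Balanced a f) {T' : C} (g : T ⟶ T') :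
    Balanced a (f ≫ g) := by
  rw [Balanced] at *
  rw [reassoc_of% hf, Category.assoc]

theorem baseAct_mul : (baseAct L ▷⊚ H.A) ≫ H.μ =
    (cAs _ _ _).hom ≫ (L.obj ⊚◁ H.μ) ≫ baseAct L := by
  rw [baseAct, cR_comp, Category.assoc, H.mul_assoc, cAs_nat₁_assoc, ← c_exch_assoc]

/-- Right multiplication on `A` commutes with the left base action, so the free action followed by a
balanced morphism is again balanced in the first two factors. This is what makes the action descend
to the quotient. -/
theorem tensorIdem_freeAct (hH : IsWeakBimonoid H) {f : M ⊚ H.A ⟶ T} (hf : Balanced a f) :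
    (tensorIdem a ▷⊚ H.A) ≫ (freeMod H M).act ≫ f = (freeMod H M).act ≫ f := by
  rw [Balanced] at hf
  change _ ≫ ((cAs M H.A H.A).hom ≫ (M ⊚◁ H.μ)) ≫ f = ((cAs M H.A H.A).hom ≫ (M ⊚◁ H.μ)) ≫ f
  have h1 : ((a ▷⊚ H.A) ▷⊚ H.A) ≫ (cAs M H.A H.A).hom ≫ (M ⊚◁ H.μ) ≫ f =
      (((cAs M L.obj H.A).hom ≫ (M ⊚◁ baseAct L)) ▷⊚ H.A) ≫
        (cAs M H.A H.A).hom ≫ (M ⊚◁ H.μ) ≫ f := by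
    rw [cAs_nat₁_assoc, ← c_exch_assoc, hf, cR_comp_assoc, cAs_nat₂_assoc, ← cL_comp_assoc,
      baseAct_mul]
    simp only [cL_comp, Category.assoc, cAs_nat₃_assoc]
    simp
  rw [tensorIdem]
  simp only [cR_comp, Category.assoc] at h1 ⊢
  rw [h1]
  simp only [← cR_comp_assoc, Iso.inv_hom_id_assoc, ← cL_comp,
    hH.baseSec_baseAct]
  simp

end TensorIdempotent

/-! ### The functor `(-) ∘_L A`. -/

section TensorOver

variable {C : Type u} [Category.{v} C] [Duoidal C] {H : MonComon C} {L : Splitting (sqcapL H)}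

/-- A split epimorphism stays epi after `(-) ∘ Z`; thus no preservation of coequalizers by `∘` has
to be assumed. -/
theorem Splitting.cR_π_cancel {X : C} {e : X ⟶ X} (S : Splitting e) {Z T : C}
    {f g : S.obj ⊚ Z ⟶ T} (w : (S.π ▷⊚ Z) ≫ f = (S.π ▷⊚ Z) ≫ g) : f = g := by
  have := congrArg ((S.ι ▷⊚ Z) ≫ ·) w
  simpa [← cR_comp_assoc, S.ι_π] using this

theorem Splitting.cRR_π_cancel {X : C} {e : X ⟶ X} (S : Splitting e) {Z Z' T : C}
    {f g : (S.obj ⊚ Z) ⊚ Z' ⟶ T} (w : ((S.π ▷⊚ Z) ▷⊚ Z') ≫ f = ((S.π ▷⊚ Z) ▷⊚ Z') ≫ g) :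
    f = g := by
  have := congrArg (((S.ι ▷⊚ Z) ▷⊚ Z') ≫ ·) w
  simpa [← cR_comp_assoc, ← cR_comp, S.ι_π] using this

section Quotient

variable {D : MixedData C} (X : RMod D) {e : X.carrier ⟶ X.carrier} (S : Splitting e)
  (h : (e ▷⊚ D.X) ≫ X.act ≫ S.π = X.act ≫ S.π)
include h

theorem RMod.quotient_aux :
    X.act ≫ S.π = (S.π ▷⊚ D.X) ≫ (S.ι ▷⊚ D.X) ≫ X.act ≫ S.π := by
  rw [← cR_comp_assoc, S.π_ι, h]

/-- The module structure on a split quotient of a module. -/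
def RMod.quotient : RMod D where
  carrier := S.obj
  act := (S.ι ▷⊚ D.X) ≫ X.act ≫ S.π
  act_one := S.cR_π_cancel <| by
    rw [← c_exch_assoc, ← RMod.quotient_aux X S h, reassoc_of% X.act_one, cRu_nat]
  act_act := S.cRR_π_cancel <| by
    rw [← cR_comp_assoc, ← RMod.quotient_aux X S h, cR_comp_assoc, ← RMod.quotient_aux X S h,
      cAs_nat₁_assoc, ← c_exch_assoc, ← RMod.quotient_aux X S h, reassoc_of% X.act_act]

omit h in
/-- The morphism induced between quotients. -/
def RMod.quotientMap {X Y : RMod D} {e : X.carrier ⟶ X.carrier} (S : Splitting e)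
    (h : (e ▷⊚ D.X) ≫ X.act ≫ S.π = X.act ≫ S.π) {e' : Y.carrier ⟶ Y.carrier} (S' : Splitting e')
    (h' : (e' ▷⊚ D.X) ≫ Y.act ≫ S'.π = Y.act ≫ S'.π) (f : X ⟶ Y)
    (w : S.π ≫ S.ι ≫ f.hom ≫ S'.π = f.hom ≫ S'.π) : X.quotient S h ⟶ Y.quotient S' h' where
  hom := S.ι ≫ f.hom ≫ S'.π
  linear := S.cR_π_cancel <| by
    change (S.π ▷⊚ D.X) ≫ ((S.ι ▷⊚ D.X) ≫ X.act ≫ S.π) ≫ S.ι ≫ f.hom ≫ S'.π =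
      (S.π ▷⊚ D.X) ≫ ((S.ι ≫ f.hom ≫ S'.π) ▷⊚ D.X) ≫ (S'.ι ▷⊚ D.X) ≫ Y.act ≫ S'.π
    have h1 := RMod.quotient_aux X S h
    rw [← cR_comp_assoc, w, cR_comp_assoc, ← RMod.quotient_aux Y S' h', ← reassoc_of% f.linear]
    simp only [Category.assoc]
    rw [← reassoc_of% h1, w]

theorem RMod.act_quotient : X.act ≫ S.π = (S.π ▷⊚ D.X) ≫ (X.quotient S h).act :=
  RMod.quotient_aux X S h

end Quotient

variable (H) in
/-- The free module functor on morphisms. -/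
def freeMap {M N : C} (f : M ⟶ N) : freeMod H M ⟶ freeMod H N where
  hom := f ▷⊚ H.A
  linear := by
    have h1 : ((cAs M H.A H.A).hom ≫ (M ⊚◁ H.μ)) ≫ (f ▷⊚ H.A) =
        ((f ▷⊚ H.A) ▷⊚ H.A) ≫ (cAs N H.A H.A).hom ≫ (N ⊚◁ H.μ) := by
      rw [cAs_nat₁_assoc, ← c_exch, Category.assoc]
    exact h1

theorem Balanced.map {M N T : C} {a : M ⊚ L.obj ⟶ M} {b : N ⊚ L.obj ⟶ N} {g : N ⊚ H.A ⟶ T}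
    (hg : Balanced b g) {f : M ⟶ N} (hf : a ≫ f = (f ▷⊚ L.obj) ≫ b) :
    Balanced a ((f ▷⊚ H.A) ≫ g) := by
  rw [Balanced] at *
  rw [← cR_comp_assoc, hf, cR_comp_assoc, hg, Category.assoc, cAs_nat₁_assoc, Category.assoc,
    ← c_exch_assoc]

variable {P Q : RMod (baseData L)}

/-- The idempotent on `P ∘ A` whose image is `P ∘_L A`, for a right `L`-module `P`. -/
def RMod.tensorIdem (P : RMod (baseData L)) : P.carrier ⊚ H.A ⟶ P.carrier ⊚ H.A :=
  Duo.tensorIdem (L := L) P.act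

variable (hH : IsWeakBimonoid H) (S : ∀ P : RMod (baseData L), Splitting P.tensorIdem)

include hH in
theorem RMod.balanced_tensorIdem (P : RMod (baseData L)) :
    Balanced (L := L) P.act P.tensorIdem := Duo.balanced_tensorIdem hH P.act_act

include hH in
theorem balanced_π (P : RMod (baseData L)) : Balanced (L := L) P.act (S P).π := by
  rw [← (S P).idem_π]
  exact (P.balanced_tensorIdem hH).comp _

include hH in
/-- Balanced morphisms factorize through the image of the idempotent. -/
theorem tensor_fac {T : C} {f : P.carrier ⊚ H.A ⟶ T} (hf : Balanced (L := L) P.act f) :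
    (S P).π ≫ (S P).ι ≫ f = f := by
  rw [reassoc_of% (S P).π_ι]
  exact hf.tensorIdem_comp hH

/-- The right `A`-module `P ∘_L A`. -/
def tensorObj (P : RMod (baseData L)) : RMod (hopfData H) :=
  RMod.quotient (freeMod H P.carrier) (S P) (tensorIdem_freeAct hH (balanced_π hH S P))

theorem tensor_linear (P : RMod (baseData L)) : (freeMod H P.carrier).act ≫ (S P).π =
    ((S P).π ▷⊚ H.A) ≫ (tensorObj hH S P).act :=
  RMod.act_quotient (freeMod H P.carrier) (S P) (tensorIdem_freeAct hH (balanced_π hH S P))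

include hH in
theorem balanced_map_π (f : P ⟶ Q) :
    Balanced (L := L) P.act ((f.hom ▷⊚ H.A) ≫ (S Q).π) :=
  (balanced_π hH S Q).map f.linear

/-- The `L`-module tensor product on morphisms. -/
def tensorMap (f : P ⟶ Q) : tensorObj hH S P ⟶ tensorObj hH S Q :=
  RMod.quotientMap (X := freeMod H P.carrier) (Y := freeMod H Q.carrier) (S P)
    (tensorIdem_freeAct hH (balanced_π hH S P)) (S Q) (tensorIdem_freeAct hH (balanced_π hH S Q))
    (freeMap H f.hom)
    (tensor_fac hH S (balanced_map_π hH S f))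

theorem π_tensorMap (f : P ⟶ Q) :
    (S P).π ≫ (tensorMap hH S f).hom = (f.hom ▷⊚ H.A) ≫ (S Q).π :=
  tensor_fac hH S (balanced_map_π hH S f)

/-- The functor `(-) ∘_L A`. -/
def tensorFunctor : RMod (baseData L) ⥤ RMod (hopfData H) where
  obj := tensorObj hH S
  map := tensorMap hH S
  map_id P := RMod.hom_ext <| (S P).π_cancel <| by
    refine (π_tensorMap hH S (𝟙 P)).trans ?_
    change (𝟙 P.carrier ▷⊚ H.A) ≫ (S P).π = (S P).π ≫ 𝟙 _
    simp
  map_comp {P Q R} f g := RMod.hom_ext <| (S P).π_cancel <| by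
    have h1 := π_tensorMap hH S f
    have h2 := π_tensorMap hH S g
    refine (π_tensorMap hH S (f ≫ g)).trans ?_
    have h3 : ∀ {X Y Z X' Y' Z' : C} {p : X ⟶ X'} {q : Y ⟶ Y'} {r : Z ⟶ Z'} {m : X ⟶ Y}
        {n : Y ⟶ Z} {m' : X' ⟶ Y'} {n' : Y' ⟶ Z'}, p ≫ m' = m ≫ q → q ≫ n' = n ≫ r →
        (m ≫ n) ≫ r = p ≫ m' ≫ n' := fun w w' => by
      rw [reassoc_of% w, w', Category.assoc]
    exact (congrArg (· ≫ (S R).π) (cR_comp f.hom g.hom H.A)).trans (h3 h1 h2)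

include hH in
theorem nonempty_tensorOver [IsIdempotentComplete C] : Nonempty (TensorOver L) := by
  have h1 : ∀ P : RMod (baseData L), Nonempty (Splitting P.tensorIdem) := fun P =>
    exists_splitting ((P.balanced_tensorIdem hH).tensorIdem_comp hH)
  let S := fun P => (h1 P).some
  exact ⟨{
    W := tensorFunctor hH S
    π := fun P => (S P).π
    balanced := balanced_π hH S
    isCoeq := fun P => ⟨Limits.Cofork.IsColimit.mk _
      (fun s => (S P).ι ≫ s.π) (fun s => tensor_fac hH S s.condition)
      (fun s m hm => (S P).π_cancel (hm.trans (tensor_fac hH S s.condition).symm))⟩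
    natural := fun f => (π_tensorMap hH S f).symm
    linear := tensor_linear hH S }⟩

namespace TensorOver

variable (T : TensorOver L)

theorem balanced' (P : RMod (baseData L)) : Balanced (L := L) P.act (T.π P) := T.balanced P

theorem epi_π (P : RMod (baseData L)) : Epi (T.π P) := by
  obtain ⟨h⟩ := T.isCoeq P
  exact ⟨fun f g w => Limits.Cofork.IsColimit.hom_ext h w⟩

-- The idempotent is balanced, so it descends along any coequalizer `T.π P`, and the descended map
-- is a section because `T.π P` is epi. Every choice of `T` therefore splits the same idempotent.
include hH in
theorem exists_section (P : RMod (baseData L)) :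
    ∃ i : (T.W.obj P).carrier ⟶ P.carrier ⊚ H.A,
      T.π P ≫ i = P.tensorIdem ∧ i ≫ T.π P = 𝟙 _ := by
  obtain ⟨h⟩ := T.isCoeq P
  have hE : Balanced (L := L) P.act P.tensorIdem := P.balanced_tensorIdem hH
  have h1 : T.π P ≫ Limits.Cofork.IsColimit.desc h P.tensorIdem hE = P.tensorIdem :=
    Limits.Cofork.IsColimit.π_desc' h _ hE
  refine ⟨Limits.Cofork.IsColimit.desc h P.tensorIdem hE, h1, ?_⟩
  have := T.epi_π P
  rw [← cancel_epi (T.π P), reassoc_of% h1, Category.comp_id]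
  exact (T.balanced' P).tensorIdem_comp hH

/-- The splitting of the idempotent on `P ∘ A` through the coequalizer `P ∘_L A`. -/
noncomputable def splitting (P : RMod (baseData L)) : Splitting P.tensorIdem where
  obj := (T.W.obj P).carrier
  ι := (T.exists_section hH P).choose
  π := T.π P
  ι_π := (T.exists_section hH P).choose_spec.2
  π_ι := (T.exists_section hH P).choose_spec.1

end TensorOver

end TensorOver

/-! ### Reversing both products, and the counit law for `(-) •_R A`. -/

section Reversal

variable {C : Type u} [Category.{v} C]

/-- The monoidal category with the reversed product. -/
@[reducible]
def revMonoidal (M : MonoidalCategory C) : MonoidalCategory C where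
  tensorObj X Y := M.tensorObj Y X
  whiskerLeft X _ _ f := M.whiskerRight f X
  whiskerRight f X := M.whiskerLeft X f
  tensorHom f g := M.tensorHom g f
  tensorUnit := M.tensorUnit
  associator X Y Z := (M.associator Z Y X).symm
  leftUnitor := M.rightUnitor
  rightUnitor := M.leftUnitor
  tensorHom_def f g := @MonoidalCategory.tensorHom_def' _ _ M _ _ _ _ g f
  id_tensorHom_id X Y := @MonoidalCategory.id_tensorHom_id _ _ M Y X
  tensorHom_comp_tensorHom f g h k :=
    @MonoidalCategory.tensorHom_comp_tensorHom _ _ M _ _ _ _ _ _ g f k h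
  whiskerLeft_id X Y := @MonoidalCategory.id_whiskerRight _ _ M Y X
  id_whiskerRight X Y := @MonoidalCategory.whiskerLeft_id _ _ M Y X
  associator_naturality f g h :=
    @MonoidalCategory.associator_inv_naturality _ _ M _ _ _ _ _ _ h g f
  leftUnitor_naturality f := @MonoidalCategory.rightUnitor_naturality _ _ M _ _ f
  rightUnitor_naturality f := @MonoidalCategory.leftUnitor_naturality _ _ M _ _ f
  pentagon W X Y Z := @MonoidalCategory.pentagon_inv _ _ M Z Y X W
  triangle X Y := @MonoidalCategory.triangle_assoc_comp_right _ _ M Y X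

variable [Duoidal C]

theorem ζ_circ_assoc_inv (X Y Z W U V : C) :
    ((X ⊙ Y) ⊚◁ ζ Z W U V) ≫ ζ X Y (Z ⊚ U) (W ⊚ V) ≫ ((cAs X Z U).inv ⊙ₘ (cAs Y W V).inv) =
      (cAs (X ⊙ Y) (Z ⊙ W) (U ⊙ V)).inv ≫ (ζ X Y Z W ▷⊚ (U ⊙ V)) ≫ ζ (X ⊚ Z) (Y ⊚ W) U V := by
  have h1 := ζ_circ_assoc X Y Z W U V
  rw [← cancel_mono ((cAs X Z U).hom ⊙ₘ (cAs Y W V).hom), ← cancel_epi (cAs _ _ _).hom]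
  simp [h1]

theorem ζ_bull_assoc_inv (X Y Z W U V : C) :
    ζ X (Y ⊙ Z) W (U ⊙ V) ≫ ((X ⊚ W) ⊙◁ ζ Y Z U V) ≫ (bAs (X ⊚ W) (Y ⊚ U) (Z ⊚ V)).inv =
      ((bAs X Y Z).inv ⊚ₘ (bAs W U V).inv) ≫ ζ (X ⊙ Y) Z (W ⊙ U) V ≫
        (ζ X Y W U ▷⊙ (Z ⊚ V)) := by
  have h1 := ζ_bull_assoc X Y Z W U V
  rw [← cancel_mono (bAs _ _ _).hom, ← cancel_epi ((bAs X Y Z).hom ⊚ₘ (bAs W U V).hom)]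
  simp [h1]

theorem δ_coassoc_inv : δ ≫ (unitI C ⊙◁ δ) ≫ (bAs (unitI C) (unitI C) (unitI C)).inv =
    δ ≫ (δ ▷⊙ unitI C) := by
  rw [← reassoc_of% δ_coassoc, Iso.hom_inv_id, Category.comp_id]

/-- The duoidal category with both products reversed. -/
@[reducible]
def revDuoidal (C : Type u) [Category.{v} C] [Duoidal C] : Duoidal C where
  circ := revMonoidal TwoMonoidal.circ
  bull := revMonoidal TwoMonoidal.bull
  δ := Duoidal.δ (C := C)
  ϖ := Duoidal.ϖ (C := C)
  τ := Duoidal.τ (C := C)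
  ζ X Y Z W := Duoidal.ζ W Z Y X
  ζ_natural f g h k := ζ_natural k h g f
  ϖ_one_left := ϖ_one_right (C := C)
  ϖ_one_right := ϖ_one_left (C := C)
  ϖ_assoc := (Iso.inv_comp_eq _).mpr (ϖ_assoc (C := C)) |>.symm
  δ_counit_left := δ_counit_right (C := C)
  δ_counit_right := δ_counit_left (C := C)
  δ_coassoc := δ_coassoc_inv (C := C)
  ζ_circ_assoc X Y Z W U V := ζ_circ_assoc_inv V U W Z Y X
  ζ_bull_assoc X Y Z W U V := ζ_bull_assoc_inv V U W Z Y X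
  ζ_δ_left X Y := ζ_δ_right Y X
  ζ_δ_right X Y := ζ_δ_left Y X
  ζ_ϖ_left X Y := ζ_ϖ_right Y X
  ζ_ϖ_right X Y := ζ_ϖ_left Y X

/-- The weak bimonoid `H`, in the reversed duoidal category. -/
@[reducible]
def MonComon.rev (H : MonComon C) : @MonComon C _ (revDuoidal C).toTwoMonoidal :=
  @MonComon.mk C _ (revDuoidal C).toTwoMonoidal H.A
    (@MonObj.mk C _ (revMonoidal TwoMonoidal.circ) H.A H.η H.μ H.mul_one H.one_mul
      ((Iso.eq_inv_comp _).mpr H.mul_assoc.symm))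
    (@ComonObj.mk C _ (revMonoidal TwoMonoidal.bull) H.A H.ε H.Δ H.comul_counit H.counit_comul
      (by
        have h1 : H.Δ ≫ (H.Δ ▷⊙ H.A) = H.Δ ≫ (H.A ⊙◁ H.Δ) ≫ (bAs H.A H.A H.A).inv := by
          rw [← reassoc_of% H.comul_assoc, Iso.hom_inv_id, Category.comp_id]
        exact h1))

variable {H : MonComon C}

theorem AxWB.rev (hH : AxWB H) : @AxWB C _ (revDuoidal C) H.rev := hH

/-- Under the reversal this axiom unfolds to the mirror image already exploited for `A • (-)`, so
the results on that comonad apply to `(-) • A`. -/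
theorem AxLLC.rev (hC : AxLLC H) : @AxRRC C _ (revDuoidal C) H.rev := hC

variable (H) in
/-- The mirror image of `ls`. -/
def rs (X Y : C) : (Y ⊙ H.A) ⊚ (X ⊙ H.A) ⟶ Y ⊚ (X ⊙ H.A) :=
  (_ ⊚◁ ((X ⊙◁ H.Δ) ≫ (bAs X H.A H.A).inv)) ≫ (ζ Y H.A (X ⊙ H.A) H.A ≫ (_ ⊙◁ H.μ)) ≫
    (_ ⊙◁ H.ε) ≫ (bRu _).hom

variable (H) in
/-- The mirror image of `lκ`. -/
def rκ (Y : C) : Y ⊙ H.A ⟶ Y ⊚ (unitI C ⊙ H.A) :=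
  (cRu _).inv ≫ (_ ⊚◁ (δ ≫ (unitI C ⊙◁ H.η))) ≫ rs H (unitI C) Y

theorem rs_eq (hH : AxWB H) (hC : AxLLC H) (X Y : C) :
    rs H X Y = (rκ H Y ▷⊚ (X ⊙ H.A)) ≫ (cAs _ _ _).hom ≫
      (Y ⊚◁ ((ζ (unitI C) H.A X H.A ≫ (_ ⊙◁ H.μ)) ≫ ((cLu X).hom ▷⊙ H.A))) :=
  @ls_eq C _ (revDuoidal C) H.rev hH.rev (@leftCounit_of_axRRC C _ (revDuoidal C) H.rev hC.rev) X Y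

variable (H) in
/-- In Sweedler notation, `q • b ∘ a ↦ q ∘ a₁ ε(b a₂)`. -/
def rstep (Q : C) : (Q ⊙ H.A) ⊚ H.A ⟶ Q ⊚ H.A :=
  (_ ⊚◁ H.Δ) ≫ ζ Q H.A H.A H.A ≫ (_ ⊙◁ (H.μ ≫ H.ε)) ≫ (bRu _).hom

variable (H) in
/-- The morphism `I • A ⟶ A` induced by `τ`. -/
def rproj : unitI C ⊙ H.A ⟶ H.A := (τ ▷⊙ H.A) ≫ (bLu H.A).hom

/-- Naturality along maps compatible with `Δ`. It is used for `J • A ≅ A` and for `I • A ⟶ A`, to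
eliminate the auxiliary object `X`. -/
theorem rs_map {X Q : C} {f : X ⊙ H.A ⟶ H.A} (hf : (X ⊙◁ H.Δ) ≫ (bAs X H.A H.A).inv ≫
    (f ▷⊙ H.A) = f ≫ H.Δ) : rs H X Q ≫ (Q ⊚◁ f) = (_ ⊚◁ f) ≫ rstep H Q := by
  rw [rs, rstep, ← cL_comp_assoc, ← hf]
  simp only [cL_comp, bL_comp, Category.assoc]
  rw [ζ_nat₃_assoc, ← bRu_nat, b_exch_assoc, b_exch_assoc]

theorem comul_bLu : (unitJ C ⊙◁ H.Δ) ≫ (bAs (unitJ C) H.A H.A).inv ≫ ((bLu H.A).hom ▷⊙ H.A) =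
    (bLu H.A).hom ≫ H.Δ := by
  rw [← bLu_nat]
  simp

theorem comul_rproj : (unitI C ⊙◁ H.Δ) ≫ (bAs (unitI C) H.A H.A).inv ≫ (rproj H ▷⊙ H.A) =
    rproj H ≫ H.Δ := by
  rw [rproj, bR_comp, ← bAs_inv_nat₁_assoc, b_exch_assoc, comul_bLu, Category.assoc]

theorem rmul_J : (ζ (unitI C) H.A (unitJ C) H.A ≫ (_ ⊙◁ H.μ)) ≫ ((cLu (unitJ C)).hom ▷⊙ H.A) ≫
    (bLu H.A).hom = (_ ⊚◁ (bLu H.A).hom) ≫ (rproj H ▷⊚ H.A) ≫ H.μ := by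
  have h1 := ζ_ϖ_left H.A H.A
  have h2 : ζ (unitJ C) H.A (unitJ C) H.A ≫ (ϖ ▷⊙ (H.A ⊚ H.A)) ≫ (bLu (H.A ⊚ H.A)).hom =
      (_ ⊚◁ (bLu H.A).hom) ≫ ((bLu H.A).hom ▷⊚ _) := by
    rw [← cancel_epi ((bLu H.A).inv ⊚ₘ (bLu H.A).inv), h1, c_hom_def, Category.assoc]
    simp
  rw [Category.assoc, b_exch_assoc, bLu_nat, ← ϖ_one_left, bR_comp, Category.assoc, ← ζ_nat₁_assoc,
    reassoc_of% h2, rproj, cR_comp, ← c_exch_assoc]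
  simp only [Category.assoc]

theorem rκ_rproj (Q : C) : rκ H Q ≫ (Q ⊚◁ rproj H) = (cRu _).inv ≫ (_ ⊚◁ H.η) ≫ rstep H Q := by
  have h1 : (δ ≫ (unitI C ⊙◁ H.η)) ≫ rproj H = H.η := by
    rw [rproj, Category.assoc, b_exch_assoc, bLu_nat, reassoc_of% δ_counit_left,
      Iso.inv_hom_id_assoc]
  rw [rκ, Category.assoc, Category.assoc, rs_map comul_rproj, ← cL_comp_assoc, h1]

/-- The mirror image of `star` at `X = J`: `q ∘ a₁ ε(b a₂) = q ∘ 1₁ a ε(b 1₂)`. -/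
theorem rstep_eq (hH : AxWB H) (hC : AxLLC H) (Q : C) : rstep H Q =
    (((cRu _).inv ≫ (_ ⊚◁ H.η) ≫ rstep H Q) ▷⊚ H.A) ≫ (cAs Q H.A H.A).hom ≫ (Q ⊚◁ H.μ) := by
  have h1 := congrArg (· ≫ (Q ⊚◁ (bLu H.A).hom)) (rs_eq hH hC (unitJ C) Q)
  simp only [Category.assoc, ← cL_comp] at h1
  have h2 := rmul_J (H := H)
  simp only [Category.assoc] at h2
  rw [rs_map comul_bLu, h2, cL_comp, ← cAs_nat₃_assoc, ← c_exch_assoc] at h1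
  rw [← cancel_epi (_ ⊚◁ (bLu H.A).hom), h1, ← rκ_rproj, cR_comp_assoc, cL_comp, cAs_nat₂_assoc]

/-- Applying the action of `A` on `Q` to `rstep_eq` gives `q a₁ ε(b a₂) = (q 1₁ ε(b 1₂)) a`, and the
bracket is the counit evaluated after the idempotent. -/
theorem weak_counit_aux (hH : AxWB H) (hC : AxLLC H) {Q : C} {a : Q ⊚ H.A ⟶ Q}
    (ha : (a ▷⊚ H.A) ≫ a = (cAs Q H.A H.A).hom ≫ (Q ⊚◁ H.μ) ≫ a) :
    (((cRu (Q ⊙ H.A)).inv ≫ (_ ⊚◁ H.η) ≫ entw H.Δ H.μ Q ≫ (a ▷⊙ H.A)) ▷⊚ H.A) ≫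
      (((Q ⊙◁ H.ε) ≫ (bRu Q).hom) ▷⊚ H.A) ≫ a =
    (entw H.Δ H.μ Q ≫ (a ▷⊙ H.A)) ≫ (Q ⊙◁ H.ε) ≫ (bRu Q).hom := by
  have h1 : (entw H.Δ H.μ Q ≫ (a ▷⊙ H.A)) ≫ (Q ⊙◁ H.ε) ≫ (bRu Q).hom = rstep H Q ≫ a := by
    rw [entw, rstep, bL_comp]
    simp only [Category.assoc]
    rw [← b_exch_assoc, bRu_nat]
  have h2 := congrArg (· ≫ a) (rstep_eq hH hC Q)
  simp only [Category.assoc] at h2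
  conv_rhs => rw [h1, h2, ← ha, ← cR_comp_assoc]
  rw [← cR_comp_assoc, Category.assoc, Category.assoc, h1]
  simp only [Category.assoc]

theorem hopfData_law (hH : IsWeakBimonoid H) : (hopfData H).Law where
  mul_one := H.mul_one
  counit_left := H.counit_comul
  counit_right := H.comul_counit
  coassoc := H.comul_assoc
  ψ_natural := entw_natural H.Δ H.μ
  ψ_mul := entw_mul hH.right.wb H.mul_assoc
  ψ_comul := entw_comul H.comul_assoc hH.right.wb
  weak_counit Q := weak_counit_aux hH.right.wb hH.right.llc Q.act_act

end Reversal

/-! ### The morphism underlying `λ`, and its compatibilities. -/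

section LiftedTensor

variable {C : Type u} [Category.{v} C] [Duoidal C] {H : MonComon C}

theorem cLu_comul : (cLu H.A).hom ≫ H.Δ = (δ ⊚ₘ H.Δ) ≫ ζ (unitI C) (unitI C) H.A H.A ≫
    ((cLu H.A).hom ⊙ₘ (cLu H.A).hom) := by
  rw [c_hom_def, Category.assoc, ← c_exch_assoc, ζ_unit_left, cLu_nat]

theorem cLu_counit : (cLu H.A).hom ≫ H.ε = (τ ⊚ₘ H.ε) ≫ ϖ := by
  rw [c_hom_def, Category.assoc, ← c_exch_assoc, ϖ_one_left, cLu_nat]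

theorem cLu_mul : ((cLu H.A).hom ▷⊚ H.A) ≫ H.μ =
    (cAs (unitI C) H.A H.A).hom ≫ (unitI C ⊚◁ H.μ) ≫ (cLu H.A).hom := by
  rw [cLu_nat]
  simp

/-- The morphism `M' ∘ A ⟶ (M • I) ∘ A ⟶ (M ∘ A) • A ⟶ N • A` induced by `k : M' ⟶ M • I` and
`p : M ∘ A ⟶ N`. -/
def preLam {M' M N : C} (k : M' ⟶ M ⊙ unitI C) (p : M ⊚ H.A ⟶ N) : M' ⊚ H.A ⟶ N ⊙ H.A :=
  (k ▷⊚ H.A) ≫ entw H.Δ (cLu H.A).hom M ≫ (p ▷⊙ H.A)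

variable {M' M N : C} {k : M' ⟶ M ⊙ unitI C} {p : M ⊚ H.A ⟶ N}

/-- `entw_mul` for the multiplication of `A`: the second tensor factor is multiplied first through
`I ∘ A ≅ A` and then by `μ`. -/
theorem preLam_linear (hH : AxWB H) {n : N ⊚ H.A ⟶ N}
    (hp : ((cAs M H.A H.A).hom ≫ (M ⊚◁ H.μ)) ≫ p = (p ▷⊚ H.A) ≫ n) :
    ((cAs M' H.A H.A).hom ≫ (M' ⊚◁ H.μ)) ≫ preLam k p =
      (preLam k p ▷⊚ H.A) ≫ entw H.Δ H.μ N ≫ (n ▷⊙ H.A) := by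
  have h1 := entw_mul hH (cLu_mul (H := H)) M
  simp only [preLam, cR_comp, Category.assoc]
  rw [reassoc_of% @entw_natural, ← bR_comp, ← hp, bR_comp, ← reassoc_of% h1, c_exch_assoc,
    cAs_nat₁_assoc]

/-- `entw_mul` for the base action `L ∘ A ⟶ A`, whose compatibility with the coactions is
`baseAct_comul`. -/
theorem preLam_balanced (hH : IsWeakBimonoid H) {L : Splitting (sqcapL H)} {a : M ⊚ L.obj ⟶ M}
    {a' : M' ⊚ L.obj ⟶ M'}
    (hk : a' ≫ k = (k ▷⊚ L.obj) ≫ entw (baseCoact L) (cLu (unitI C)).hom M ≫ (a ▷⊙ unitI C))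
    (hp : Balanced a p) : Balanced a' (preLam k p) := by
  have h1 := entw_mul (hH.baseAct_comul L) (cLu_unit_assoc H.A) M
  rw [Balanced] at *
  rw [preLam, ← cR_comp_assoc, hk, cR_comp, cR_comp, Category.assoc, Category.assoc,
    reassoc_of% @entw_natural, ← bR_comp, hp, bR_comp, ← reassoc_of% h1, cAs_nat₁_assoc,
    ← c_exch_assoc, Category.assoc]

theorem preLam_counit : preLam k p ≫ (N ⊙◁ H.ε) ≫ (bRu N).hom =
    ((k ≫ (M ⊙◁ τ) ≫ (bRu M).hom) ▷⊚ H.A) ≫ p := by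
  have h1 := entw_counit H.comul_counit (cLu_counit (H := H)) M
  rw [preLam, Category.assoc, Category.assoc, ← b_exch_assoc, bRu_nat, reassoc_of% h1,
    ← cR_comp_assoc]

/-- `entw_comul`, where `k₂` plays the role of an `I`-coaction on `M'` for which `k` is
coassociative; in the application `M'` is the lifted `M • I`. -/
theorem preLam_comul {k₂ : M' ⟶ M' ⊙ unitI C}
    (hk : k₂ ≫ (k ▷⊙ unitI C) ≫ (bAs M (unitI C) (unitI C)).hom = k ≫ (M ⊙◁ δ)) :
    preLam k₂ (preLam k p) ≫ (bAs N H.A H.A).hom = preLam k p ≫ (N ⊙◁ H.Δ) := by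
  have h1 := entw_comul H.comul_assoc (cLu_comul (H := H)) M
  have h2 : k₂ ≫ (k ▷⊙ unitI C) = k ≫ (M ⊙◁ δ) ≫ (bAs M (unitI C) (unitI C)).inv := by
    rw [← reassoc_of% hk, Iso.hom_inv_id, Category.comp_id]
  rw [preLam, preLam.eq_1 k p, bR_comp, Category.assoc, Category.assoc, Category.assoc,
    ← reassoc_of% @entw_natural, ← cR_comp_assoc, h2, cR_comp_assoc, bR_comp,
    Category.assoc, bAs_nat₁,
    reassoc_of% h1, Category.assoc, Category.assoc, b_exch]

theorem preLam_natural {M₂' M₂ N₂ : C} {k₂ : M₂' ⟶ M₂ ⊙ unitI C} {p₂ : M₂ ⊚ H.A ⟶ N₂}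
    {f' : M' ⟶ M₂'} {f : M ⟶ M₂} {g : N ⟶ N₂} (hk : f' ≫ k₂ = k ≫ (f ▷⊙ unitI C))
    (hp : (f ▷⊚ H.A) ≫ p₂ = p ≫ g) :
    (f' ▷⊚ H.A) ≫ preLam k₂ p₂ = preLam k p ≫ (g ▷⊙ H.A) := by
  rw [preLam, preLam, ← cR_comp_assoc, hk, cR_comp_assoc, reassoc_of% @entw_natural, ← bR_comp, hp,
    bR_comp, Category.assoc, Category.assoc]

theorem preLam_comp₂ {M₂ N₂ : C} {f : M₂ ⟶ M'} (g : N ⟶ N₂) :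
    preLam (f ≫ k) (p ≫ g) = (f ▷⊚ H.A) ≫ preLam k p ≫ (g ▷⊙ H.A) := by
  rw [preLam, preLam, bR_comp, cR_comp, Category.assoc, Category.assoc, Category.assoc]

end LiftedTensor

/-! ### The comonad morphism `λ`. -/

section Lambda

variable {C : Type u} [Category.{v} C] [Duoidal C] {H : MonComon C} {L : Splitting (sqcapL H)}
  (hH : IsWeakBimonoid H) (K : Lifting (baseData L)) (R : WeakLifting (hopfData H))
  (T : TensorOver L)

/-- The composite of `λ_P` with the projection `(P • I) ∘ A ⟶ (P • I) ∘_L A` and the inclusion into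
`(P ∘_L A) • A`. -/
def lamAux (P : RMod (baseData L)) :
    (K.G.obj P).carrier ⊚ H.A ⟶ (T.W.obj P).carrier ⊙ (hopfData H).Y :=
  preLam (K.ι P) (T.π P)

theorem Splitting.epi_cR {X : C} {e : X ⟶ X} (S : Splitting e) (Z : C) : Epi (S.π ▷⊚ Z) :=
  ⟨fun _ _ w => S.cR_π_cancel w⟩

theorem WeakLifting.linear_of_comp {D : MixedData C} (R : WeakLifting D) (h : D.Law)
    {X U Q : RMod D} (p : X ⟶ U) [Epi (p.hom ▷⊚ D.X)] {l : X.carrier ⟶ Q.carrier ⊙ D.Y}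
    (hl : X.act ≫ l = (l ▷⊚ D.X) ≫ D.nuAct Q) {g : U.carrier ⟶ (R.G.obj Q).carrier}
    (hg : p.hom ≫ g ≫ R.ι Q = l) : U.act ≫ g = (g ▷⊚ D.X) ≫ (R.G.obj Q).act := by
  refine R.ι_cancel h Q ?_
  rw [← cancel_epi (p.hom ▷⊚ D.X), Category.assoc, Category.assoc, R.act_ι h,
    ← reassoc_of% p.linear, hg, hl, ← hg, cR_comp, cR_comp]
  simp only [Category.assoc]

/-- Both composites are compared inside `N • (A • A)`: one becomes `x` followed by the
comultiplication of `A`, the other becomes the iterated map `y`, and `h7` equates them. -/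
theorem comul_aux {A N X X' U U' V V' V₂ : C} {D : A ⟶ A ⊙ A} {p : X ⟶ U} {l : U ⟶ V}
    {i : V ⟶ N ⊙ A} {x : X ⟶ N ⊙ A} {d : V ⟶ V₂} {i₂ : V₂ ⟶ V ⊙ A} {d' : U ⟶ U'} {p' : X' ⟶ U'}
    {s : X ⟶ X'} {l' : U' ⟶ V'} {i' : V' ⟶ U ⊙ A} {x' : X' ⟶ U ⊙ A} {m : V' ⟶ V₂}
    {y : X ⟶ (N ⊙ A) ⊙ A}
    (h1 : p ≫ l ≫ i = x) (h2 : d ≫ i₂ ≫ (i ▷⊙ A) ≫ (bAs N A A).hom = i ≫ (N ⊙◁ D))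
    (h3 : s ≫ p' = p ≫ d') (h4 : p' ≫ l' ≫ i' = x') (h5 : m ≫ i₂ = i' ≫ (l ▷⊙ A))
    (h6 : s ≫ x' ≫ ((l ≫ i) ▷⊙ A) = y) (h7 : y ≫ (bAs N A A).hom = x ≫ (N ⊙◁ D)) :
    p ≫ (l ≫ d) ≫ i₂ ≫ (i ▷⊙ A) = p ≫ (d' ≫ l' ≫ m) ≫ i₂ ≫ (i ▷⊙ A) := by
  rw [← cancel_mono (bAs N A A).hom]
  simp only [Category.assoc]
  rw [h2, reassoc_of% h1, ← h7, ← h6, reassoc_of% h5, ← reassoc_of% h3, reassoc_of% h4, bR_comp]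
  simp only [Category.assoc]

/-- A linear map out of a unital action satisfies `f(m) 1 = f(m 1) = f(m)`, so it lands in the image
of the idempotent. -/
theorem lamAux_idem {D : MixedData C} {M : C} {Q : RMod D} {b : M ⊚ D.X ⟶ M}
    (hb : (M ⊚◁ D.one) ≫ b = (cRu M).hom) {f : M ⟶ Q.carrier ⊙ D.Y}
    (hf : b ≫ f = (f ▷⊚ D.X) ≫ D.nuAct Q) : f ≫ D.idem Q = f := by
  rw [MixedData.idem, cRu_inv_nat_assoc, ← c_exch_assoc, ← hf, reassoc_of% hb, Iso.inv_hom_id_assoc]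

include hH in
theorem lamAux_linear (P : RMod (baseData L)) :
    (freeMod H (K.G.obj P).carrier).act ≫ lamAux K T P =
      (lamAux K T P ▷⊚ (hopfData H).X) ≫ (hopfData H).nuAct (T.W.obj P) :=
  preLam_linear hH.right.wb (T.linear P)

include hH in
theorem lamAux_comp_idem (P : RMod (baseData L)) :
    lamAux K T P ≫ (hopfData H).idem (T.W.obj P) = lamAux K T P :=
  lamAux_idem (freeMod H (K.G.obj P).carrier).act_one (lamAux_linear hH K T P)

include hH in
theorem lamAux_balanced (P : RMod (baseData L)) :
    Balanced (L := L) (K.G.obj P).act (lamAux K T P) :=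
  preLam_balanced hH (K.act_ι (baseData_law L hH) P) (T.balanced P)

theorem lambda0_eq (M : C) :
    lambda0 R M = entw H.Δ (cLu H.A).hom M ≫ R.π (freeMod H M) := by
  have h1 : ∀ {X Y Z W V : C} (f : X ⟶ Y) (g : Y ⟶ Z) (h : Z ⟶ W) (k : W ⟶ V),
      f ≫ g ≫ h ≫ k = (f ≫ g ≫ h) ≫ k := by simp
  exact h1 _ _ _ _

/-- Naturality of `R.π` in the projection `P ∘ A ⟶ P ∘_L A` moves the projection before the
splitting; the defining formula of `λ` then involves only `lamAux`. -/
theorem lambda0_map (P : RMod (baseData L)) :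
    (K.ι P ▷⊚ H.A) ≫ lambda0 R P.carrier ≫ (R.G.map (T.πHom P)).hom =
      lamAux K T P ≫ R.π (T.W.obj P) := by
  have h1 : (T.π P ▷⊙ H.A) ≫ R.π (T.W.obj P) =
      R.π (freeMod H P.carrier) ≫ (R.G.map (T.πHom P)).hom := R.π_natural (T.πHom P)
  have h2 : ∀ {X Y Z W V U : C} {f : X ⟶ Y} {g : Y ⟶ Z} {h : Z ⟶ W} {k : W ⟶ V} {h' : Z ⟶ U}
      {k' : U ⟶ V}, h' ≫ k' = h ≫ k → f ≫ (g ≫ h) ≫ k = (f ≫ g ≫ h') ≫ k' := fun w => by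
    simp [w]
  rw [lambda0_eq]
  exact h2 h1

/-- The underlying morphism of `λ_P`. -/
noncomputable def lamHom (P : RMod (baseData L)) :
    (T.W.obj (K.G.obj P)).carrier ⟶ (R.G.obj (T.W.obj P)).carrier :=
  (T.splitting hH (K.G.obj P)).ι ≫ lamAux K T P ≫ R.π (T.W.obj P)

theorem π_lamHom (P : RMod (baseData L)) :
    T.π (K.G.obj P) ≫ lamHom hH K R T P = lamAux K T P ≫ R.π (T.W.obj P) :=
  tensor_fac hH (T.splitting hH) ((lamAux_balanced hH K T P).comp _)

/-- Since `lamAux` lands in the image of the idempotent, passing through `R.π` and `R.ι` does not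
change it. As `T.π` is epi and `R.ι` is monic, every property of `λ` reduces to one of `preLam`. -/
theorem π_lamHom_ι (P : RMod (baseData L)) :
    T.π (K.G.obj P) ≫ lamHom hH K R T P ≫ R.ι (T.W.obj P) = lamAux K T P := by
  rw [reassoc_of% π_lamHom hH K R T P, R.π_ι_eq, lamAux_comp_idem hH]

include hH in
theorem lam_cancel {P : RMod (baseData L)} {Q : RMod (hopfData H)}
    {f g : (T.W.obj P).carrier ⟶ (R.G.obj Q).carrier}
    (w : T.π P ≫ f ≫ R.ι Q = T.π P ≫ g ≫ R.ι Q) : f = g := by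
  have := T.epi_π P
  rw [cancel_epi] at w
  exact R.ι_cancel (hopfData_law hH) Q w

theorem lamHom_linear (P : RMod (baseData L)) :
    (T.W.obj (K.G.obj P)).act ≫ lamHom hH K R T P =
      (lamHom hH K R T P ▷⊚ (hopfData H).X) ≫ (R.G.obj (T.W.obj P)).act := by
  have h1 : Epi ((T.πHom (K.G.obj P)).hom ▷⊚ (hopfData H).X) :=
    (T.splitting hH (K.G.obj P)).epi_cR _
  exact R.linear_of_comp (hopfData_law hH) (T.πHom (K.G.obj P)) (lamAux_linear hH K T P)
    (π_lamHom_ι hH K R T P)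

/-- The comonad morphism `λ`. -/
noncomputable def lam : K.G.toFunctor ⋙ T.W ⟶ T.W ⋙ R.G.toFunctor where
  app P :=
    { hom := lamHom hH K R T P
      linear := lamHom_linear hH K R T P }
  naturality P Q f := RMod.hom_ext <| lam_cancel hH R T <| by
    have h1 : ((K.G.map f).hom ▷⊚ H.A) ≫ lamAux K T Q =
        lamAux K T P ≫ ((T.W.map f).hom ▷⊙ (hopfData H).Y) :=
      preLam_natural (K.ι_natural f) (T.natural f)
    have h2 := π_lamHom_ι hH K R T P
    have h3 := π_lamHom_ι hH K R T Q
    have h4 := T.natural (K.G.map f)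
    have h5 := R.ι_natural (T.W.map f)
    change T.π (K.G.obj P) ≫ ((T.W.map (K.G.map f)).hom ≫ lamHom hH K R T Q) ≫ R.ι (T.W.obj Q) =
      T.π (K.G.obj P) ≫ (lamHom hH K R T P ≫ (R.G.map (T.W.map f)).hom) ≫ R.ι (T.W.obj Q)
    rw [Category.assoc, Category.assoc, h5, ← reassoc_of% h4, h3, reassoc_of% h2, h1]

theorem eq_lam_iff (P : RMod (baseData L))
    (g : (T.W.obj (K.G.obj P)).carrier ⟶ (R.G.obj (T.W.obj P)).carrier) :
    T.π (K.G.obj P) ≫ g =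
        (K.ι P ▷⊚ H.A) ≫ lambda0 R P.carrier ≫ (R.G.map (T.πHom P)).hom ↔
      g = ((lam hH K R T).app P).hom := by
  have := T.epi_π (K.G.obj P)
  rw [lambda0_map, ← π_lamHom hH K R T P, cancel_epi]
  rfl

theorem isComonadMorphism_lam : IsComonadMorphism K.G R.G T.W (lam hH K R T) where
  counit P := RMod.hom_ext <| by
    have := T.epi_π (K.G.obj P)
    rw [← cancel_epi (T.π (K.G.obj P))]
    have h1 : lamAux K T P ≫ (_ ⊙◁ (hopfData H).counit) ≫ (bRu _).hom = _ ≫ T.π P :=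
      preLam_counit
    have h2 := π_lamHom_ι hH K R T P
    have h3 := R.counit_eq (T.W.obj P)
    have h4 := T.natural (K.G.ε.app P)
    have h5 := K.counit_eq P
    change T.π (K.G.obj P) ≫ lamHom hH K R T P ≫ (R.G.ε.app (T.W.obj P)).hom =
      T.π (K.G.obj P) ≫ (T.W.map (K.G.ε.app P)).hom
    rw [h3, reassoc_of% h2, h1]
    refine Eq.trans ?_ h4
    rw [h5]
    rfl
  comul P := RMod.hom_ext <| by
    have h0 := T.epi_π (K.G.obj P)
    have h7 : preLam ((K.G.δ.app P).hom ≫ K.ι (K.G.obj P)) (lamAux K T P) ≫ (bAs _ _ _).hom =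
        lamAux K T P ≫ (_ ⊙◁ (hopfData H).comul) := preLam_comul (by
          exact (Category.assoc _ _ _).trans (K.comul_eq P))
    have h8 : ((K.G.δ.app P).hom ▷⊚ H.A) ≫ lamAux K T (K.G.obj P) ≫
        ((lamHom hH K R T P ≫ R.ι (T.W.obj P)) ▷⊙ H.A) =
        preLam ((K.G.δ.app P).hom ≫ K.ι (K.G.obj P)) (lamAux K T P) := by
      rw [← π_lamHom_ι hH K R T P]
      exact (preLam_comp₂ _).symm
    refine R.ιι_cancel (hopfData_law hH) _ ?_
    rw [← cancel_epi (T.π (K.G.obj P))]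
    exact comul_aux (π_lamHom_ι hH K R T P) (R.comul_eq (T.W.obj P)) (T.natural (K.G.δ.app P))
      (π_lamHom_ι hH K R T (K.G.obj P)) (R.ι_natural ((lam hH K R T).app P))
      h8 h7

end Lambda

/-! ### The functor on mixed modules induced by a comonad morphism. -/

section LiftedFunctor

/-- Naturality of `l` at `r` and functoriality of `W` transport the two coalgebra laws. -/
theorem IsComonadMorphism.coalgebra {B : Type*} [Category B] {E : Type*} [Category E]
    {K : Comonad B} {G : Comonad E} {W : B ⥤ E} {l : K.toFunctor ⋙ W ⟶ W ⋙ G.toFunctor}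
    (hl : IsComonadMorphism K G W l) {P : B} {r : P ⟶ K.obj P} (h1 : r ≫ K.ε.app P = 𝟙 P)
    (h2 : r ≫ K.δ.app P = r ≫ K.map r) :
    (W.map r ≫ l.app P) ≫ G.ε.app (W.obj P) = 𝟙 (W.obj P) ∧
      (W.map r ≫ l.app P) ≫ G.δ.app (W.obj P) =
        (W.map r ≫ l.app P) ≫ G.map (W.map r ≫ l.app P) := by
  have h3 := l.naturality r
  have h4 : W.map (K.map r) ≫ l.app (K.obj P) = l.app P ≫ G.map (W.map r) := h3
  constructor
  · rw [Category.assoc, hl.counit, ← W.map_comp, h1, W.map_id]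
  · have h5 := congrArg W.map h2
    rw [W.map_comp, W.map_comp] at h5
    rw [Category.assoc, hl.comul, reassoc_of% h5, reassoc_of% h4, G.map_comp, Category.assoc]

variable {C : Type u} [Category.{v} C] [TwoMonoidal C] {D D' : MixedData C} {K : WeakLifting D}
  {R : WeakLifting D'} {W : RMod D ⥤ RMod D'} {l : K.G.toFunctor ⋙ W ⟶ W ⋙ R.G.toFunctor}
  (hD : D.Law) (hD' : D'.Law) (hl : IsComonadMorphism K.G R.G W l)

/-- The coalgebra structure induced by a comonad morphism on the image of a mixed module. -/
def liftCoalg (l : K.G.toFunctor ⋙ W ⟶ W ⋙ R.G.toFunctor) (P : MixedMod D) :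
    W.obj P.toRMod ⟶ R.G.obj (W.obj P.toRMod) :=
  W.map (K.coalg hD P) ≫ l.app P.toRMod

include hl hD' in
theorem isMixedCoaction_liftCoalg (P : MixedMod D) : IsMixedCoaction (W.obj P.toRMod)
    ((liftCoalg hD l P).hom ≫ R.ι (W.obj P.toRMod)) := by
  obtain ⟨h1, h2⟩ := hl.coalgebra (P.isMixed.toHom_counit K hD) (P.isMixed.toHom_comul K hD)
  exact R.isMixedCoaction hD' _ h1 h2

theorem liftCoalg_natural {P Q : MixedMod D} (f : P ⟶ Q) :
    W.map (MixedMod.homToRMod f) ≫ liftCoalg hD l Q =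
      liftCoalg hD l P ≫ R.G.map (W.map (MixedMod.homToRMod f)) := by
  have h1 : W.map (K.G.map (MixedMod.homToRMod f)) ≫ l.app Q.toRMod =
    l.app P.toRMod ≫ R.G.map (W.map (MixedMod.homToRMod f)) := l.naturality (MixedMod.homToRMod f)
  rw [liftCoalg, liftCoalg, ← W.map_comp_assoc, ← K.coalg_natural hD, W.map_comp, Category.assoc,
    Category.assoc, h1]

/-- The functor between the categories of mixed modules induced by a comonad morphism. -/
def liftFunctor : MixedMod D ⥤ MixedMod D' where
  obj P := ⟨W.obj P.toRMod, (liftCoalg hD l P).hom ≫ R.ι (W.obj P.toRMod),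
    isMixedCoaction_liftCoalg hD hD' hl P⟩
  map {P Q} f :=
    { hom := (W.map (MixedMod.homToRMod f)).hom
      linear := (W.map (MixedMod.homToRMod f)).linear
      colinear := by
        have h1 := congrArg RMod.Hom.hom (liftCoalg_natural hD (l := l) f)
        have h2 := R.ι_natural (W.map (MixedMod.homToRMod f))
        rw [RMod.comp_hom, RMod.comp_hom] at h1
        change _ ≫ (liftCoalg hD l Q).hom ≫ R.ι (W.obj Q.toRMod) =
          ((liftCoalg hD l P).hom ≫ R.ι (W.obj P.toRMod)) ≫ _
        rw [reassoc_of% h1, h2, Category.assoc] }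
  map_id P := MixedMod.hom_ext (congrArg RMod.Hom.hom (W.map_id P.toRMod))
  map_comp f g := MixedMod.hom_ext
    (congrArg RMod.Hom.hom (W.map_comp (MixedMod.homToRMod f) (MixedMod.homToRMod g)))

end LiftedFunctor

end Duo

theorem mainTheorem7 {C : Type u} [Category.{v} C] [Duo.Duoidal C] [IsIdempotentComplete C]
    (H : Duo.MonComon C) (hH : Duo.IsWeakBimonoid H) :
    -- the weakly lifted comonad `(-) •_R A` on the category of right `A`-modules exists
    Nonempty (Duo.WeakLifting (Duo.hopfData H)) ∧
    -- the base object `L` exists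
    Nonempty (Duo.Splitting (Duo.sqcapL H)) ∧
    ∀ L : Duo.Splitting (Duo.sqcapL H),
      Duo.IsComoduleMonoid L ∧
      -- the comonad `(-) • I` on the category of right `L`-modules exists
      Nonempty (Duo.Lifting (Duo.baseData L)) ∧
      -- the functor `(-) ∘_L A` exists
      Nonempty (Duo.TensorOver L) ∧
      -- the forgetful functors are comonadic
      Nonempty (ComonadicLeftAdjoint (Duo.MixedMod.forget (Duo.baseData L))) ∧
      Nonempty (ComonadicLeftAdjoint (Duo.MixedMod.forget (Duo.hopfData H))) ∧
      ∀ (K : Duo.Lifting (Duo.baseData L)) (R : Duo.WeakLifting (Duo.hopfData H))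
        (T : Duo.TensorOver L),
        -- the comonad morphism `λ_P : (P • I) ∘_L A ⟶ (P ∘_L A) •_R A`
        ∃ lam : K.G.toFunctor ⋙ T.W ⟶ T.W ⋙ R.G.toFunctor,
          Duo.IsComonadMorphism K.G R.G T.W lam ∧
          (∀ (P : Duo.RMod (Duo.baseData L))
            (g : (T.W.obj (K.G.obj P)).carrier ⟶ (R.G.obj (T.W.obj P)).carrier),
            T.π (K.G.obj P) ≫ g =
                Duo.cR (K.ι P) H.A ≫ Duo.lambda0 R P.carrier ≫ (R.G.map (T.πHom P)).hom ↔
              g = (lam.app P).hom) ∧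
          -- the lifted functor, whose coaction is induced by `λ`
          ∃ F : Duo.MixedMod (Duo.baseData L) ⥤ Duo.MixedMod (Duo.hopfData H),
            F ⋙ Duo.MixedMod.forget (Duo.hopfData H) =
              Duo.MixedMod.forget (Duo.baseData L) ⋙ T.W ∧
            ∀ P : Duo.MixedMod (Duo.baseData L),
              ∃ r : P.toRMod ⟶ K.G.obj P.toRMod, r.hom ≫ K.ι P.toRMod = P.coact ∧
                ∃ h : Duo.IsMixedCoaction (T.W.obj P.toRMod)
                    ((T.W.map r ≫ lam.app P.toRMod).hom ≫ R.ι (T.W.obj P.toRMod)),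
                  F.obj P = ⟨T.W.obj P.toRMod,
                    (T.W.map r ≫ lam.app P.toRMod).hom ≫ R.ι (T.W.obj P.toRMod), h⟩ := by
  have hA := Duo.hopfData_law hH
  obtain ⟨R₀⟩ := hA.nonempty_weakLifting
  refine ⟨⟨R₀⟩, Duo.exists_splitting hH.sqcapL_sqcapL, fun L => ?_⟩
  have hL := Duo.baseData_law L hH
  obtain ⟨K₀⟩ := hL.nonempty_lifting (Duo.baseData_idem L hH)
  refine ⟨hH.isComoduleMonoid L, ⟨K₀⟩, Duo.nonempty_tensorOver hH,
    K₀.toWeakLifting.nonempty_comonadic hL, R₀.nonempty_comonadic hA, fun K R T => ?_⟩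
  have hl := Duo.isComonadMorphism_lam hH K R T
  -- The lifted functor keeps the underlying module and the underlying maps of `T.W`, so both
  -- required equalities hold by definition.
  exact ⟨Duo.lam hH K R T, hl, Duo.eq_lam_iff hH K R T, Duo.liftFunctor hL hA hl, rfl, fun P =>
    ⟨K.coalg hL P, K.coalg_ι hL P, Duo.isMixedCoaction_liftCoalg hL hA hl P, rfl⟩⟩
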